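/- Let $k$ be a field, let $(a_{ij})_{i,j\in I}$, $I=\{1,\dots,n\}$, $n\ge 1$, be a symmetrizable generalized Cartan matrix with Kac–Moody algebra $\mathfrak g$, and let $d_i$ $(i\in I)$ be relatively prime positive integers such that $(d_ia_{ij})$ is symmetric. Let $\zeta\in k\setminus\{0,1,-1\}$ ($\zeta$ may be a root of unity). For $i\ne j$ put $$p_{ij}(x,y)=\sum_{r=0}^{1-a_{ij}}(-1)^r\zeta^{-d_ir(1-a_{ij}-r)}\binom{1-a_{ij}}{r}_{\zeta^{2d_i}}x^{1-a_{ij}-r}\,y\,x^r ,$$ where $\binom{m}{r}_\xi\in\mathbb Z[\xi]$ is the (non-symmetric) $\xi$-binomial coefficient. Let $U=U_\zeta(\mathfrak g')$ be the $k$-algebra with generators $E_i,F_i,K_i^{\pm1}$ $(i\in I)$ and relations $K_iK_i^{-1}=K_i^{-1}K_i=1$, $K_iK_j=K_jK_i$, $K_iE_j=\zeta^{d_ia_{ij}}E_jK_i$, $K_iF_j=\zeta^{-d_ia_{ij}}F_jK_i$, $E_iF_j-F_jE_i=\delta_{ij}(K_i-K_i^{-1})$ for all $i,j$, and $p_{ij}(E_i,E_j)=p_{ij}(F_i,F_j)=0$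 for $i\ne j$. Let $U^{+},U^{-},G^-,H\subset U$ be the subalgebras generated by the $E_i$, by the $F_i$, by the $F_iK_i$ and by the $K_i^{\pm1}$, respectively. For $\alpha,\beta\in\mathbb N^n$ let $U^+_\alpha$ (resp. $U^-_{-\beta}$) be the span of the products of the $E_i$ (resp. the $F_i$) in which each index $i$ occurs $\alpha_i$ (resp. $\beta_i$) times. For $\lambda\in\mathbb Z^n$ put $K_\lambda=K_1^{\lambda_1}\cdots K_n^{\lambda_n}$, and let $\alpha_1,\dots,\alpha_n$ be the standard basis of $\mathbb Z^n$. There are direct sum decompositions $$U=\bigoplus_{\lambda\in\mathbb Z^n}U^+K_\lambda G^-,\qquad U=\bigoplus_{\alpha,\beta\in\mathbb N^n}U^+_\alpha HU^-_{-\beta};$$ let $P_\lambda$ and $\pi_{\alpha,\beta}$ denote the corresponding projections of $U$ onto $U^+K_\lambda G^-$ and $U^+_\alpha HU^-_{-\beta}$. Let $\tau:I\to I$ be an involutive diagram automorphism: $\tau^2=\mathrm{id}$ and $a_{\tau(i)\tau(j)}=a_{ij}$ for all $i,j$. Assume that $\zeta^{d_{\tau(i)}a_{\tau(i)\tau(j)}}=\zeta^{d_ia_{ij}}$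 for all $i,j$ (which is automatic if the Cartan matrix is indecomposable). Let $\mathbf c=(c_1,\dots,c_n)\in k^n$. Let $H_\theta\subset H$ be the subalgebra generated by the elements $K_iK_{\tau(i)}^{-1}$ $(i\in I)$, let $H_\theta\ltimes U^-\subset U$ be the subalgebra generated by $H_\theta$ and $U^-$, and let $B_{\mathbf c}\subset U$ be the subalgebra generated by $H_\theta$ and the elements $B_i=F_i+c_iE_{\tau(i)}K_i^{-1}$ $(i\in I)$. Filter $B_{\mathbf c}$ by $\deg B_i=1$ for $i\in I$ and $\deg h=0$ for $h\in H_\theta$, and let $\mathrm{gr}(B_{\mathbf c})$ be the associated graded algebra. (i) Let $i\neq j$. If $a_{ij}\neq0$ or $\tau(i)\ne j$, then $\pi_{0,0}\circ P_{-\lambda}(p_{ij}(B_i,B_j))=0$ for $\lambda=(1-a_{ij})\alpha_i+\alpha_j$. If $a_{ij}=0$ and $\tau(i)=j$, then $$P_{-\alpha_i-\alpha_j}\circ\pi_{0,0}(p_{ij}(B_i,B_j))=(c_j-c_i)K_i^{-1}K_j^{-1}.$$ (ii) There is a unique algebra homomorphism $\varphi:\mathrm{gr}(B_{\mathbf c})\to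 H_\theta\ltimes U^-$ with $\varphi(B_i)=F_i$ for all $i\in I$ and $\varphi(h)=h$ for all $h\in H_\theta$. It is surjective, and it is an isomorphism if and only if $c_i=c_{\tau(i)}$ for all $i\in I$ with $a_{i\tau(i)}=0$. -/

import Mathlib

open scoped DirectSum

noncomputable section

namespace QuantumPair

/-! ### Filtered algebras and their associated graded algebras -/

section Graded

/-- An increasing `ℕ`-filtration of a `k`-algebra by subspaces,
compatible with the product. -/
structure AlgFiltration (k A : Type*) [Field k] [Ring A] [Algebra k A] where
  /-- the filtered pieces -/
  piece : ℕ → Submodule k A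
  mono : ∀ {i j : ℕ}, i ≤ j → piece i ≤ piece j
  one_mem : (1 : A) ∈ piece 0
  mul_mem : ∀ {i j : ℕ} {x y : A}, x ∈ piece i → y ∈ piece j → x * y ∈ piece (i + j)

variable {k A : Type*} [Field k] [Ring A] [Algebra k A] (Φ : AlgFiltration k A)

namespace AlgFiltration

/-- The preceding piece `Φ_{m-1}`, with `Φ_{-1} = 0`. -/
def prev : ℕ → Submodule k A
  | 0 => ⊥
  | m + 1 => Φ.piece m

theorem mul_prev {i j : ℕ} {x y : A} (hx : x ∈ Φ.piece i) (hy : y ∈ Φ.prev j) :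
    x * y ∈ Φ.prev (i + j) := by
  cases j with
  | zero =>
    have h0 : y = 0 := by simpa [prev] using hy
    simp [h0]
  | succ j => exact Φ.mul_mem hx hy

theorem prev_mul {i j : ℕ} {x y : A} (hx : x ∈ Φ.prev i) (hy : y ∈ Φ.piece j) :
    x * y ∈ Φ.prev (i + j) := by
  cases i with
  | zero =>
    have h0 : x = 0 := by simpa [prev] using hx
    simp [h0]
  | succ i =>
    have h := Φ.mul_mem (i := i) hx hy
    rw [show i + 1 + j = (i + j) + 1 by omega]
    exact h

/-- The `m`-th homogeneous component `Φ_m / Φ_{m-1}` of the associated graded algebra. -/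
def Comp (m : ℕ) : Type _ := Φ.piece m ⧸ (Φ.prev m).comap (Φ.piece m).subtype

instance (m : ℕ) : AddCommGroup (Φ.Comp m) :=
  inferInstanceAs (AddCommGroup (Φ.piece m ⧸ (Φ.prev m).comap (Φ.piece m).subtype))

instance (m : ℕ) : Module k (Φ.Comp m) :=
  inferInstanceAs (Module k (Φ.piece m ⧸ (Φ.prev m).comap (Φ.piece m).subtype))

/-- The class in `Φ_m / Φ_{m-1}` of an element of `Φ_m`. -/
def cls (m : ℕ) : Φ.piece m →ₗ[k] Φ.Comp m :=
  Submodule.mkQ ((Φ.prev m).comap (Φ.piece m).subtype)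

/-- The product `Φ_i × Φ_j → Φ_{i+j}`. -/
def pieceMul (i j : ℕ) : Φ.piece i →ₗ[k] Φ.piece j →ₗ[k] Φ.piece (i + j) :=
  LinearMap.mk₂ k (fun x y => ⟨(x : A) * y, Φ.mul_mem x.2 y.2⟩)
    (fun x x' y => Subtype.ext (by simp [add_mul]))
    (fun r x y => Subtype.ext (by simp))
    (fun x y y' => Subtype.ext (by simp [mul_add]))
    (fun r x y => Subtype.ext (by simp))

/-- The induced product `Φ_i/Φ_{i-1} × Φ_j/Φ_{j-1} → Φ_{i+j}/Φ_{i+j-1}`. -/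
def compMul (i j : ℕ) : Φ.Comp i →ₗ[k] Φ.Comp j →ₗ[k] Φ.Comp (i + j) :=
  Submodule.liftQ _
    (LinearMap.flip (Submodule.liftQ _
      (LinearMap.flip ((Φ.pieceMul i j).compr₂ (Φ.cls (i + j))))
      (by
        intro y hy
        rw [LinearMap.mem_ker]
        ext x
        exact (Submodule.Quotient.mk_eq_zero _).2 (Φ.mul_prev x.2 hy))))
    (by
      intro x hx
      rw [LinearMap.mem_ker]
      refine LinearMap.ext fun y => ?_
      induction y using Submodule.Quotient.induction_on with
      | _ y => exact (Submodule.Quotient.mk_eq_zero _).2 (Φ.prev_mul hx y.2))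

theorem cls_surjective (m : ℕ) : Function.Surjective (Φ.cls m) := Submodule.mkQ_surjective _

theorem compMul_cls {i j : ℕ} (x : Φ.piece i) (y : Φ.piece j) :
    Φ.compMul i j (Φ.cls i x) (Φ.cls j y) =
      Φ.cls (i + j) ⟨(x : A) * y, Φ.mul_mem x.2 y.2⟩ := rfl

theorem sigma_eq {i j : ℕ} (h : i = j) (x : Φ.piece i) (y : Φ.piece j) (hxy : (x : A) = y) :
    (⟨i, Φ.cls i x⟩ : GradedMonoid Φ.Comp) = ⟨j, Φ.cls j y⟩ := by
  subst h
  rw [Subtype.ext hxy]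

instance gOne : GradedMonoid.GOne Φ.Comp where
  one := Φ.cls 0 ⟨1, Φ.one_mem⟩

instance gMul : GradedMonoid.GMul Φ.Comp where
  mul {i j} x y := Φ.compMul i j x y

instance gRing : DirectSum.GRing Φ.Comp where
  mul_zero x := map_zero _
  zero_mul x := LinearMap.map_zero₂ _ _
  mul_add x y z := map_add _ _ _
  add_mul x y z := LinearMap.map_add₂ _ _ _ _
  one_mul := by
    rintro ⟨i, x⟩
    obtain ⟨x, rfl⟩ := Φ.cls_surjective i x
    exact Φ.sigma_eq (zero_add i) _ x (one_mul _)
  mul_one := by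
    rintro ⟨i, x⟩
    obtain ⟨x, rfl⟩ := Φ.cls_surjective i x
    exact Φ.sigma_eq (add_zero i) _ x (mul_one _)
  mul_assoc := by
    rintro ⟨i, x⟩ ⟨j, y⟩ ⟨l, z⟩
    obtain ⟨x, rfl⟩ := Φ.cls_surjective i x
    obtain ⟨y, rfl⟩ := Φ.cls_surjective j y
    obtain ⟨z, rfl⟩ := Φ.cls_surjective l z
    exact Φ.sigma_eq (add_assoc i j l) ⟨(x : A) * y * z, _⟩ ⟨(x : A) * (y * z), _⟩
      (mul_assoc _ _ _)
  natCast m := m • Φ.cls 0 ⟨1, Φ.one_mem⟩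
  natCast_zero := zero_smul _ _
  natCast_succ m := by
    rw [add_smul, one_smul]
    rfl
  intCast m := m • Φ.cls 0 ⟨1, Φ.one_mem⟩
  intCast_ofNat m := by
    rw [natCast_zsmul]
  intCast_negSucc_ofNat m := by
    rw [negSucc_zsmul]

instance gAlgebra : DirectSum.GAlgebra k Φ.Comp where
  toFun := (LinearMap.toSpanSingleton k (Φ.Comp 0) (Φ.cls 0 ⟨1, Φ.one_mem⟩)).toAddMonoidHom
  map_one := one_smul k (Φ.cls 0 ⟨1, Φ.one_mem⟩)
  map_mul r s :=
    Φ.sigma_eq (add_zero 0).symm ((r * s) • ⟨1, Φ.one_mem⟩)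
      ⟨(r • (1 : A)) * (s • (1 : A)), Φ.mul_mem (Submodule.smul_mem _ r Φ.one_mem)
        (Submodule.smul_mem _ s Φ.one_mem)⟩ (by simp [smul_smul, mul_comm])
  commutes := by
    rintro r ⟨i, x⟩
    obtain ⟨x, rfl⟩ := Φ.cls_surjective i x
    exact Φ.sigma_eq ((zero_add i).trans (add_zero i).symm)
      ⟨(r • (1 : A)) * (x : A), Φ.mul_mem (Submodule.smul_mem _ r Φ.one_mem) x.2⟩
      ⟨(x : A) * (r • (1 : A)), Φ.mul_mem x.2 (Submodule.smul_mem _ r Φ.one_mem)⟩ (by simp)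
  smul_def := by
    rintro r ⟨i, x⟩
    obtain ⟨x, rfl⟩ := Φ.cls_surjective i x
    exact Φ.sigma_eq (zero_add i).symm (r • x)
      ⟨(r • (1 : A)) * (x : A), Φ.mul_mem (Submodule.smul_mem _ r Φ.one_mem) x.2⟩ (by simp)

/-- The associated graded algebra `⨁_m Φ_m / Φ_{m-1}`. -/
abbrev Gr : Type _ := ⨁ m, Φ.Comp m

/-- The image in `gr` of an element of `Φ_m`, in degree `m`. -/
def symbol (m : ℕ) (x : Φ.piece m) : Φ.Gr := DirectSum.of Φ.Comp m (Φ.cls m x)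

end AlgFiltration

/-- The canonical projection onto the `i`-th summand of a direct sum decomposition
`M = ⨁ i, W i` (and `0` if the family `W` is not a direct sum decomposition of `M`). -/
def directProj {k M ι : Type*} [Field k] [AddCommGroup M] [Module k M] [DecidableEq ι]
    (W : ι → Submodule k M) (i : ι) : M →ₗ[k] M :=
  open scoped Classical in
  if h : DirectSum.IsInternal W then
    (W i).subtype ∘ₗ DirectSum.component k ι (fun j => W j) i ∘ₗ
      (LinearEquiv.ofBijective (DirectSum.coeLinearMap W) h).symm.toLinearMap
  else 0

end Graded

/-! ### The quantized enveloping algebra -/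

/-- `a` is a symmetrizable generalized Cartan matrix, symmetrized by the relatively prime
positive integers `d i`. -/
structure IsSymmetrizableGCM {n : ℕ} (a : Matrix (Fin n) (Fin n) ℤ) (d : Fin n → ℕ) : Prop where
  diag : ∀ i, a i i = 2
  offDiag : ∀ i j, i ≠ j → a i j ≤ 0
  zero_symm : ∀ i j, a i j = 0 → a j i = 0
  pos : ∀ i, 0 < d i
  coprime : Finset.univ.gcd d = 1
  symm : ∀ i j, (d i : ℤ) * a i j = d j * a j i

/-- The `ξ`-binomial coefficient, by the `ξ`-Pascal rule; it is a polynomial in `ξ`. -/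
def xiBinom {k : Type*} [Field k] (ξ : k) : ℕ → ℕ → k
  | _, 0 => 1
  | 0, _ + 1 => 0
  | m + 1, r + 1 => xiBinom ξ m r + ξ ^ (r + 1) * xiBinom ξ m (r + 1)

/-- The quantum Serre polynomial `p_{ij}(x, y)`, where `e = d_i` and `b = a_{ij} ≤ 0`. -/
def serre {k : Type*} [Field k] (ζ : kˣ) (e : ℕ) (b : ℤ) {A : Type*} [Ring A] [Algebra k A]
    (x y : A) : A :=
  ∑ r ∈ Finset.range ((1 - b).toNat + 1),
    ((-1 : k) ^ r * ((ζ ^ (-((e : ℤ) * r * (1 - b - r))) : kˣ) : k) *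
      xiBinom ((ζ : k) ^ (2 * e)) (1 - b).toNat r) •
      (x ^ ((1 - b).toNat - r) * y * x ^ r)

/-- The generators of the quantized enveloping algebra. -/
inductive Gen (n : ℕ) : Type
  | E (i : Fin n)
  | F (i : Fin n)
  | K (i : Fin n)
  | Kinv (i : Fin n)

section Algebra

variable {k : Type*} [Field k] {n : ℕ}

/-- The generators as elements of the free algebra. -/
def gen (x : Gen n) : FreeAlgebra k (Gen n) := FreeAlgebra.ι k x

/-- The defining relations of `U_ζ(𝔤')`. -/
inductive Rel (a : Matrix (Fin n) (Fin n) ℤ) (d : Fin n → ℕ) (ζ : kˣ) :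
    FreeAlgebra k (Gen n) → FreeAlgebra k (Gen n) → Prop
  | K_mul_Kinv (i) : Rel a d ζ (gen (.K i) * gen (.Kinv i)) 1
  | Kinv_mul_K (i) : Rel a d ζ (gen (.Kinv i) * gen (.K i)) 1
  | K_comm (i j) : Rel a d ζ (gen (.K i) * gen (.K j)) (gen (.K j) * gen (.K i))
  | K_E (i j) : Rel a d ζ (gen (.K i) * gen (.E j))
      (((ζ ^ ((d i : ℤ) * a i j) : kˣ) : k) • (gen (.E j) * gen (.K i)))
  | K_F (i j) : Rel a d ζ (gen (.K i) * gen (.F j))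
      (((ζ ^ (-((d i : ℤ) * a i j)) : kˣ) : k) • (gen (.F j) * gen (.K i)))
  | E_F (i j) : Rel a d ζ (gen (.E i) * gen (.F j) - gen (.F j) * gen (.E i))
      (if i = j then gen (.K i) - gen (.Kinv i) else 0)
  | serre_E (i j) (h : i ≠ j) : Rel a d ζ (serre ζ (d i) (a i j) (gen (.E i)) (gen (.E j))) 0
  | serre_F (i j) (h : i ≠ j) : Rel a d ζ (serre ζ (d i) (a i j) (gen (.F i)) (gen (.F j))) 0

/-- The `k`-algebra `U_ζ(𝔤')`. -/
abbrev Uq (a : Matrix (Fin n) (Fin n) ℤ) (d : Fin n → ℕ) (ζ : kˣ) : Type _ :=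
  RingQuot (Rel a d ζ)

variable (a : Matrix (Fin n) (Fin n) ℤ) (d : Fin n → ℕ) (ζ : kˣ)

/-- The generators as elements of `U_ζ(𝔤')`. -/
def uGen (x : Gen n) : Uq a d ζ := RingQuot.mkAlgHom k (Rel a d ζ) (gen x)

/-- `E_i`. -/
def uE (i : Fin n) : Uq a d ζ := uGen a d ζ (.E i)

/-- `F_i`. -/
def uF (i : Fin n) : Uq a d ζ := uGen a d ζ (.F i)

/-- `K_i`, as an invertible element; `((uK i)⁻¹ : units)` is `K_i⁻¹`. -/
def uK (i : Fin n) : (Uq a d ζ)ˣ where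
  val := uGen a d ζ (.K i)
  inv := uGen a d ζ (.Kinv i)
  val_inv := by
    simpa [uGen] using RingQuot.mkAlgHom_rel k (Rel.K_mul_Kinv (a := a) (d := d) (ζ := ζ) i)
  inv_val := by
    simpa [uGen] using RingQuot.mkAlgHom_rel k (Rel.Kinv_mul_K (a := a) (d := d) (ζ := ζ) i)

/-- `K_λ = K_1^{λ_1} ⋯ K_n^{λ_n}`. -/
def uKpow (l : Fin n → ℤ) : (Uq a d ζ)ˣ := (List.ofFn fun i => uK a d ζ i ^ l i).prod

/-- The subalgebra `U⁺`. -/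
def Uplus : Subalgebra k (Uq a d ζ) := Algebra.adjoin k (Set.range (uE a d ζ))

/-- The subalgebra `U⁻`. -/
def Uminus : Subalgebra k (Uq a d ζ) := Algebra.adjoin k (Set.range (uF a d ζ))

/-- The subalgebra `G⁻`, generated by the elements `F_i K_i`. -/
def Gminus : Subalgebra k (Uq a d ζ) :=
  Algebra.adjoin k (Set.range fun i => uF a d ζ i * (uK a d ζ i : Uq a d ζ))

/-- The subalgebra `H`, generated by the elements `K_i` and `K_i⁻¹`. -/
def Hsub : Subalgebra k (Uq a d ζ) :=
  Algebra.adjoin k (Set.range (fun i => (uK a d ζ i : Uq a d ζ)) ∪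
    Set.range (fun i => (((uK a d ζ i)⁻¹ : (Uq a d ζ)ˣ) : Uq a d ζ)))

/-- The homogeneous component of degree `α` of `U⁺`. -/
def UplusDeg (α : Fin n → ℕ) : Submodule k (Uq a d ζ) :=
  Submodule.span k {x | ∃ w : List (Fin n), (∀ i, w.count i = α i) ∧ x = (w.map (uE a d ζ)).prod}

/-- The homogeneous component of degree `-β` of `U⁻`. -/
def UminusDeg (β : Fin n → ℕ) : Submodule k (Uq a d ζ) :=
  Submodule.span k {x | ∃ w : List (Fin n), (∀ i, w.count i = β i) ∧ x = (w.map (uF a d ζ)).prod}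

/-- The subspace `U⁺ K_λ G⁻`. -/
def UKG (l : Fin n → ℤ) : Submodule k (Uq a d ζ) :=
  (Uplus a d ζ).toSubmodule * Submodule.span k {(uKpow a d ζ l : Uq a d ζ)} *
    (Gminus a d ζ).toSubmodule

/-- The subspace `U⁺_α H U⁻_{-β}`, indexed by the pair `(α, β)`. -/
def UHU (αβ : (Fin n → ℕ) × (Fin n → ℕ)) : Submodule k (Uq a d ζ) :=
  UplusDeg a d ζ αβ.1 * (Hsub a d ζ).toSubmodule * UminusDeg a d ζ αβ.2

/-- The projection `P_λ` onto `U⁺ K_λ G⁻` along the other summands of `⨁_μ U⁺ K_μ G⁻`. -/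
def projP (l : Fin n → ℤ) : Uq a d ζ →ₗ[k] Uq a d ζ := directProj (UKG a d ζ) l

/-- The projection `π_{α,β}` onto `U⁺_α H U⁻_{-β}` along the other summands. -/
def projPi (α β : Fin n → ℕ) : Uq a d ζ →ₗ[k] Uq a d ζ := directProj (UHU a d ζ) (α, β)

/-! ### The coideal subalgebra and the partial bosonization -/

variable (τ : Equiv.Perm (Fin n)) (c : Fin n → k)

/-- `K_i K_{τ(i)}⁻¹`. -/
def uKτ (i : Fin n) : Uq a d ζ := ((uK a d ζ i * (uK a d ζ (τ i))⁻¹ : (Uq a d ζ)ˣ) : Uq a d ζ)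

/-- `B_i = F_i + c_i E_{τ(i)} K_i⁻¹`. -/
def uB (i : Fin n) : Uq a d ζ :=
  uF a d ζ i + c i • (uE a d ζ (τ i) * (((uK a d ζ i)⁻¹ : (Uq a d ζ)ˣ) : Uq a d ζ))

/-- The subalgebra `H_θ`. -/
def Hθ : Subalgebra k (Uq a d ζ) := Algebra.adjoin k (Set.range (uKτ a d ζ τ))

/-- The partial bosonization `H_θ ⋉ U⁻`: the subalgebra generated by `H_θ` and `U⁻`. -/
def partialBos : Subalgebra k (Uq a d ζ) := Hθ a d ζ τ ⊔ Uminus a d ζ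

/-- The coideal subalgebra `B_𝐜`, generated by `H_θ` and the `B_i`. -/
def Bc : Subalgebra k (Uq a d ζ) :=
  Algebra.adjoin k ((Hθ a d ζ τ : Set (Uq a d ζ)) ∪ Set.range (uB a d ζ τ c))

/-- The generators of `B_𝐜`, as elements of `B_𝐜`: `B_i` on the left summand,
`K_i K_{τ(i)}⁻¹` on the right one. -/
def bGen : Fin n ⊕ Fin n → Bc a d ζ τ c
  | .inl i => ⟨uB a d ζ τ c i, Algebra.subset_adjoin (.inr ⟨i, rfl⟩)⟩
  | .inr i => ⟨uKτ a d ζ τ i, Algebra.subset_adjoin (.inl (Algebra.subset_adjoin ⟨i, rfl⟩))⟩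

/-- The degree of a word in the generators: the number of letters `B_i`. -/
def bDeg (w : List (Fin n ⊕ Fin n)) : ℕ := w.countP (fun x => x.isLeft)

/-- The filtration of `B_𝐜` given by `deg B_i = 1` and `deg h = 0` for `h ∈ H_θ`: its `m`-th piece
is spanned by the words of degree at most `m` in the generators. -/
def filt : AlgFiltration k (Bc a d ζ τ c) where
  piece m := Submodule.span k {x | ∃ w, bDeg w ≤ m ∧ x = (w.map (bGen a d ζ τ c)).prod}
  mono := by
    intro i j hij
    refine Submodule.span_mono ?_
    rintro x ⟨w, hw, rfl⟩
    exact ⟨w, hw.trans hij, rfl⟩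
  one_mem := Submodule.subset_span ⟨[], by simp [bDeg], by simp⟩
  mul_mem := by
    intro i j x y hx hy
    have h := Submodule.mul_mem_mul hx hy
    rw [Submodule.span_mul_span] at h
    refine Submodule.span_mono ?_ h
    rintro _ ⟨_, ⟨v, hv, rfl⟩, _, ⟨w, hw, rfl⟩, rfl⟩
    refine ⟨v ++ w, ?_, by simp⟩
    simp only [bDeg, List.countP_append] at hv hw ⊢
    omega

theorem bGen_inl_mem (i : Fin n) : bGen a d ζ τ c (.inl i) ∈ (filt a d ζ τ c).piece 1 :=
  Submodule.subset_span ⟨[.inl i], by simp [bDeg], by simp⟩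

/-- `φ : gr(B_𝐜) → H_θ ⋉ U⁻` satisfies `φ(B_i) = F_i` for all `i`, and `φ(h) = h` for all `h` in
the degree zero part `H_θ`. -/
def IsCanonical (φ : (filt a d ζ τ c).Gr →ₐ[k] partialBos a d ζ τ) : Prop :=
  (∀ i, ((φ ((filt a d ζ τ c).symbol 1 ⟨bGen a d ζ τ c (.inl i), bGen_inl_mem a d ζ τ c i⟩) :
      partialBos a d ζ τ) : Uq a d ζ) = uF a d ζ i) ∧
    ∀ h : (filt a d ζ τ c).piece 0,
      ((φ ((filt a d ζ τ c).symbol 0 h) : partialBos a d ζ τ) : Uq a d ζ) =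
        ((h : Bc a d ζ τ c) : Uq a d ζ)

end Algebra

end QuantumPair

end

open scoped DirectSum

noncomputable section

namespace QuantumPair

/-! ### Continuants -/

section Continuant

variable {k R : Type*} [Field k] [Ring R] [Algebra k R]

/-! Put $s=\zeta^{d_ia_{ij}}$, $p=\zeta^{2d_i}$, $m=1-a_{ij}$. Then $p_{ij}(x,y)$ is obtained from
$y$ by the commuting operators $y\mapsto xy-sp^tyx$, $0\le t<m$ (`serre_eq_qSeq`), and
$s^2p^{m-1}=1$. Nothing is ever divided by a quantum integer, so roots of unity cause no trouble.

Triangular decomposition: $U$ acts on the space of formal triples $(E_w,K_\mu,F_v)$ modulo the Serre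
relations, and each monomial $E_wK_\mu F_v$ sends the vacuum to its own class. Hence a linear map on
$U$ may be prescribed on monomials as soon as it respects the Serre relations in either word
(`exists_linearMap_uMon`). All projections, gradings and functionals below arise this way.

Serre elements in the $B_i$: write $B_i=x+x'$ with $x=F_i$ and $x'=c_iE_{\tau(i)}K_i^{-1}$. If
$\tau(i)\ne j$, the relation $p_{ij}(F_i,F_j)=0$ says that a continuant in the operators attached to
$B_i$ kills $F_j$. The relation for the $E$'s gives the reversed continuant, which is the same one
since the operators commute. So it kills $B_j$, and it differs from $p_{ij}(B_i,\cdot)$ by terms of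
lower degree. If $\tau(i)=j$, commuting $x'$ past $F_j$ leaves a term in $H_\theta$ and a multiple
of $K_i^{-1}K_j^{-1}$. The contribution of the latter carries a factor $1-s^2p^{m-1}=0$ unless
$m=1$, and for $m=1$ the total coefficient is $c_j-c_i$. Thus, if $c_i=c_{\tau(i)}$ whenever
$a_{i\tau(i)}=0$, every $p_{ij}(B_i,B_j)$ has degree at most $m$ instead of $m+1$ (`serre_uB_mem`,
`serre_uB_of_eq_zero`). The vanishing in (i) is a weight argument.

The homomorphism $\varphi$: give $E_i$ height $1$ and $F_i$ height $-1$. The part of height $-m$ of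
a word with $m$ letters $B_i$ is the same word in the $F_i$, so taking it on the $m$-th filtered
piece $\Phi_m$ defines $\varphi$, and every canonical map is of this form. Injectivity means that an
element of $\Phi_m$ without part of height $-m$ lies in $\Phi_{m-1}$ (`IsCanonical.injective_iff`).
Under the condition on $\mathbf c$, sending $F$-words to $B$-words is well defined modulo
$\Phi_{m-1}$ and inverts $\varphi$. Conversely, if $a_{i\tau(i)}=0$, injectivity forces the
commutator $[B_i,B_{\tau(i)}]$, of height $0$, into $\Phi_0=H_\theta$. There all exponents sum to
$0$, so its term $(c_{\tau(i)}-c_i)K_i^{-1}K_{\tau(i)}^{-1}$ must vanish. -/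

/-- The continuant of the sequence `D`, with scalars `κ`: the determinant of the tridiagonal
matrix with diagonal `D 0, D 1, …` in which the products of opposite off-diagonal entries are
`κ 1, κ 2, …`. -/
def cont (D : ℕ → R) (κ : ℕ → k) : ℕ → R
  | 0 => 1
  | 1 => D 0
  | t + 2 => D (t + 1) * cont D κ (t + 1) - κ (t + 1) • cont D κ t

theorem cont_add_two (D : ℕ → R) (κ : ℕ → k) (t : ℕ) :
    cont D κ (t + 2) = D (t + 1) * cont D κ (t + 1) - κ (t + 1) • cont D κ t := rfl

/-- Expansion of the tridiagonal determinant at its other end. The recursion multiplies new entries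
on the left, so `D 0` stays rightmost and no commutativity is needed. -/
theorem cont_front (κ : ℕ → k) (D : ℕ → R) (t : ℕ) :
    cont D κ (t + 2) = cont (fun r => D (r + 1)) (fun r => κ (r + 1)) (t + 1) * D 0 -
      κ 1 • cont (fun r => D (r + 2)) (fun r => κ (r + 2)) t := by
  induction t using Nat.strong_induction_on with
  | _ t ih =>
    match t with
    | 0 => simp [cont]
    | 1 => simp [cont, sub_mul, mul_sub, mul_assoc]; abel
    | t + 2 =>
      rw [cont_add_two D, ih (t + 1) (by omega), ih t (by omega),
        cont_add_two (fun r => D (r + 1)) _ (t + 1), cont_add_two (fun r => D (r + 2)) _ t]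
      simp only [mul_sub, sub_mul, smul_sub, mul_assoc, smul_mul_assoc, mul_smul_comm, smul_smul,
        mul_comm (κ 1), add_assoc, Nat.reduceAdd]
      abel

/-- The expansion of one continuant at its front matches the recursion of the other at its end;
commutativity only serves to move `D 0` from right to left. This allows the relations among the
`E`'s, whose scalars come in the opposite order, to be read with the same operators as those among
the `F`'s. -/
theorem cont_reverse (m : ℕ) (D D' : ℕ → R) (κ κ' : ℕ → k)
    (hc : ∀ i j, Commute (D i) (D j)) (hD : ∀ t < m, D' t = D (m - 1 - t))
    (hκ : ∀ t, 0 < t → t < m → κ' t = κ (m - t)) : cont D' κ' m = cont D κ m := by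
  induction m using Nat.strong_induction_on generalizing D κ with
  | _ m ih =>
    match m with
    | 0 => rfl
    | 1 => simpa [cont] using hD 0
    | t + 2 =>
      rw [cont_front κ D, cont_add_two D',
        ih (t + 1) (by omega) (fun r => D (r + 1)) (fun r => κ (r + 1)) (fun _ _ => hc _ _)
          (fun s hs => by rw [hD s (by omega)]; congr 1; omega)
          (fun s h0 hs => by rw [hκ s h0 (by omega)]; congr 1; omega),
        ih t (by omega) (fun r => D (r + 2)) (fun r => κ (r + 2)) (fun _ _ => hc _ _)
          (fun s hs => by rw [hD s (by omega)]; congr 1; omega)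
          (fun s h0 hs => by rw [hκ s h0 (by omega)]; congr 1; omega),
        hD (t + 1) (by omega), hκ (t + 1) (by omega) (by omega)]
      have h : ∀ (D₁ : ℕ → R) (κ₁ : ℕ → k), (∀ i, Commute (D 0) (D₁ i)) → ∀ s,
          Commute (D 0) (cont D₁ κ₁ s) := by
        intro D₁ κ₁ h₁ s
        induction s using Nat.strong_induction_on with
        | _ s ihs =>
          match s with
          | 0 => exact Commute.one_right _
          | 1 => exact h₁ 0
          | s + 2 =>
            exact ((h₁ _).mul_right (ihs _ (by omega))).sub_right
              ((ihs s (by omega)).smul_right _)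
      have h2 := (h (fun r => D (r + 1)) (fun r => κ (r + 1)) (fun _ => hc _ _) (t + 1)).eq
      rw [← h2]
      congr 2
      · congr 1; omega
      · congr 1; omega

end Continuant

/-! ### Iterated `q`-commutators and the quantum Serre polynomials -/

section Serre

variable {k A : Type*} [Field k] [Ring A] [Algebra k A]

/-- The iterated `q`-commutators `y_{t+1} = x y_t - s p^t y_t x`, `y_0 = y`. -/
def qSeq (s p : k) (x y : A) : ℕ → A
  | 0 => y
  | t + 1 => x * qSeq s p x y t - (s * p ^ t) • (qSeq s p x y t * x)

/-- The operator `y ↦ x y - s y x`. -/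
def qComm (s : k) (x : A) : Module.End k A := LinearMap.mulLeft k x - s • LinearMap.mulRight k x

theorem qComm_apply (s : k) (x y : A) : qComm s x y = x * y - s • (y * x) := rfl

theorem qComm_commute (s t : k) (x : A) : Commute (qComm s x) (qComm t x) := by
  refine LinearMap.ext fun y => ?_
  simp only [Module.End.mul_apply, qComm_apply, mul_sub, sub_mul, smul_sub, mul_smul_comm,
    smul_mul_assoc, smul_smul, mul_assoc, mul_comm s t]
  abel

theorem qSeq_succ (s p : k) (x y : A) (t : ℕ) :
    qSeq s p x y (t + 1) = qComm (s * p ^ t) x (qSeq s p x y t) := rfl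

theorem qSeq_eq_cont (s p : k) (x y : A) (t : ℕ) :
    qSeq s p x y t = cont (fun t => qComm (s * p ^ t) x) (0 : ℕ → k) t y := by
  induction t using Nat.strong_induction_on with
  | _ t ih =>
    match t with
    | 0 => rfl
    | 1 => rfl
    | t + 2 => rw [qSeq_succ, ih (t + 1) (by omega), cont]; simp

/-- The operators `qComm` for a fixed `x` commute, so their order is irrelevant; this is the
reversal of continuants with zero off-diagonal scalars. -/
theorem qSeq_reverse (s p s' p' : k) (x y : A) (m : ℕ)
    (h : ∀ t < m, s' * p' ^ t = s * p ^ (m - 1 - t)) : qSeq s' p' x y m = qSeq s p x y m := by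
  rw [qSeq_eq_cont, qSeq_eq_cont,
    cont_reverse m (fun t => qComm (s * p ^ t) x) _ 0 0 (fun _ _ => qComm_commute _ _ _) (fun t ht => by simp only [h t ht])
      (fun _ _ _ => rfl)]

theorem qSeq_succ' (s p : k) (x y : A) (t : ℕ) :
    qSeq s p x y (t + 1) = qSeq (s * p) p x (x * y - s • (y * x)) t := by
  induction t with
  | zero => simp [qSeq]
  | succ t ih =>
    rw [qSeq, ih, qSeq]
    congr 2
    rw [pow_succ', mul_assoc]

theorem qSeq_add (s p : k) (x y y' : A) (t : ℕ) :
    qSeq s p x (y + y') t = qSeq s p x y t + qSeq s p x y' t := by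
  simp only [qSeq_eq_cont, map_add]

theorem qSeq_sub (s p : k) (x y y' : A) (t : ℕ) :
    qSeq s p x (y - y') t = qSeq s p x y t - qSeq s p x y' t := by
  simp only [qSeq_eq_cont, map_sub]

theorem qSeq_smul (s p r : k) (x y : A) (t : ℕ) :
    qSeq s p x (r • y) t = r • qSeq s p x y t := by
  simp only [qSeq_eq_cont, map_smul]

theorem xiBinom_eq_zero (ξ : k) (m r : ℕ) (h : m < r) : xiBinom ξ m r = 0 := by
  induction m generalizing r with
  | zero => obtain ⟨r, rfl⟩ := Nat.exists_eq_succ_of_ne_zero h.ne'; rfl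
  | succ m ih =>
    obtain ⟨r, rfl⟩ := Nat.exists_eq_succ_of_ne_zero (by omega : r ≠ 0)
    rw [Nat.succ_eq_add_one, xiBinom, ih r (by omega), ih (r + 1) (by omega)]
    simp

theorem xiBinom_zero_right (ξ : k) (m : ℕ) : xiBinom ξ m 0 = 1 := by cases m <;> rfl

/-- The $q$-binomial theorem. Peeling off the innermost bracket `x * y - s • (y * x)`, its two
halves supply the two terms of the Pascal rule for `xiBinom`. -/
theorem qSeq_eq_sum (s p : k) (x y : A) (t : ℕ) :
    qSeq s p x y t = ∑ r ∈ Finset.range (t + 1),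
      ((-1) ^ r * (s ^ r * p ^ (r.choose 2)) * xiBinom p t r) • (x ^ (t - r) * y * x ^ r) := by
  induction t generalizing s y with
  | zero => simp [qSeq, xiBinom]
  | succ t ih =>
    rw [qSeq_succ', ih]
    have hL : ∀ r ∈ Finset.range (t + 1),
        ((-1) ^ r * ((s * p) ^ r * p ^ (r.choose 2)) * xiBinom p t r) •
          (x ^ (t - r) * (x * y - s • (y * x)) * x ^ r) =
        ((-1) ^ r * (s ^ r * p ^ (r.choose 2)) * (p ^ r * xiBinom p t r)) •
          (x ^ (t + 1 - r) * y * x ^ r) +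
        ((-1) ^ (r + 1) * (s ^ (r + 1) * p ^ ((r + 1).choose 2)) * xiBinom p t r) •
          (x ^ (t + 1 - (r + 1)) * y * x ^ (r + 1)) := by
      intro r hr
      have hr' : t + 1 - r = (t - r) + 1 := by
        have := Finset.mem_range.1 hr; omega
      have h2 : (r + 1).choose 2 = r + r.choose 2 := by
        rw [Nat.choose_succ_succ' r 1, Nat.choose_one_right]
      rw [hr', h2, Nat.add_sub_add_right, pow_succ x, pow_succ' x r]
      simp only [mul_sub, sub_mul, mul_smul_comm, smul_mul_assoc, smul_sub, smul_smul, mul_assoc]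
      rw [sub_eq_add_neg, ← neg_smul]
      congr 2 <;> ring
    rw [Finset.sum_congr rfl hL, Finset.sum_add_distrib, Finset.sum_range_succ' _ (t + 1)]
    -- Shifting the index by one aligns this half with the other; the extra top term is free because
    -- `xiBinom p t (t + 1)` vanishes.
    have hlast : ∑ r ∈ Finset.range (t + 1),
        ((-1) ^ r * (s ^ r * p ^ (r.choose 2)) * (p ^ r * xiBinom p t r)) •
          (x ^ (t + 1 - r) * y * x ^ r) = ∑ r ∈ Finset.range (t + 1),
        ((-1) ^ (r + 1) * (s ^ (r + 1) * p ^ ((r + 1).choose 2)) *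
          (p ^ (r + 1) * xiBinom p t (r + 1))) •
          (x ^ (t + 1 - (r + 1)) * y * x ^ (r + 1)) + x ^ (t + 1) * y := by
      have := Finset.sum_range_succ (fun r => ((-1) ^ r * (s ^ r * p ^ (r.choose 2)) *
        (p ^ r * xiBinom p t r)) • (x ^ (t + 1 - r) * y * x ^ r)) (t + 1)
      rw [xiBinom_eq_zero p t (t + 1) (by omega)] at this
      simp only [mul_zero, zero_smul, add_zero] at this
      rw [← this, Finset.sum_range_succ']
      simp [xiBinom_zero_right]
    rw [hlast]
    simp only [pow_zero, Nat.choose_zero_succ, mul_one, xiBinom_zero_right, one_smul,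
      Nat.sub_zero]
    rw [add_right_comm, ← Finset.sum_add_distrib]
    congr 1
    refine Finset.sum_congr rfl fun r _ => ?_
    rw [← add_smul, xiBinom]
    congr 1
    ring

/-- With $s=\zeta^{eb}$ and $p=\zeta^{2e}$, the exponent of $s^rp^{\binom r2}$ is
$ebr+er(r-1)=-er(1-b-r)$. -/
theorem serre_eq_qSeq (ζ : kˣ) (e : ℕ) (b : ℤ) (x y : A) :
    serre ζ e b x y =
      qSeq ((ζ ^ ((e : ℤ) * b) : kˣ) : k) ((ζ : k) ^ (2 * e)) x y (1 - b).toNat := by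
  rw [qSeq_eq_sum, serre]
  refine Finset.sum_congr rfl fun r hr => ?_
  congr 3
  have h2 : (2 : ℤ) * (r.choose 2 : ℕ) = r * (r - 1) := by
    have := Nat.triangle_succ r
    have h3 := Nat.choose_two_right r
    have h4 : 2 ∣ r * (r - 1) := (Nat.even_mul_pred_self r).two_dvd
    have h5 : 2 * r.choose 2 = r * (r - 1) := by rw [h3, Nat.mul_div_cancel' h4]
    rcases Nat.eq_zero_or_pos r with rfl | h0
    · simp
    · zify [h0] at h5
      exact_mod_cast h5
  rw [← Units.val_pow_eq_pow_val, ← Units.val_pow_eq_pow_val, ← Units.val_pow_eq_pow_val,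
    ← Units.val_mul]
  congr 1
  rw [← zpow_natCast, ← zpow_natCast ζ, ← zpow_natCast (ζ ^ _), ← zpow_mul, ← zpow_mul,
    ← zpow_add]
  congr 1
  push_cast
  linear_combination (-(e : ℤ)) * h2

theorem map_serre {A' : Type*} [Ring A'] [Algebra k A'] (f : A →ₐ[k] A') (ζ : kˣ) (e : ℕ) (b : ℤ)
    (x y : A) : f (serre ζ e b x y) = serre ζ e b (f x) (f y) := by
  simp [serre]

/-- Each bracket adds one `x` and one scalar factor, so the sequence dies as soon as some `s * p ^ r
* u` equals `1`. -/
theorem qSeq_of_skew (s p u : k) (x h : A) (hu : h * x = u • (x * h)) (t : ℕ) :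
    qSeq s p x h t = (∏ r ∈ Finset.range t, (1 - s * p ^ r * u)) • (x ^ t * h) := by
  induction t with
  | zero => simp [qSeq]
  | succ t ih =>
    rw [qSeq, ih, Finset.prod_range_succ]
    simp only [mul_smul_comm, smul_mul_assoc, mul_assoc, hu, smul_smul]
    rw [← mul_assoc x, ← pow_succ', ← mul_assoc (x ^ t), ← pow_succ, ← sub_smul]
    congr 1
    ring

theorem skew_qSeq (s p u v : k) (x y h : A) (hx : h * x = u • (x * h))
    (hy : h * y = v • (y * h)) (t : ℕ) :
    h * qSeq s p x y t = (v * u ^ t) • (qSeq s p x y t * h) := by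
  induction t with
  | zero => simpa [qSeq] using hy
  | succ t ih =>
    rw [qSeq, mul_sub, ← mul_assoc, hx, smul_mul_assoc, mul_assoc, ih, mul_smul_comm, mul_smul_comm,
      ← mul_assoc h, ih, sub_mul]
    simp only [smul_mul_assoc, mul_smul_comm, mul_assoc, hx, smul_smul, smul_sub]
    congr 2 <;> ring

/-- Since `e` commutes with `x`, taking the commutator with `e` commutes with all the brackets. What
is left is the sequence started at `h - h'`, and each of its two parts contains a vanishing factor.
-/
theorem commute_qSeq_of_right (s p u v : k) (x y e h h' : A) (hx : e * x = x * e)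
    (hy : e * y = y * e + (h - h')) (hu : h * x = u • (x * h)) (hv : h' * x = v • (x * h'))
    (m : ℕ) (h1 : ∃ t < m, s * p ^ t * u = 1) (h2 : ∃ t < m, s * p ^ t * v = 1) :
    e * qSeq s p x y m = qSeq s p x y m * e := by
  have key : ∀ t, e * qSeq s p x y t = qSeq s p x y t * e + qSeq s p x (h - h') t := by
    intro t
    induction t with
    | zero => exact hy
    | succ t ih =>
      rw [qSeq, mul_sub, ← mul_assoc, hx, mul_assoc, ih, mul_smul_comm, ← mul_assoc, ih, qSeq]
      simp only [mul_add, add_mul, sub_mul, smul_add, mul_assoc, smul_mul_assoc, hx]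
      abel
  have hz : ∀ u, (∃ t < m, s * p ^ t * u = 1) →
      (∏ r ∈ Finset.range m, (1 - s * p ^ r * u)) = 0 := by
    rintro u ⟨t, ht, h⟩
    exact Finset.prod_eq_zero (Finset.mem_range.2 ht) (by rw [h, sub_self])
  rw [key, qSeq_sub, qSeq_of_skew _ _ _ _ _ hu, qSeq_of_skew _ _ _ _ _ hv, hz u h1, hz v h2]
  simp

/-- At every step the `h'` contributions cancel, and the commutator with the `(t + 1)`-st term is a
scalar times `qSeq s p x y t * h`. The scalars add up to $\sum_r(s'p'^r-sp^r)$, which is zero at the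
end because the two lists are reverses of each other. -/
theorem commute_qSeq_of_left (s p s' p' : k) (hp : p * p' = 1)
    (x y e h h' : A) (hx : e * x = x * e + (h - h')) (hy : e * y = y * e)
    (hhx : h * x = p' • (x * h)) (hhy : h * y = s' • (y * h))
    (hhx' : h' * x = p • (x * h')) (hhy' : h' * y = s • (y * h'))
    (m : ℕ) (hm : ∀ t < m, s' * p' ^ t = s * p ^ (m - 1 - t)) :
    e * qSeq s p x y m = qSeq s p x y m * e := by
  have key : ∀ t, e * qSeq s p x y (t + 1) = qSeq s p x y (t + 1) * e +
      (∑ r ∈ Finset.range (t + 1), (s' * p' ^ r - s * p ^ r)) • (qSeq s p x y t * h) := by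
    intro t
    have aux : ∀ t, (h - h') * qSeq s p x y t - (s * p ^ t) • (qSeq s p x y t * (h - h')) =
        (s' * p' ^ t - s * p ^ t) • (qSeq s p x y t * h) := by
      intro t
      rw [sub_mul, skew_qSeq s p _ _ x y h hhx hhy, skew_qSeq s p _ _ x y h' hhx' hhy', mul_sub,
        smul_sub, sub_smul]
      abel
    induction t with
    | zero =>
      rw [Finset.sum_range_one, ← aux 0]
      simp only [qSeq]
      rw [mul_sub, ← mul_assoc, hx, add_mul, mul_assoc, hy, mul_smul_comm, ← mul_assoc e, hy,
        mul_assoc y, hx, mul_add, smul_add, sub_mul _ _ e, smul_mul_assoc]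
      simp only [mul_assoc]
      abel
    | succ t ih =>
      rw [Finset.sum_range_succ, add_smul, ← aux (t + 1), qSeq, mul_sub, ← mul_assoc, hx, add_mul,
        mul_assoc, ih, mul_smul_comm, ← mul_assoc, ih, add_mul _ _ x, mul_assoc _ e x, hx, sub_mul,
        smul_mul_assoc]
      have h2 : (∑ r ∈ Finset.range (t + 1), (s' * p' ^ r - s * p ^ r)) •
          (qSeq s p x y (t + 1) * h) =
          x * (∑ r ∈ Finset.range (t + 1), (s' * p' ^ r - s * p ^ r)) • (qSeq s p x y t * h) -
          (s * p ^ (t + 1)) • ((∑ r ∈ Finset.range (t + 1), (s' * p' ^ r - s * p ^ r)) •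
            (qSeq s p x y t * h) * x) := by
        rw [qSeq, sub_mul, smul_mul_assoc, smul_mul_assoc, mul_assoc _ h x, hhx, mul_smul_comm,
          mul_smul_comm]
        simp only [smul_sub, smul_smul, mul_assoc]
        congr 2
        rw [pow_succ]
        linear_combination (-(∑ r ∈ Finset.range (t + 1), (s' * p' ^ r - s * p ^ r)) * s *
          p ^ t) * hp
      rw [h2, sub_mul _ _ e, smul_mul_assoc]
      simp only [mul_add, smul_add, mul_assoc, smul_mul_assoc]
      abel
  match m with
  | 0 => simpa [qSeq] using hy
  | m + 1 =>
    rw [key, Finset.sum_sub_distrib, Finset.sum_congr rfl fun t ht => hm t (Finset.mem_range.1 ht),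
      Finset.sum_range_reflect (fun t => s * p ^ t) (m + 1), sub_self, zero_smul, add_zero]

/-- The two products in a bracket acquire the same scalar when the `k₁`, `k₂` are moved to the
right, because `k₁` past `y` and `k₂` past `x` cost the same `β`; hence the shape of the bracket
survives. -/
theorem qSeq_twist (s p α β : k) (x y k₁ k₂ : A) (h1x : k₁ * x = α • (x * k₁))
    (h1y : k₁ * y = β • (y * k₁)) (h2x : k₂ * x = β • (x * k₂)) (h12 : k₁ * k₂ = k₂ * k₁)
    (t : ℕ) : ∃ u : k, qSeq s p (x * k₁) (y * k₂) t = u • (qSeq s p x y t * (k₁ ^ t * k₂)) := by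
  induction t with
  | zero => exact ⟨1, by simp [qSeq]⟩
  | succ t ih =>
    obtain ⟨u, hu⟩ := ih
    refine ⟨u * (β * α ^ t), ?_⟩
    have h3 : (k₁ ^ t * k₂) * x = (β * α ^ t) • (x * (k₁ ^ t * k₂)) := by
      have h4 : ∀ t, k₁ ^ t * x = α ^ t • (x * k₁ ^ t) := by
        intro t
        induction t with
        | zero => simp
        | succ t ih =>
          rw [pow_succ', mul_assoc, ih, mul_smul_comm, ← mul_assoc, h1x, smul_mul_assoc, smul_smul,
            mul_assoc, pow_succ]
      rw [mul_assoc, h2x, mul_smul_comm, ← mul_assoc, h4, smul_mul_assoc, smul_smul, mul_assoc]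
    have h5 : (k₁ ^ t * k₂) * k₁ = k₁ ^ (t + 1) * k₂ := by
      rw [mul_assoc, ← h12, pow_succ, mul_assoc]
    have h6 : k₁ * (k₁ ^ t * k₂) = k₁ ^ (t + 1) * k₂ := by
      rw [← mul_assoc, ← pow_succ']
    rw [qSeq, hu, qSeq, mul_smul_comm, smul_mul_assoc, mul_assoc x k₁, ← mul_assoc k₁,
      skew_qSeq s p _ _ _ _ _ h1x h1y, smul_mul_assoc, mul_assoc _ k₁, h6, mul_assoc _ _ (x * k₁),
      ← mul_assoc (k₁ ^ t * k₂), h3, smul_mul_assoc, mul_assoc x, h5]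
    simp only [sub_mul, mul_smul_comm, smul_mul_assoc, smul_smul, smul_sub, mul_assoc]
    congr 2
    ring

theorem IsSymmetrizableGCM.toNat_pos {n : ℕ} {a : Matrix (Fin n) (Fin n) ℤ} {d : Fin n → ℕ}
    (had : IsSymmetrizableGCM a d) {i j : Fin n} (h : i ≠ j) : 0 < (1 - a i j).toNat := by
  have := had.offDiag i j h
  omega

/-- A form of $s^2p^{m-1}=1$: inverting $\zeta$ reverses the list of the scalars $sp^t$. -/
theorem zpow_mul_pow_reflect (ζ : kˣ) (e : ℕ) (b : ℤ) (t : ℕ) (ht : t < (1 - b).toNat) :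
    (((ζ⁻¹) ^ ((e : ℤ) * b) : kˣ) : k) * (((ζ⁻¹ : kˣ) : k) ^ (2 * e)) ^ t =
      ((ζ ^ ((e : ℤ) * b) : kˣ) : k) * ((ζ : k) ^ (2 * e)) ^ ((1 - b).toNat - 1 - t) := by
  simp only [← Units.val_pow_eq_pow_val, ← Units.val_mul]
  congr 1
  rw [← zpow_natCast ζ, ← zpow_natCast ζ⁻¹, ← zpow_natCast (ζ⁻¹ ^ _), ← zpow_natCast (ζ ^ _),
    ← zpow_mul, ← zpow_mul, ← zpow_add, ← zpow_add, inv_zpow']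
  congr 1
  have h : (((1 - b).toNat - 1 - t : ℕ) : ℤ) = -b - t := by omega
  rw [h]
  push_cast
  ring

/-- In any algebra satisfying the relations other than the Serre relations,
the Serre elements in the `F i` commute with the `E l`. -/
theorem commute_serre {n : ℕ} {a : Matrix (Fin n) (Fin n) ℤ} {d : Fin n → ℕ}
    (had : IsSymmetrizableGCM a d) (ζ : kˣ) (E F K K' : Fin n → A)
    (hK : ∀ i j, K i * F j = ((ζ ^ (-((d i : ℤ) * a i j)) : kˣ) : k) • (F j * K i))
    (hK' : ∀ i j, K' i * F j = ((ζ ^ ((d i : ℤ) * a i j) : kˣ) : k) • (F j * K' i))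
    (hEF : ∀ i j, E i * F j = F j * E i + if i = j then K i - K' i else 0)
    (l i j : Fin n) (hij : i ≠ j) :
    E l * serre ζ (d i) (a i j) (F i) (F j) = serre ζ (d i) (a i j) (F i) (F j) * E l := by
  have hm := had.toNat_pos hij
  rw [serre_eq_qSeq]
  by_cases hl : l = i
  · subst hl
    refine commute_qSeq_of_left (h := K l) (h' := K' l) (s' := ((ζ⁻¹ ^ ((d l : ℤ) * a l j) : kˣ) : k))
      (p' := ((ζ⁻¹ : kˣ) : k) ^ (2 * d l)) _ _ ?_ _ _ _ ?_ ?_ ?_ ?_ ?_ ?_ _ ?_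
    · rw [← mul_pow, Units.mul_inv, one_pow]
    · simpa using hEF l l
    · simpa [hij] using hEF l j
    · rw [hK, had.diag, ← Units.val_pow_eq_pow_val, ← zpow_natCast, inv_zpow']
      congr 4
      push_cast
      ring
    · rw [hK, inv_zpow']
    · rw [hK', had.diag, ← Units.val_pow_eq_pow_val, ← zpow_natCast]
      congr 4
      push_cast
      ring
    · rw [hK']
    · exact fun t ht => zpow_mul_pow_reflect ζ (d l) (a l j) t ht
  -- For `l ≠ i` only the bracket of `E l` with `F j` can be nonzero. The factor with $t=0$ kills
  -- the `K j` term and the one with $t=m-1$ kills the `K' j` term.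
  · have hs := had.symm i j
    refine commute_qSeq_of_right (h := if l = j then K j else 0) (h' := if l = j then K' j else 0)
      (u := ((ζ ^ (-((d i : ℤ) * a i j)) : kˣ) : k)) (v := ((ζ ^ ((d i : ℤ) * a i j) : kˣ) : k))
      _ _ _ _ _ ?_ ?_ ?_ ?_ _ ⟨0, hm, ?_⟩ ⟨(1 - a i j).toNat - 1, by omega, ?_⟩
    · simpa [hl] using hEF l i
    · rw [hEF]
      split_ifs with h
      · rw [h]
      · simp
    · split_ifs with h
      · rw [hK, hs]
      · simp
    · split_ifs with h
      · rw [hK', hs]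
      · simp
    · rw [pow_zero, mul_one, ← Units.val_mul, ← zpow_add, add_neg_cancel, zpow_zero, Units.val_one]
    · rw [← Units.val_pow_eq_pow_val, ← Units.val_pow_eq_pow_val, ← Units.val_mul, ← Units.val_mul,
        ← zpow_natCast, ← zpow_natCast, ← zpow_mul, ← zpow_add, ← zpow_add]
      have := had.offDiag i j hij
      have h : (((1 - a i j).toNat - 1 : ℕ) : ℤ) = - a i j := by omega
      rw [h, show (d i : ℤ) * a i j + (2 * d i : ℕ) * -a i j + d i * a i j = 0 by push_cast; ring,
        zpow_zero, Units.val_one]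

end Serre

/-! ### The elements `K_λ` -/

section Torus

theorem prod_ofFn_mul {G : Type*} [Monoid G] {n : ℕ} (f g : Fin n → G)
    (h : ∀ i j, Commute (f i) (g j)) :
    (List.ofFn fun i => f i * g i).prod = (List.ofFn f).prod * (List.ofFn g).prod := by
  induction n with
  | zero => simp
  | succ n ih =>
    simp only [List.ofFn_succ, List.prod_cons]
    rw [ih (fun i => f i.succ) (fun i => g i.succ) (fun _ _ => h _ _)]
    have hc : Commute (List.ofFn fun i => f i.succ).prod (g 0) := by
      refine Commute.list_prod_left _ _ fun x hx => ?_
      obtain ⟨i, rfl⟩ := (List.mem_ofFn' _ _).1 hx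
      exact h _ _
    simp only [mul_assoc]
    rw [← mul_assoc (g 0), ← hc.eq, mul_assoc]

variable {k : Type*} [Field k] {n : ℕ} (a : Matrix (Fin n) (Fin n) ℤ) (d : Fin n → ℕ) (ζ : kˣ)

theorem uK_comm (i j : Fin n) : Commute (uK a d ζ i) (uK a d ζ j) := by
  refine Units.ext ?_
  simpa only [uGen, map_mul, uK, Units.val_mul] using RingQuot.mkAlgHom_rel k (Rel.K_comm (a := a) (d := d) (ζ := ζ) i j)

theorem uKpow_add (l l' : Fin n → ℤ) :
    uKpow a d ζ (l + l') = uKpow a d ζ l * uKpow a d ζ l' := by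
  simp only [uKpow, Pi.add_apply, zpow_add]
  exact prod_ofFn_mul _ _ fun i j => ((uK_comm a d ζ i j).zpow_left _).zpow_right _

theorem uKpow_zero : uKpow a d ζ 0 = 1 := by
  refine List.prod_eq_one fun x hx => ?_
  obtain ⟨i, rfl⟩ := (List.mem_ofFn' _ _).1 hx
  simp

theorem uKpow_single (i : Fin n) (z : ℤ) : uKpow a d ζ (Pi.single i z) = uK a d ζ i ^ z := by
  rw [uKpow, List.ofFn_eq_map, List.prod_map_eq_pow_single i]
  · rw [List.count_eq_one_of_mem (List.nodup_finRange n) (List.mem_finRange i)]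
    simp
  · intro j hj _
    simp [Pi.single_eq_of_ne hj]

theorem uKpow_neg (l : Fin n → ℤ) : uKpow a d ζ (-l) = (uKpow a d ζ l)⁻¹ := by
  rw [eq_inv_iff_mul_eq_one, ← uKpow_add, neg_add_cancel, uKpow_zero]

/-- A subgroup of `ℤ^n` containing the standard basis is everything. -/
theorem zpow_induction {P : (Fin n → ℤ) → Prop} (h0 : P 0) (hadd : ∀ μ ν, P μ → P ν → P (μ + ν))
    (hneg : ∀ μ, P μ → P (-μ)) (h1 : ∀ i, P (Pi.single i 1)) (μ : Fin n → ℤ) : P μ := by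
  let S : AddSubgroup (Fin n → ℤ) :=
    { carrier := {μ | P μ}, zero_mem' := h0, add_mem' := hadd _ _, neg_mem' := hneg _ }
  change μ ∈ S
  rw [← Finset.univ_sum_single μ]
  refine S.sum_mem fun i _ => ?_
  have : Pi.single i (μ i) = μ i • (Pi.single i 1 : Fin n → ℤ) := by
    rw [← Pi.single_smul]; simp
  rw [this]
  exact S.zsmul_mem (h1 i) _

end Torus

/-! ### The pairing of the weight lattice with the root lattice -/

section Pairing

variable {n : ℕ} (a : Matrix (Fin n) (Fin n) ℤ) (d : Fin n → ℕ)

/-- The exponent `e` in `K_ν E_j = ζ^e E_j K_ν`. -/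
def pair (ν : Fin n → ℤ) (j : Fin n) : ℤ := ∑ i, ν i * (d i * a i j)

theorem pair_add (μ ν : Fin n → ℤ) (j : Fin n) : pair a d (μ + ν) j = pair a d μ j + pair a d ν j := by
  simp [pair, add_mul, Finset.sum_add_distrib]

theorem pair_zero (j : Fin n) : pair a d 0 j = 0 := by simp [pair]

theorem pair_neg (μ : Fin n → ℤ) (j : Fin n) : pair a d (-μ) j = -pair a d μ j := by
  simp [pair]

theorem pair_single (i j : Fin n) : pair a d (Pi.single i 1) j = d i * a i j := by
  rw [pair, Finset.sum_eq_single i] <;> simp +contextual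

/-- The exponent `e` in `K_ν E_w = ζ^e E_w K_ν`, for a word `w`. -/
def pairW (ν : Fin n → ℤ) (w : List (Fin n)) : ℤ := (w.map (pair a d ν)).sum

theorem pairW_nil (ν : Fin n → ℤ) : pairW a d ν [] = 0 := rfl

theorem pairW_cons (ν : Fin n → ℤ) (i : Fin n) (w : List (Fin n)) :
    pairW a d ν (i :: w) = pair a d ν i + pairW a d ν w := by simp [pairW]

theorem pairW_add (μ ν : Fin n → ℤ) (w : List (Fin n)) :
    pairW a d (μ + ν) w = pairW a d μ w + pairW a d ν w := by
  induction w with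
  | nil => rfl
  | cons i w ih => rw [pairW_cons, pairW_cons, pairW_cons, ih, pair_add]; ring

theorem pairW_zero (w : List (Fin n)) : pairW a d 0 w = 0 := by
  induction w with
  | nil => rfl
  | cons i w ih => rw [pairW_cons, ih, pair_zero]; rfl

end Pairing

/-! ### The model of `U` -/

section Model

variable {k : Type*} [Field k] {n : ℕ}

/-- The vector space with basis the formal triples `(E_w, K_μ, F_v)`. -/
abbrev Psi (k : Type*) [Field k] (n : ℕ) : Type _ :=
  (List (Fin n) × (Fin n → ℤ) × List (Fin n)) →₀ k

/-- The basis vectors of `Psi`. -/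
def psi (k : Type*) [Field k] {n : ℕ} (w : List (Fin n)) (μ : Fin n → ℤ) (v : List (Fin n)) :
    Psi k n := Finsupp.single (w, μ, v) 1

/-- The linear map on `Psi` with given values on the basis vectors. -/
def psiLift {X : Type*} [AddCommGroup X] [Module k X]
    (f : List (Fin n) → (Fin n → ℤ) → List (Fin n) → X) : Psi k n →ₗ[k] X :=
  Finsupp.linearCombination k fun x => f x.1 x.2.1 x.2.2

theorem psiLift_psi {X : Type*} [AddCommGroup X] [Module k X]
    (f : List (Fin n) → (Fin n → ℤ) → List (Fin n) → X) (w μ v) :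
    psiLift f (psi k w μ v) = f w μ v := by
  simp [psiLift, psi]

theorem psi_ext {X : Type*} [AddCommGroup X] [Module k X] {f g : Psi k n →ₗ[k] X}
    (h : ∀ w μ v, f (psi k w μ v) = g (psi k w μ v)) : f = g :=
  Finsupp.lhom_ext' fun ⟨w, μ, v⟩ => LinearMap.ext_ring (h w μ v)

theorem psi_mem {S : Submodule k (Psi k n)} (h : ∀ w μ v, psi k w μ v ∈ S) (x : Psi k n) :
    x ∈ S := by
  induction x using Finsupp.induction_linear with
  | zero => exact S.zero_mem
  | add x y hx hy => exact S.add_mem hx hy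
  | single x c =>
    rw [← mul_one c, ← smul_eq_mul, ← Finsupp.smul_single]
    exact S.smul_mem _ (h _ _ _)

variable (a : Matrix (Fin n) (Fin n) ℤ) (d : Fin n → ℕ) (ζ : kˣ)

/-- Left multiplication by `E_i` on the model. -/
def opE (k : Type*) [Field k] {n : ℕ} (i : Fin n) : Module.End k (Psi k n) :=
  psiLift fun w μ v => psi k (i :: w) μ v

/-- Left multiplication by `K_ν` on the model. -/
def opK (ν : Fin n → ℤ) : Module.End k (Psi k n) :=
  psiLift fun w μ v => ((ζ ^ pairW a d ν w : kˣ) : k) • psi k w (ν + μ) v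

/-- Left multiplication by `F_i` on a basis vector of the model. -/
def opFAux (i : Fin n) : List (Fin n) → (Fin n → ℤ) → List (Fin n) → Psi k n
  | [], μ, v => ((ζ ^ pair a d μ i : kˣ) : k) • psi k [] μ (i :: v)
  | j :: w, μ, v => opE k j (opFAux i w μ v) -
      if j = i then (opK a d ζ (Pi.single i 1) - opK a d ζ (-Pi.single i 1)) (psi k w μ v) else 0

/-- Left multiplication by `F_i` on the model. -/
def opF (i : Fin n) : Module.End k (Psi k n) := psiLift (opFAux a d ζ i)

theorem opE_psi (i : Fin n) (w μ v) : opE k i (psi k w μ v) = psi k (i :: w) μ v :=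
  psiLift_psi _ _ _ _

theorem opK_psi (ν : Fin n → ℤ) (w μ v) : opK a d ζ ν (psi k w μ v) =
    ((ζ ^ pairW a d ν w : kˣ) : k) • psi k w (ν + μ) v := psiLift_psi _ _ _ _

theorem opF_psi_nil (i : Fin n) (μ v) : opF a d ζ i (psi k [] μ v) =
    ((ζ ^ pair a d μ i : kˣ) : k) • psi k [] μ (i :: v) := psiLift_psi _ _ _ _

theorem opF_psi_cons (i j : Fin n) (w μ v) : opF a d ζ i (psi k (j :: w) μ v) =
    opE k j (opF a d ζ i (psi k w μ v)) -
      if j = i then (opK a d ζ (Pi.single i 1) - opK a d ζ (-Pi.single i 1)) (psi k w μ v)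
      else 0 := by
  rw [opF, psiLift_psi, psiLift_psi]; rfl

theorem opE_opF (i j : Fin n) : opE k i * opF a d ζ j = opF a d ζ j * opE k i +
    if i = j then opK a d ζ (Pi.single i 1) - opK a d ζ (-Pi.single i 1) else 0 := by
  refine psi_ext fun w μ v => ?_
  simp only [LinearMap.add_apply, Module.End.mul_apply, opE_psi, opF_psi_cons]
  split_ifs with h
  · subst h; simp
  · simp

theorem opK_opE (ν : Fin n → ℤ) (j : Fin n) : opK a d ζ ν * opE k j =
    ((ζ ^ pair a d ν j : kˣ) : k) • (opE k j * opK a d ζ ν) := by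
  refine psi_ext fun w μ v => ?_
  simp only [LinearMap.smul_apply, Module.End.mul_apply, opE_psi, opK_psi, pairW_cons, zpow_add,
    Units.val_mul, map_smul, smul_smul]

theorem opK_opK (ν ν' : Fin n → ℤ) : opK a d ζ ν * opK a d ζ ν' = opK a d ζ (ν + ν') := by
  refine psi_ext fun w μ v => ?_
  simp only [Module.End.mul_apply, opK_psi, map_smul, smul_smul, pairW_add, zpow_add,
    Units.val_mul, add_assoc]
  rw [mul_comm]

theorem opK_zero : opK a d ζ (0 : Fin n → ℤ) = 1 := by
  refine psi_ext fun w μ v => ?_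
  simp [opK_psi, pairW_zero]

theorem opK_opF (ν : Fin n → ℤ) (j : Fin n) : opK a d ζ ν * opF a d ζ j =
    ((ζ ^ (-pair a d ν j) : kˣ) : k) • (opF a d ζ j * opK a d ζ ν) := by
  refine psi_ext fun w μ v => ?_
  simp only [LinearMap.smul_apply, Module.End.mul_apply]
  induction w with
  | nil =>
    simp only [opF_psi_nil, opK_psi, map_smul, smul_smul, pairW_nil, pair_add]
    congr 1
    simp only [← Units.val_mul, ← zpow_add]
    congr 2
    ring
  | cons i w ih =>
    have h1 := LinearMap.congr_fun (opK_opE a d ζ ν i) (opF a d ζ j (psi k w μ v))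
    simp only [LinearMap.smul_apply, Module.End.mul_apply] at h1
    rw [opF_psi_cons, map_sub, h1, ih, ← opE_psi (k := k) i w,
      show opK a d ζ ν (opE k i (psi k w μ v)) = (opK a d ζ ν * opE k i) (psi k w μ v) from rfl,
      opK_opE, LinearMap.smul_apply, Module.End.mul_apply, map_smul, map_smul]
    have h2 := LinearMap.congr_fun (opE_opF a d ζ i j) (opK a d ζ ν (psi k w μ v))
    simp only [LinearMap.add_apply, Module.End.mul_apply] at h2
    rw [← sub_eq_iff_eq_add] at h2
    rw [← h2, smul_sub, smul_sub, smul_smul, smul_smul, mul_comm]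
    congr 1
    -- When `i = j` the scalars of $E_i$ and $F_j$ cancel, as they must: the commutator
    -- $K_i-K_i^{-1}$ commutes with $K_\nu$.
    · split_ifs with h
      · subst h
        simp only [LinearMap.sub_apply, map_sub, ← Module.End.mul_apply, opK_opK]
        rw [smul_smul, ← Units.val_mul, ← zpow_add]
        simp [add_comm]
      · simp

/-- The coefficients of the quantum Serre polynomials. -/
def serreCoef (ζ : kˣ) (e : ℕ) (b : ℤ) (r : ℕ) : k :=
  (-1 : k) ^ r * ((ζ ^ (-((e : ℤ) * r * (1 - b - r))) : kˣ) : k) *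
    xiBinom ((ζ : k) ^ (2 * e)) (1 - b).toNat r

/-- The words of the quantum Serre polynomials. -/
def serreWord (i j : Fin n) (m r : ℕ) : List (Fin n) :=
  List.replicate (m - r) i ++ j :: List.replicate r i

theorem serre_eq {A : Type*} [Ring A] [Algebra k A] (e : ℕ) (b : ℤ) (E : Fin n → A) (i j : Fin n) :
    serre ζ e b (E i) (E j) = ∑ r ∈ Finset.range ((1 - b).toNat + 1),
      serreCoef ζ e b r • ((serreWord i j (1 - b).toNat r).map E).prod := by
  simp [serre, serreCoef, serreWord, mul_assoc]

theorem prod_serre_prod {A : Type*} [Ring A] [Algebra k A] (e : ℕ) (b : ℤ) (E : Fin n → A)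
    (i j : Fin n) (u w : List (Fin n)) :
    (u.map E).prod * serre ζ e b (E i) (E j) * (w.map E).prod =
      ∑ r ∈ Finset.range ((1 - b).toNat + 1),
      serreCoef ζ e b r • ((u ++ serreWord i j (1 - b).toNat r ++ w).map E).prod := by
  simp [serre_eq, Finset.mul_sum, Finset.sum_mul, mul_assoc]

/-- The span of the consequences of the Serre relations in the model. -/
def serreSpan : Submodule k (Psi k n) := Submodule.span k
  ({x | ∃ i j, i ≠ j ∧ ∃ u w μ v, x = ∑ r ∈ Finset.range ((1 - a i j).toNat + 1),
      serreCoef ζ (d i) (a i j) r • psi k (u ++ serreWord i j (1 - a i j).toNat r ++ w) μ v} ∪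
   {x | ∃ i j, i ≠ j ∧ ∃ w μ u v, x = ∑ r ∈ Finset.range ((1 - a i j).toNat + 1),
      serreCoef ζ (d i) (a i j) r • psi k w μ (u ++ serreWord i j (1 - a i j).toNat r ++ v)})

theorem prod_opE_psi (u w μ v) : (u.map (opE k)).prod (psi k w μ v) =
    (psi k (u ++ w) μ v : Psi k n) := by
  induction u with
  | nil => rfl
  | cons i u ih => rw [List.map_cons, List.prod_cons, Module.End.mul_apply, ih, opE_psi]; rfl

theorem prod_opF_psi (u v) : (u.map (opF a d ζ)).prod (psi k [] 0 v) =
    (psi k [] 0 (u ++ v) : Psi k n) := by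
  induction u with
  | nil => rfl
  | cons i u ih =>
    rw [List.map_cons, List.prod_cons, Module.End.mul_apply, ih, opF_psi_nil, pair_zero]
    simp

theorem opK_psi_nil (μ v) : opK a d ζ μ (psi k [] 0 v) = psi k [] μ v := by
  simp [opK_psi, pairW_nil]

theorem serreE_psi (e : ℕ) (b : ℤ) (i j : Fin n) (u w μ v) :
    ((u.map (opE k)).prod * serre ζ e b (opE k i) (opE k j)) (psi k w μ v) =
      (∑ r ∈ Finset.range ((1 - b).toNat + 1), serreCoef ζ e b r •
        psi k (u ++ serreWord i j (1 - b).toNat r ++ w) μ v : Psi k n) := by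
  have h := LinearMap.congr_fun
    (prod_serre_prod (A := Module.End k (Psi k n)) ζ e b (opE k) i j u w) (psi k [] μ v)
  rw [Module.End.mul_apply, prod_opE_psi, List.append_nil] at h
  rw [h, LinearMap.sum_apply]
  refine Finset.sum_congr rfl fun r _ => ?_
  rw [LinearMap.smul_apply, prod_opE_psi, List.append_nil]

theorem serreF_psi (e : ℕ) (b : ℤ) (i j : Fin n) (w μ u v) :
    ((w.map (opE k)).prod * opK a d ζ μ) (((u.map (opF a d ζ)).prod *
      serre ζ e b (opF a d ζ i) (opF a d ζ j)) (psi k [] 0 v)) =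
      (∑ r ∈ Finset.range ((1 - b).toNat + 1), serreCoef ζ e b r •
        psi k w μ (u ++ serreWord i j (1 - b).toNat r ++ v) : Psi k n) := by
  have h := LinearMap.congr_fun
    (prod_serre_prod (A := Module.End k (Psi k n)) ζ e b (opF a d ζ) i j u v) (psi k [] 0 [])
  rw [Module.End.mul_apply, prod_opF_psi, List.append_nil] at h
  rw [h, LinearMap.sum_apply, map_sum]
  refine Finset.sum_congr rfl fun r _ => ?_
  rw [LinearMap.smul_apply, prod_opF_psi, map_smul, Module.End.mul_apply, opK_psi_nil,
    prod_opE_psi, List.append_nil, List.append_nil]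

theorem serreE_mem (i j : Fin n) (h : i ≠ j) (u : List (Fin n)) (x : Psi k n) :
    ((u.map (opE k)).prod * serre ζ (d i) (a i j) (opE k i) (opE k j)) x ∈ serreSpan a d ζ := by
  change x ∈ (serreSpan a d ζ).comap _
  refine psi_mem (fun w μ v => ?_) x
  exact Submodule.subset_span (Or.inl ⟨i, j, h, u, w, μ, v, serreE_psi ..⟩)

theorem serreF_mem (i j : Fin n) (h : i ≠ j) (w : List (Fin n)) (μ : Fin n → ℤ)
    (u v : List (Fin n)) :
    ((w.map (opE k)).prod * opK a d ζ μ) (((u.map (opF a d ζ)).prod *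
      serre ζ (d i) (a i j) (opF a d ζ i) (opF a d ζ j)) (psi k [] 0 v)) ∈ serreSpan a d ζ :=
  Submodule.subset_span (Or.inr ⟨i, j, h, w, μ, u, v, serreF_psi ..⟩)

/-- Rephrases the generators of `serreSpan` through Serre elements acting as operators, so that
stability under an operator becomes a question of commuting it past Serre elements instead of
manipulating words. -/
theorem serreSpan_le {S : Submodule k (Psi k n)}
    (hE : ∀ i j : Fin n, i ≠ j → ∀ (u : List (Fin n)) (x : Psi k n),
      ((u.map (opE k)).prod * serre ζ (d i) (a i j) (opE k i) (opE k j)) x ∈ S)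
    (hF : ∀ i j : Fin n, i ≠ j → ∀ (w : List (Fin n)) (μ : Fin n → ℤ) (u v : List (Fin n)),
      ((w.map (opE k)).prod * opK a d ζ μ)
        (((u.map (opF a d ζ)).prod *
          serre ζ (d i) (a i j) (opF a d ζ i) (opF a d ζ j)) (psi k [] 0 v)) ∈ S) :
    serreSpan a d ζ ≤ S := by
  refine Submodule.span_le.2 ?_
  rintro x (⟨i, j, h, u, w, μ, v, rfl⟩ | ⟨i, j, h, w, μ, u, v, rfl⟩)
  · rw [← serreE_psi]
    exact hE i j h u (psi k w μ v)
  · rw [← serreF_psi a]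
    exact hF i j h w μ u v

theorem skew_prod {A : Type*} [Ring A] [Algebra k A] (x : A) (E : Fin n → A) (f : Fin n → ℤ)
    (h : ∀ j, x * E j = ((ζ ^ f j : kˣ) : k) • (E j * x)) (w : List (Fin n)) :
    x * (w.map E).prod = ((ζ ^ (w.map f).sum : kˣ) : k) • ((w.map E).prod * x) := by
  induction w with
  | nil => simp
  | cons i w ih =>
    simp only [List.map_cons, List.prod_cons, List.sum_cons]
    rw [← mul_assoc, h, smul_mul_assoc, mul_assoc, ih, mul_smul_comm, smul_smul, zpow_add,
      Units.val_mul, mul_assoc]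

theorem skew_serre {A : Type*} [Ring A] [Algebra k A] (x : A) (E : Fin n → A) (f : Fin n → ℤ)
    (h : ∀ j, x * E j = ((ζ ^ f j : kˣ) : k) • (E j * x)) (e : ℕ) (b : ℤ) (i j : Fin n) :
    ∃ s : kˣ, x * serre ζ e b (E i) (E j) = (s : k) • (serre ζ e b (E i) (E j) * x) := by
  refine ⟨ζ ^ f j * (ζ ^ f i) ^ (1 - b).toNat, ?_⟩
  rw [serre_eq_qSeq, skew_qSeq _ _ _ _ _ _ _ (h i) (h j)]
  simp

theorem opE_mem (i : Fin n) (x : Psi k n) (hx : x ∈ serreSpan a d ζ) :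
    opE k i x ∈ serreSpan a d ζ := by
  refine serreSpan_le a d ζ (S := (serreSpan a d ζ).comap (opE k i)) ?_ ?_ hx
  · intro i' j h u x
    simpa [mul_assoc] using serreE_mem a d ζ i' j h (i :: u) x
  · intro i' j h w μ u v
    simpa [mul_assoc] using serreF_mem a d ζ i' j h (i :: w) μ u v

theorem opK_mem (ν : Fin n → ℤ) (x : Psi k n) (hx : x ∈ serreSpan a d ζ) :
    opK a d ζ ν x ∈ serreSpan a d ζ := by
  have hν := opK_opE a d ζ ν
  refine serreSpan_le a d ζ (S := (serreSpan a d ζ).comap (opK a d ζ ν)) ?_ ?_ hx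
  · intro i j h u x
    obtain ⟨s, hs⟩ := skew_serre (A := Module.End k (Psi k n)) ζ _ _ _ hν (d i) (a i j) i j
    rw [Submodule.mem_comap, ← Module.End.mul_apply, ← mul_assoc, skew_prod (A := Module.End k (Psi k n)) ζ _ _ _ hν,
      smul_mul_assoc, mul_assoc, hs, mul_smul_comm, ← mul_assoc, LinearMap.smul_apply,
      LinearMap.smul_apply, Module.End.mul_apply]
    exact Submodule.smul_mem _ _ (Submodule.smul_mem _ _ (serreE_mem a d ζ i j h u _))
  · intro i j h w μ u v
    rw [Submodule.mem_comap, ← Module.End.mul_apply, ← mul_assoc, skew_prod (A := Module.End k (Psi k n)) ζ _ _ _ hν,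
      smul_mul_assoc, mul_assoc, opK_opK, LinearMap.smul_apply]
    exact Submodule.smul_mem _ _ (serreF_mem a d ζ i j h w _ u v)

theorem opK_opF_single (i j : Fin n) : opK a d ζ (Pi.single i 1) * opF a d ζ j =
    ((ζ ^ (-((d i : ℤ) * a i j)) : kˣ) : k) • (opF a d ζ j * opK a d ζ (Pi.single i 1)) := by
  rw [opK_opF, pair_single]

theorem opK_opF_neg_single (i j : Fin n) : opK a d ζ (-Pi.single i 1) * opF a d ζ j =
    ((ζ ^ ((d i : ℤ) * a i j) : kˣ) : k) • (opF a d ζ j * opK a d ζ (-Pi.single i 1)) := by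
  rw [opK_opF, pair_neg, pair_single, neg_neg]

variable {a d}

theorem opE_serreF (had : IsSymmetrizableGCM a d) (l i j : Fin n) (h : i ≠ j) :
    opE k l * serre ζ (d i) (a i j) (opF a d ζ i) (opF a d ζ j) =
      serre ζ (d i) (a i j) (opF a d ζ i) (opF a d ζ j) * opE k l :=
  commute_serre had ζ (opE k) (opF a d ζ) (fun i => opK a d ζ (Pi.single i 1))
    (fun i => opK a d ζ (-Pi.single i 1)) (opK_opF_single a d ζ) (opK_opF_neg_single a d ζ)
    (opE_opF a d ζ) l i j h

/-- Exchanging the roles of `E` and `F` in `commute_serre` also exchanges `K` and its inverse. -/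
theorem opF_serreE (had : IsSymmetrizableGCM a d) (l i j : Fin n) (h : i ≠ j) :
    opF a d ζ l * serre ζ (d i) (a i j) (opE k i) (opE k j) =
      serre ζ (d i) (a i j) (opE k i) (opE k j) * opF a d ζ l := by
  refine commute_serre had ζ (opF a d ζ) (opE k) (fun i => opK a d ζ (-Pi.single i 1))
    (fun i => opK a d ζ (Pi.single i 1)) (fun i j => ?_) (fun i j => ?_) (fun i j => ?_) l i j h
  · rw [opK_opE, pair_neg, pair_single]
  · rw [opK_opE, pair_single]
  · rw [opE_opF]
    split_ifs with h1 h2 h2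
    · subst h1; abel
    · exact absurd h1.symm h2
    · exact absurd h2.symm h1
    · simp

/-- Moving $F_l$ to the right through $E$-letters leaves only torus terms, which preserve the span.
It then meets a Serre element in the $E$'s, with which it commutes, or reaches the $F$-word and
becomes one more letter. -/
theorem opF_mem (had : IsSymmetrizableGCM a d) (l : Fin n) (x : Psi k n)
    (hx : x ∈ serreSpan a d ζ) : opF a d ζ l x ∈ serreSpan a d ζ := by
  have key : ∀ (w : List (Fin n)) (y : Psi k n), (∀ u : List (Fin n), ∀ ν,
      ((u.map (opE k)).prod * opK a d ζ ν) y ∈ serreSpan a d ζ) →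
      (∀ u : List (Fin n), ((u.map (opE k)).prod * opF a d ζ l) y ∈ serreSpan a d ζ) →
      opF a d ζ l ((w.map (opE k)).prod y) ∈ serreSpan a d ζ := by
    intro w y hK hF
    induction w with
    | nil => simpa using hF []
    | cons i w ih =>
      have h1 := LinearMap.congr_fun (opE_opF a d ζ i l) ((w.map (opE k)).prod y)
      simp only [LinearMap.add_apply, Module.End.mul_apply] at h1
      rw [← sub_eq_iff_eq_add] at h1
      rw [List.map_cons, List.prod_cons, Module.End.mul_apply, ← h1]
      refine Submodule.sub_mem _ (opE_mem a d ζ _ _ ih) ?_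
      have h2 : ∀ ν, opK a d ζ ν ((w.map (opE k)).prod y) ∈ serreSpan a d ζ := by
        intro ν
        rw [← Module.End.mul_apply, skew_prod (A := Module.End k (Psi k n)) ζ _ _ _ (opK_opE a d ζ ν), LinearMap.smul_apply]
        exact Submodule.smul_mem _ _ (hK w ν)
      split_ifs
      · exact Submodule.sub_mem _ (h2 _) (h2 _)
      · exact Submodule.zero_mem _
  refine serreSpan_le a d ζ (S := (serreSpan a d ζ).comap (opF a d ζ l)) ?_ ?_ hx
  · intro i j h u x
    rw [Submodule.mem_comap, Module.End.mul_apply]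
    refine key u _ (fun u' ν => ?_) fun u' => ?_
    · obtain ⟨s, hs⟩ := skew_serre (A := Module.End k (Psi k n)) ζ _ _ _ (opK_opE a d ζ ν) (d i) (a i j) i j
      rw [← Module.End.mul_apply, mul_assoc, hs, mul_smul_comm, ← mul_assoc, LinearMap.smul_apply,
        Module.End.mul_apply]
      exact Submodule.smul_mem _ _ (serreE_mem a d ζ i j h u' _)
    · rw [← Module.End.mul_apply, mul_assoc, opF_serreE ζ had l i j h, ← mul_assoc,
        Module.End.mul_apply]
      exact serreE_mem a d ζ i j h u' _
  · intro i j h w μ u v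
    rw [Submodule.mem_comap, Module.End.mul_apply]
    refine key w _ (fun u' ν => ?_) fun u' => ?_
    · rw [← Module.End.mul_apply, mul_assoc, opK_opK]
      exact serreF_mem a d ζ i j h u' _ u v
    · have h3 := opK_opF a d ζ μ l
      have h4 : opF a d ζ l * opK a d ζ μ =
          ((ζ ^ (pair a d μ l) : kˣ) : k) • (opK a d ζ μ * opF a d ζ l) := by
        rw [h3, smul_smul, ← Units.val_mul, ← zpow_add]
        simp
      rw [← Module.End.mul_apply, mul_assoc, h4, mul_smul_comm, LinearMap.smul_apply, ← mul_assoc,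
        Module.End.mul_apply]
      refine Submodule.smul_mem _ _ ?_
      simpa [mul_assoc] using serreF_mem a d ζ i j h u' μ (l :: u) v

/-- On $E_wK_\mu F_v$ the Serre element in the $F$'s passes $E_w$ by commutation and $K_\mu$ up to a
scalar; directly in front of $F_v$ it gives a generator of the span. -/
theorem serreF_apply_mem (had : IsSymmetrizableGCM a d) (i j : Fin n) (h : i ≠ j) (x : Psi k n) :
    serre ζ (d i) (a i j) (opF a d ζ i) (opF a d ζ j) x ∈ serreSpan a d ζ := by
  refine psi_mem (S := (serreSpan a d ζ).comap (serre ζ (d i) (a i j) _ _)) (fun w μ v => ?_) x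
  rw [Submodule.mem_comap, ← List.append_nil w, ← prod_opE_psi, ← opK_psi_nil a d ζ]
  have h1 : Commute (serre ζ (d i) (a i j) (opF a d ζ i) (opF a d ζ j))
      (w.map (opE k)).prod := by
    refine Commute.list_prod_right _ _ fun y hy => ?_
    obtain ⟨l, -, rfl⟩ := List.mem_map.1 hy
    exact (opE_serreF ζ had l i j h).symm
  obtain ⟨s, hs⟩ := skew_serre (A := Module.End k (Psi k n)) ζ _ _ _ (opK_opF a d ζ μ) (d i) (a i j) i j
  have hs' : serre ζ (d i) (a i j) (opF a d ζ i) (opF a d ζ j) * opK a d ζ μ =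
      ((s⁻¹ : kˣ) : k) • (opK a d ζ μ * serre ζ (d i) (a i j) (opF a d ζ i) (opF a d ζ j)) := by
    rw [hs, smul_smul, Units.inv_mul, one_smul]
  rw [← Module.End.mul_apply, h1.eq, Module.End.mul_apply, ← Module.End.mul_apply (serre _ _ _ _ _),
    hs', LinearMap.smul_apply, map_smul]
  refine Submodule.smul_mem _ _ ?_
  simpa [mul_assoc] using serreF_mem a d ζ i j h w μ [] v

end Model

/-! ### Relations in `U` -/

section Relations

variable {k : Type*} [Field k] {n : ℕ} (a : Matrix (Fin n) (Fin n) ℤ) (d : Fin n → ℕ) (ζ : kˣ)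

theorem uK_uE (i j : Fin n) : (uK a d ζ i : Uq a d ζ) * uE a d ζ j =
    ((ζ ^ ((d i : ℤ) * a i j) : kˣ) : k) • (uE a d ζ j * (uK a d ζ i : Uq a d ζ)) := by
  simpa only [uE, uGen, map_mul, map_smul, uK] using
    RingQuot.mkAlgHom_rel k (Rel.K_E (a := a) (d := d) (ζ := ζ) i j)

theorem uK_uF (i j : Fin n) : (uK a d ζ i : Uq a d ζ) * uF a d ζ j =
    ((ζ ^ (-((d i : ℤ) * a i j)) : kˣ) : k) • (uF a d ζ j * (uK a d ζ i : Uq a d ζ)) := by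
  simpa only [uF, uGen, map_mul, map_smul, uK] using
    RingQuot.mkAlgHom_rel k (Rel.K_F (a := a) (d := d) (ζ := ζ) i j)

theorem uKpow_neg_single (i : Fin n) :
    uKpow a d ζ (-Pi.single i 1) = (uK a d ζ i)⁻¹ := by
  rw [uKpow_neg, uKpow_single, zpow_one]

theorem uE_uF (i j : Fin n) : uE a d ζ i * uF a d ζ j = uF a d ζ j * uE a d ζ i +
    if i = j then (uKpow a d ζ (Pi.single i 1) : Uq a d ζ) -
      (uKpow a d ζ (-Pi.single i 1) : Uq a d ζ) else 0 := by
  have h := RingQuot.mkAlgHom_rel k (Rel.E_F (a := a) (d := d) (ζ := ζ) i j)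
  rw [map_sub, sub_eq_iff_eq_add', map_mul, map_mul] at h
  rw [uKpow_neg_single, uKpow_single, zpow_one]
  refine h.trans ?_
  congr 1
  split_ifs
  · rw [map_sub]; rfl
  · exact map_zero _

theorem serre_uE (i j : Fin n) (h : i ≠ j) :
    serre ζ (d i) (a i j) (uE a d ζ i) (uE a d ζ j) = 0 := by
  have h := RingQuot.mkAlgHom_rel k (Rel.serre_E (a := a) (d := d) (ζ := ζ) i j h)
  rwa [map_serre, map_zero] at h

theorem serre_uF (i j : Fin n) (h : i ≠ j) :
    serre ζ (d i) (a i j) (uF a d ζ i) (uF a d ζ j) = 0 := by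
  have h := RingQuot.mkAlgHom_rel k (Rel.serre_F (a := a) (d := d) (ζ := ζ) i j h)
  rwa [map_serre, map_zero] at h

theorem skew_of_units {A : Type*} [Ring A] [Algebra k A] (K : (Fin n → ℤ) → Aˣ) (h0 : K 0 = 1)
    (hadd : ∀ μ ν, K (μ + ν) = K μ * K ν) (x : A) (f : (Fin n → ℤ) →+ ℤ)
    (h : ∀ i, (K (Pi.single i 1) : A) * x =
      ((ζ ^ f (Pi.single i 1) : kˣ) : k) • (x * (K (Pi.single i 1) : A))) (ν : Fin n → ℤ) :
    (K ν : A) * x = ((ζ ^ f ν : kˣ) : k) • (x * (K ν : A)) := by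
  refine zpow_induction (P := fun ν => (K ν : A) * x = ((ζ ^ f ν : kˣ) : k) • (x * (K ν : A)))
    ?_ ?_ ?_ h ν
  · simp [h0]
  · intro μ ν hμ hν
    rw [hadd, Units.val_mul, mul_assoc, hν, mul_smul_comm, ← mul_assoc, hμ, smul_mul_assoc,
      smul_smul, mul_assoc, map_add, zpow_add, Units.val_mul, mul_comm (_ : k)]
  · intro μ hμ
    have hinv : K (-μ) = (K μ)⁻¹ := by
      rw [eq_inv_iff_mul_eq_one, ← hadd, neg_add_cancel, h0]
    rw [hinv, Units.inv_mul_eq_iff_eq_mul, mul_smul_comm, ← mul_assoc, hμ, smul_mul_assoc,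
      smul_smul, map_neg, mul_assoc, Units.mul_inv, ← Units.val_mul, ← zpow_add]
    simp

theorem uKpow_uE (ν : Fin n → ℤ) (j : Fin n) : (uKpow a d ζ ν : Uq a d ζ) * uE a d ζ j =
    ((ζ ^ pair a d ν j : kˣ) : k) • (uE a d ζ j * (uKpow a d ζ ν : Uq a d ζ)) := by
  let f : (Fin n → ℤ) →+ ℤ :=
    { toFun := fun ν => pair a d ν j, map_zero' := pair_zero a d j,
      map_add' := fun _ _ => pair_add a d _ _ j }
  refine skew_of_units ζ (uKpow a d ζ) (uKpow_zero a d ζ) (uKpow_add a d ζ) _ f (fun i => ?_) ν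
  change _ = ((ζ ^ pair a d _ j : kˣ) : k) • _
  rw [uKpow_single, zpow_one, uK_uE, pair_single]

theorem uKpow_uF (ν : Fin n → ℤ) (j : Fin n) : (uKpow a d ζ ν : Uq a d ζ) * uF a d ζ j =
    ((ζ ^ (-pair a d ν j) : kˣ) : k) • (uF a d ζ j * (uKpow a d ζ ν : Uq a d ζ)) := by
  let f : (Fin n → ℤ) →+ ℤ :=
    { toFun := fun ν => -pair a d ν j, map_zero' := by simp [pair_zero],
      map_add' := fun _ _ => by rw [pair_add]; ring }
  refine skew_of_units ζ (uKpow a d ζ) (uKpow_zero a d ζ) (uKpow_add a d ζ) _ f (fun i => ?_) ν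
  change _ = ((ζ ^ (-pair a d _ j) : kˣ) : k) • _
  rw [uKpow_single, zpow_one, uK_uF, pair_single]

/-- The monomials `E_w K_μ F_v`. -/
def uMon (w : List (Fin n)) (μ : Fin n → ℤ) (v : List (Fin n)) : Uq a d ζ :=
  (w.map (uE a d ζ)).prod * (uKpow a d ζ μ : Uq a d ζ) * (v.map (uF a d ζ)).prod

end Relations

/-! ### The action of `U` on the model -/

section Action

variable {k : Type*} [Field k] {n : ℕ} {a : Matrix (Fin n) (Fin n) ℤ} {d : Fin n → ℕ} (ζ : kˣ)

/-- The operators on the model attached to the generators of `U`. -/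
def genOp (a : Matrix (Fin n) (Fin n) ℤ) (d : Fin n → ℕ) : Gen n → Module.End k (Psi k n)
  | .E i => opE k i
  | .F i => opF a d ζ i
  | .K i => opK a d ζ (Pi.single i 1)
  | .Kinv i => opK a d ζ (-Pi.single i 1)

theorem genOp_mem (had : IsSymmetrizableGCM a d) (g : Gen n) :
    serreSpan a d ζ ≤ (serreSpan a d ζ).comap (genOp ζ a d g) := by
  intro x hx
  match g with
  | .E i => exact opE_mem a d ζ i x hx
  | .F i => exact opF_mem ζ had i x hx
  | .K i => exact opK_mem a d ζ _ x hx
  | .Kinv i => exact opK_mem a d ζ _ x hx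

/-- The action of the free algebra on the model modulo the Serre relations. -/
def freeAction (had : IsSymmetrizableGCM a d) :
    FreeAlgebra k (Gen n) →ₐ[k] Module.End k (Psi k n ⧸ serreSpan a d ζ) :=
  FreeAlgebra.lift k fun g => (serreSpan a d ζ).mapQ _ (genOp ζ a d g) (genOp_mem ζ had g)

theorem freeAction_mkQ (had : IsSymmetrizableGCM a d) (x : FreeAlgebra k (Gen n)) (y : Psi k n) :
    freeAction ζ had x ((serreSpan a d ζ).mkQ y) =
      (serreSpan a d ζ).mkQ (FreeAlgebra.lift k (genOp ζ a d) x y) := by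
  induction x using FreeAlgebra.induction generalizing y with
  | grade0 r => simp [Module.algebraMap_end_apply]
  | grade1 g => simp [freeAction]
  | mul x x' h h' => simp only [map_mul, Module.End.mul_apply, h, h']
  | add x x' h h' => simp only [map_add, LinearMap.add_apply, h, h']

theorem lift_genOp_gen (g : Gen n) :
    FreeAlgebra.lift k (genOp ζ a d) (gen g) = genOp ζ a d g :=
  FreeAlgebra.lift_ι_apply _ _

theorem freeAction_rel (had : IsSymmetrizableGCM a d) ⦃x y : FreeAlgebra k (Gen n)⦄
    (h : Rel a d ζ x y) : freeAction ζ had x = freeAction ζ had y := by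
  have key : (∀ z, FreeAlgebra.lift k (genOp ζ a d) x z - FreeAlgebra.lift k (genOp ζ a d) y z ∈
      serreSpan a d ζ) → freeAction ζ had x = freeAction ζ had y := by
    intro h
    refine LinearMap.ext fun z => ?_
    obtain ⟨z, rfl⟩ := (serreSpan a d ζ).mkQ_surjective z
    rw [freeAction_mkQ, freeAction_mkQ, ← sub_eq_zero, ← map_sub]
    exact (Submodule.Quotient.mk_eq_zero _).2 (h z)
  have key' : FreeAlgebra.lift k (genOp ζ a d) x = FreeAlgebra.lift k (genOp ζ a d) y →
      freeAction ζ had x = freeAction ζ had y := by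
    intro h
    refine key fun z => ?_
    rw [h, sub_self]
    exact Submodule.zero_mem _
  cases h with
  | K_mul_Kinv i =>
    refine key' ?_
    rw [map_mul, lift_genOp_gen, lift_genOp_gen, map_one, genOp, genOp, opK_opK, add_neg_cancel,
      opK_zero]
  | Kinv_mul_K i =>
    refine key' ?_
    rw [map_mul, lift_genOp_gen, lift_genOp_gen, map_one, genOp, genOp, opK_opK, neg_add_cancel,
      opK_zero]
  | K_comm i j =>
    refine key' ?_
    rw [map_mul, map_mul, lift_genOp_gen, lift_genOp_gen, genOp, genOp, opK_opK, opK_opK, add_comm]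
  | K_E i j =>
    refine key' ?_
    rw [map_smul, map_mul, map_mul, lift_genOp_gen, lift_genOp_gen, genOp, genOp, opK_opE,
      pair_single]
  | K_F i j =>
    refine key' ?_
    rw [map_smul, map_mul, map_mul, lift_genOp_gen, lift_genOp_gen, genOp, genOp,
      opK_opF_single]
  | E_F i j =>
    refine key' ?_
    rw [map_sub, map_mul, map_mul, lift_genOp_gen, lift_genOp_gen, genOp, genOp, sub_eq_iff_eq_add',
      opE_opF]
    congr 1
    split_ifs
    · rw [map_sub, lift_genOp_gen, lift_genOp_gen]; rfl
    · rw [map_zero]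
  | serre_E i j h =>
    refine key fun z => ?_
    have hs := map_serre (A' := Module.End k (Psi k n)) (FreeAlgebra.lift k (genOp ζ a d)) ζ (d i)
      (a i j) (gen (.E i)) (gen (.E j))
    rw [hs, lift_genOp_gen, lift_genOp_gen, map_zero, LinearMap.zero_apply, sub_zero]
    simpa [genOp] using serreE_mem a d ζ i j h [] z
  | serre_F i j h =>
    refine key fun z => ?_
    have hs := map_serre (A' := Module.End k (Psi k n)) (FreeAlgebra.lift k (genOp ζ a d)) ζ (d i)
      (a i j) (gen (.F i)) (gen (.F j))
    rw [hs, lift_genOp_gen, lift_genOp_gen, map_zero, LinearMap.zero_apply, sub_zero]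
    exact serreF_apply_mem ζ had i j h z

/-- The action of `U` on the model modulo the Serre relations. -/
def uAction (had : IsSymmetrizableGCM a d) :
    Uq a d ζ →ₐ[k] Module.End k (Psi k n ⧸ serreSpan a d ζ) :=
  RingQuot.liftAlgHom k ⟨freeAction ζ had, freeAction_rel ζ had⟩

theorem uAction_uGen (had : IsSymmetrizableGCM a d) (g : Gen n) (y : Psi k n) :
    uAction ζ had (uGen a d ζ g) ((serreSpan a d ζ).mkQ y) =
      (serreSpan a d ζ).mkQ (genOp ζ a d g y) := by
  rw [uAction, uGen, RingQuot.liftAlgHom_mkAlgHom_apply, freeAction_mkQ, lift_genOp_gen]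

theorem uAction_uKpow (had : IsSymmetrizableGCM a d) (ν : Fin n → ℤ) : ∀ y : Psi k n,
    uAction ζ had (uKpow a d ζ ν : Uq a d ζ) ((serreSpan a d ζ).mkQ y) =
      (serreSpan a d ζ).mkQ (opK a d ζ ν y) := by
  refine zpow_induction (P := fun ν => ∀ y : Psi k n,
    uAction ζ had (uKpow a d ζ ν : Uq a d ζ) ((serreSpan a d ζ).mkQ y) =
      (serreSpan a d ζ).mkQ (opK a d ζ ν y)) ?_ ?_ ?_ ?_ ν
  · intro y
    rw [uKpow_zero, Units.val_one, map_one, opK_zero]; rfl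
  · intro μ ν hμ hν y
    rw [uKpow_add, Units.val_mul, map_mul, Module.End.mul_apply, hν, hμ, ← opK_opK]; rfl
  · intro μ hμ y
    have h1 := hμ (opK a d ζ (-μ) y)
    rw [← Module.End.mul_apply (opK a d ζ μ), opK_opK, add_neg_cancel, opK_zero,
      Module.End.one_apply] at h1
    rw [uKpow_neg, ← h1, ← Module.End.mul_apply, ← map_mul, Units.inv_mul, map_one,
      Module.End.one_apply]
  · intro i y
    rw [uKpow_single, zpow_one]
    exact uAction_uGen ζ had (.K i) y

/-- Each monomial reproduces its own basis vector from the vacuum, so monomials satisfy no linear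
relations beyond those spanned by Serre relations in one of the two words. -/
theorem uAction_uMon (had : IsSymmetrizableGCM a d) (w μ v) :
    uAction ζ had (uMon a d ζ w μ v) ((serreSpan a d ζ).mkQ (psi k [] 0 [])) =
      (serreSpan a d ζ).mkQ (psi k w μ v) := by
  have hF : uAction ζ had (v.map (uF a d ζ)).prod ((serreSpan a d ζ).mkQ (psi k [] 0 [])) =
      (serreSpan a d ζ).mkQ (psi k [] 0 v) := by
    induction v with
    | nil => simp
    | cons i v ih =>
      rw [List.map_cons, List.prod_cons, map_mul, Module.End.mul_apply, ih, uF, uAction_uGen,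
        genOp, opF_psi_nil, pair_zero]
      simp
  rw [uMon, map_mul, map_mul, Module.End.mul_apply, Module.End.mul_apply, hF, uAction_uKpow,
    opK_psi_nil]
  induction w with
  | nil => simp
  | cons i w ih =>
    rw [List.map_cons, List.prod_cons, map_mul, Module.End.mul_apply, ih, uE, uAction_uGen, genOp,
      opE_psi]

/-- The triangular decomposition of `U`: a function on triples `(w, μ, v)` which is compatible
with the Serre relations extends to a linear map on `U`. -/
theorem exists_linearMap_uMon (had : IsSymmetrizableGCM a d) {X : Type*} [AddCommGroup X]
    [Module k X] (f : List (Fin n) → (Fin n → ℤ) → List (Fin n) → X)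
    (hE : ∀ i j, i ≠ j → ∀ u w μ v, ∑ r ∈ Finset.range ((1 - a i j).toNat + 1),
      serreCoef ζ (d i) (a i j) r • f (u ++ serreWord i j (1 - a i j).toNat r ++ w) μ v = 0)
    (hF : ∀ i j, i ≠ j → ∀ w μ u v, ∑ r ∈ Finset.range ((1 - a i j).toNat + 1),
      serreCoef ζ (d i) (a i j) r • f w μ (u ++ serreWord i j (1 - a i j).toNat r ++ v) = 0) :
    ∃ g : Uq a d ζ →ₗ[k] X, ∀ w μ v, g (uMon a d ζ w μ v) = f w μ v := by
  have hker : serreSpan a d ζ ≤ LinearMap.ker (psiLift (k := k) f) := by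
    refine Submodule.span_le.2 ?_
    rintro x (⟨i, j, h, u, w, μ, v, rfl⟩ | ⟨i, j, h, w, μ, u, v, rfl⟩)
    · rw [SetLike.mem_coe, LinearMap.mem_ker, map_sum]
      simpa only [map_smul, psiLift_psi] using hE i j h u w μ v
    · rw [SetLike.mem_coe, LinearMap.mem_ker, map_sum]
      simpa only [map_smul, psiLift_psi] using hF i j h w μ u v
  refine ⟨(serreSpan a d ζ).liftQ (psiLift f) hker ∘ₗ
    (LinearMap.applyₗ ((serreSpan a d ζ).mkQ (psi k [] 0 []))) ∘ₗ (uAction ζ had).toLinearMap,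
    fun w μ v => ?_⟩
  simp only [LinearMap.comp_apply, AlgHom.toLinearMap_apply, LinearMap.applyₗ_apply_apply]
  rw [uAction_uMon, ← LinearMap.comp_apply, Submodule.liftQ_mkQ, psiLift_psi]

end Action

/-! ### Spanning by monomials, and gradings -/

section Spanning

variable {k : Type*} [Field k] {n : ℕ} (a : Matrix (Fin n) (Fin n) ℤ) (d : Fin n → ℕ) (ζ : kˣ)

theorem uE_mul_uMon (i : Fin n) (w μ v) :
    uE a d ζ i * uMon a d ζ w μ v = uMon a d ζ (i :: w) μ v := by
  simp [uMon, mul_assoc]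

theorem uKpow_mul_uMon (ν : Fin n → ℤ) (w μ v) : (uKpow a d ζ ν : Uq a d ζ) * uMon a d ζ w μ v =
    ((ζ ^ pairW a d ν w : kˣ) : k) • uMon a d ζ w (ν + μ) v := by
  rw [uMon, ← mul_assoc, ← mul_assoc, skew_prod ζ _ _ _ (uKpow_uE a d ζ ν), smul_mul_assoc,
    smul_mul_assoc, uMon, uKpow_add, Units.val_mul, pairW, mul_assoc _ (uKpow a d ζ ν : Uq a d ζ)]

theorem uF_mul_uMon_nil (i : Fin n) (μ v) : uF a d ζ i * uMon a d ζ [] μ v =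
    ((ζ ^ pair a d μ i : kˣ) : k) • uMon a d ζ [] μ (i :: v) := by
  have h := uKpow_uF a d ζ μ i
  simp only [uMon, List.map_nil, List.prod_nil, one_mul, List.map_cons, List.prod_cons]
  rw [← mul_assoc _ (uF a d ζ i), h, smul_mul_assoc, smul_smul, ← Units.val_mul, ← zpow_add,
    mul_assoc]
  simp

theorem uF_mul_uMon_cons (i j : Fin n) (w μ v) : uF a d ζ i * uMon a d ζ (j :: w) μ v =
    uE a d ζ j * (uF a d ζ i * uMon a d ζ w μ v) - if j = i then
      (uKpow a d ζ (Pi.single j 1) : Uq a d ζ) * uMon a d ζ w μ v -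
        (uKpow a d ζ (-Pi.single j 1) : Uq a d ζ) * uMon a d ζ w μ v else 0 := by
  rw [← uE_mul_uMon, ← mul_assoc, ← mul_assoc, uE_uF, add_mul]
  split_ifs
  · rw [sub_mul]; abel
  · simp

/-- The sum of the weights `g i` over the letters of a word. -/
def wsum {M : Type*} [AddCommMonoid M] (g : Fin n → M) (w : List (Fin n)) : M := (w.map g).sum

@[simp] theorem wsum_nil {M : Type*} [AddCommMonoid M] (g : Fin n → M) : wsum g [] = 0 := rfl

@[simp] theorem wsum_cons {M : Type*} [AddCommMonoid M] (g : Fin n → M) (i : Fin n) (w) :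
    wsum g (i :: w) = g i + wsum g w := by simp [wsum]

theorem wsum_perm {M : Type*} [AddCommMonoid M] (g : Fin n → M) {w w' : List (Fin n)}
    (h : w.Perm w') : wsum g w = wsum g w' := (h.map g).sum_eq

/-- The homogeneous component of degree `s`, where `E_i` has degree `g i`,
`F_i` has degree `- g i`, and `K_i` has degree `0`. -/
def uDeg (g : Fin n → ℤ) (s : ℤ) : Submodule k (Uq a d ζ) :=
  Submodule.span k {x | ∃ w μ v, wsum g w - wsum g v = s ∧ x = uMon a d ζ w μ v}

variable {a d ζ}

theorem uMon_mem_uDeg (g : Fin n → ℤ) {s : ℤ} (w μ v) (h : wsum g w - wsum g v = s) :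
    uMon a d ζ w μ v ∈ uDeg a d ζ g s :=
  Submodule.subset_span ⟨w, μ, v, h, rfl⟩

theorem uDeg_le_comap {g : Fin n → ℤ} {s : ℤ} {X : Type*} [AddCommGroup X] [Module k X]
    (f : Uq a d ζ →ₗ[k] X) (S : Submodule k X)
    (h : ∀ w μ v, wsum g w - wsum g v = s → f (uMon a d ζ w μ v) ∈ S) {x : Uq a d ζ}
    (hx : x ∈ uDeg a d ζ g s) : f x ∈ S := by
  have : uDeg a d ζ g s ≤ S.comap f := by
    refine Submodule.span_le.2 ?_
    rintro _ ⟨w, μ, v, hs, rfl⟩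
    exact h w μ v hs
  exact this hx

theorem uE_mul_mem_uDeg {g : Fin n → ℤ} {s : ℤ} (i : Fin n) {x : Uq a d ζ}
    (hx : x ∈ uDeg a d ζ g s) : uE a d ζ i * x ∈ uDeg a d ζ g (g i + s) :=
  uDeg_le_comap (LinearMap.mulLeft k _) _ (fun w μ v h => by
    rw [LinearMap.mulLeft_apply, uE_mul_uMon]
    exact uMon_mem_uDeg g _ _ _ (by rw [wsum_cons, ← h]; ring)) hx

theorem uKpow_mul_mem_uDeg {g : Fin n → ℤ} {s : ℤ} (ν : Fin n → ℤ) {x : Uq a d ζ}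
    (hx : x ∈ uDeg a d ζ g s) : (uKpow a d ζ ν : Uq a d ζ) * x ∈ uDeg a d ζ g s :=
  uDeg_le_comap (LinearMap.mulLeft k _) _ (fun w μ v h => by
    rw [LinearMap.mulLeft_apply, uKpow_mul_uMon]
    exact Submodule.smul_mem _ _ (uMon_mem_uDeg g _ _ _ h)) hx

theorem uF_mul_mem_uDeg {g : Fin n → ℤ} {s : ℤ} (i : Fin n) {x : Uq a d ζ}
    (hx : x ∈ uDeg a d ζ g s) : uF a d ζ i * x ∈ uDeg a d ζ g (-g i + s) := by
  refine uDeg_le_comap (LinearMap.mulLeft k _) _ (fun w μ v h => ?_) hx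
  rw [LinearMap.mulLeft_apply]
  clear hx
  induction w generalizing s with
  | nil =>
    rw [uF_mul_uMon_nil]
    exact Submodule.smul_mem _ _ (uMon_mem_uDeg g _ _ _ (by rw [wsum_cons, ← h]; ring))
  | cons j w ih =>
    have h1 := ih rfl
    rw [uF_mul_uMon_cons]
    refine Submodule.sub_mem _ ?_ ?_
    · convert uE_mul_mem_uDeg j h1 using 2
      rw [← h, wsum_cons]; ring
    · split_ifs with hij
      · subst hij
        -- $E_j$ and $F_j$, of opposite degrees, have been traded for an element of the torus.
        have h2 : uMon a d ζ w μ v ∈ uDeg a d ζ g (-g j + s) :=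
          uMon_mem_uDeg g _ _ _ (by rw [← h, wsum_cons]; ring)
        exact Submodule.sub_mem _ (uKpow_mul_mem_uDeg _ h2) (uKpow_mul_mem_uDeg _ h2)
      · exact Submodule.zero_mem _

theorem uMon_mul_mem_uDeg {g : Fin n → ℤ} {s : ℤ} (w μ v) {x : Uq a d ζ}
    (hx : x ∈ uDeg a d ζ g s) : uMon a d ζ w μ v * x ∈ uDeg a d ζ g (wsum g w - wsum g v + s) := by
  have hF : (v.map (uF a d ζ)).prod * x ∈ uDeg a d ζ g (-wsum g v + s) := by
    induction v with
    | nil => simpa using hx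
    | cons i v ih =>
      rw [List.map_cons, List.prod_cons, mul_assoc, wsum_cons]
      convert uF_mul_mem_uDeg i ih using 2
      ring
  rw [uMon, mul_assoc, mul_assoc]
  induction w with
  | nil => simpa using uKpow_mul_mem_uDeg μ hF
  | cons i w ih =>
    rw [List.map_cons, List.prod_cons, mul_assoc, wsum_cons]
    convert uE_mul_mem_uDeg i ih using 2
    ring

theorem mul_mem_uDeg {g : Fin n → ℤ} {s t : ℤ} {x y : Uq a d ζ}
    (hx : x ∈ uDeg a d ζ g s) (hy : y ∈ uDeg a d ζ g t) : x * y ∈ uDeg a d ζ g (s + t) :=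
  uDeg_le_comap (LinearMap.mulRight k y) _ (fun w μ v h => by
    rw [← h]; exact uMon_mul_mem_uDeg w μ v hy) hx

theorem uMon_nil_zero_nil : uMon a d ζ [] 0 [] = 1 := by simp [uMon, uKpow_zero]

theorem uKpow_eq_uMon (μ : Fin n → ℤ) : (uKpow a d ζ μ : Uq a d ζ) = uMon a d ζ [] μ [] := by
  simp [uMon]

theorem one_mem_uDeg (g : Fin n → ℤ) : (1 : Uq a d ζ) ∈ uDeg a d ζ g 0 := by
  rw [← uMon_nil_zero_nil]
  exact uMon_mem_uDeg g _ _ _ (by simp)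

theorem uKpow_mem_uDeg (g : Fin n → ℤ) (μ : Fin n → ℤ) :
    (uKpow a d ζ μ : Uq a d ζ) ∈ uDeg a d ζ g 0 := by
  rw [uKpow_eq_uMon]
  exact uMon_mem_uDeg g _ _ _ (by simp)

theorem uE_mem_uDeg (g : Fin n → ℤ) (i : Fin n) : uE a d ζ i ∈ uDeg a d ζ g (g i) := by
  simpa using uE_mul_mem_uDeg i (one_mem_uDeg (a := a) (d := d) (ζ := ζ) g)

theorem uF_mem_uDeg (g : Fin n → ℤ) (i : Fin n) : uF a d ζ i ∈ uDeg a d ζ g (-g i) := by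
  simpa using uF_mul_mem_uDeg i (one_mem_uDeg (a := a) (d := d) (ζ := ζ) g)

/-- For zero weights every monomial has degree zero, so this says that the monomials span: their
span contains $1$ and is stable under left multiplication by the generators. -/
theorem uDeg_zero_eq_top : uDeg a d ζ 0 0 = ⊤ := by
  rw [eq_top_iff]
  rintro u -
  obtain ⟨x, rfl⟩ := RingQuot.mkAlgHom_surjective k (Rel a d ζ) u
  have key : ∀ y ∈ uDeg a d ζ 0 0, RingQuot.mkAlgHom k (Rel a d ζ) x * y ∈ uDeg a d ζ 0 0 := by
    induction x using FreeAlgebra.induction with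
    | grade0 r =>
      intro y hy
      rw [AlgHom.commutes, ← Algebra.smul_def]
      exact Submodule.smul_mem _ _ hy
    | grade1 g =>
      intro y hy
      change uGen a d ζ g * y ∈ _
      match g with
      | .E i => simpa [uE] using uE_mul_mem_uDeg i hy
      | .F i => simpa [uF] using uF_mul_mem_uDeg i hy
      | .K i =>
        have := uKpow_mul_mem_uDeg (Pi.single i 1) hy
        rw [uKpow_single, zpow_one] at this
        exact this
      | .Kinv i =>
        have := uKpow_mul_mem_uDeg (-Pi.single i 1) hy
        rw [uKpow_neg_single] at this
        exact this
    | mul x x' h h' =>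
      intro y hy
      rw [map_mul, mul_assoc]
      exact h _ (h' _ hy)
    | add x x' h h' =>
      intro y hy
      rw [map_add, add_mul]
      exact Submodule.add_mem _ (h _ hy) (h' _ hy)
  simpa using key 1 (one_mem_uDeg _)

theorem span_range_uMon :
    Submodule.span k (Set.range fun x : List (Fin n) × (Fin n → ℤ) × List (Fin n) =>
      uMon a d ζ x.1 x.2.1 x.2.2) = ⊤ := by
  rw [eq_top_iff, ← uDeg_zero_eq_top]
  refine Submodule.span_mono ?_
  rintro _ ⟨w, μ, v, -, rfl⟩
  exact ⟨(w, μ, v), rfl⟩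

end Spanning

/-! ### Linear maps on `U` defined on monomials -/

section Filter

variable {k : Type*} [Field k] {n : ℕ} {a : Matrix (Fin n) (Fin n) ℤ} {d : Fin n → ℕ} {ζ : kˣ}

theorem serreWord_perm (i j : Fin n) {m r : ℕ} (h : r ≤ m) :
    (serreWord i j m r).Perm (serreWord i j m 0) := by
  have h1 : List.replicate m i = List.replicate (m - r) i ++ List.replicate r i := by
    rw [← List.replicate_add]; congr 1; omega
  simp only [serreWord, Nat.sub_zero, h1, List.replicate_zero, List.append_assoc]
  refine List.Perm.append_left _ ?_
  exact (List.perm_append_singleton _ _).symm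

theorem serre_sum_uMon_left (i j : Fin n) (h : i ≠ j) (u w μ v) :
    ∑ r ∈ Finset.range ((1 - a i j).toNat + 1), serreCoef ζ (d i) (a i j) r •
      uMon a d ζ (u ++ serreWord i j (1 - a i j).toNat r ++ w) μ v = 0 := by
  have := prod_serre_prod ζ (d i) (a i j) (uE a d ζ) i j u w
  rw [serre_uE a d ζ i j h, mul_zero, zero_mul] at this
  simp only [uMon, ← smul_mul_assoc, ← Finset.sum_mul]
  rw [← this, zero_mul, zero_mul]

theorem serre_sum_uMon_right (i j : Fin n) (h : i ≠ j) (w μ u v) :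
    ∑ r ∈ Finset.range ((1 - a i j).toNat + 1), serreCoef ζ (d i) (a i j) r •
      uMon a d ζ w μ (u ++ serreWord i j (1 - a i j).toNat r ++ v) = 0 := by
  have := prod_serre_prod ζ (d i) (a i j) (uF a d ζ) i j u v
  rw [serre_uF a d ζ i j h, mul_zero, zero_mul] at this
  simp only [uMon, ← mul_smul_comm, ← Finset.mul_sum]
  rw [← this, mul_zero]

open scoped Classical in
-- The words of one Serre relation are permutations of each other, so a condition that ignores the
-- order of letters keeps or drops all of them together. Only the relations that are kept have to be
-- checked.
theorem exists_linearMap_filter (had : IsSymmetrizableGCM a d) {X : Type*} [AddCommGroup X]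
    [Module k X] (P : List (Fin n) → (Fin n → ℤ) → List (Fin n) → Prop)
    (hPw : ∀ w w' μ v, w.Perm w' → (P w μ v ↔ P w' μ v))
    (hPv : ∀ w μ v v', v.Perm v' → (P w μ v ↔ P w μ v'))
    (f : List (Fin n) → (Fin n → ℤ) → List (Fin n) → X)
    (hE : ∀ i j, i ≠ j → ∀ u w μ v, P (u ++ serreWord i j (1 - a i j).toNat 0 ++ w) μ v →
      ∑ r ∈ Finset.range ((1 - a i j).toNat + 1),
      serreCoef ζ (d i) (a i j) r • f (u ++ serreWord i j (1 - a i j).toNat r ++ w) μ v = 0)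
    (hF : ∀ i j, i ≠ j → ∀ w μ u v, P w μ (u ++ serreWord i j (1 - a i j).toNat 0 ++ v) →
      ∑ r ∈ Finset.range ((1 - a i j).toNat + 1),
      serreCoef ζ (d i) (a i j) r • f w μ (u ++ serreWord i j (1 - a i j).toNat r ++ v) = 0) :
    ∃ g : Uq a d ζ →ₗ[k] X, ∀ w μ v, g (uMon a d ζ w μ v) = if P w μ v then f w μ v else 0 := by
  have hperm : ∀ (i j : Fin n) (u w : List (Fin n)), ∀ r ∈ Finset.range ((1 - a i j).toNat + 1),
      (u ++ serreWord i j (1 - a i j).toNat r ++ w).Perm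
        (u ++ serreWord i j (1 - a i j).toNat 0 ++ w) := fun i j u w r hr =>
    ((serreWord_perm i j (Nat.lt_succ_iff.1 (Finset.mem_range.1 hr))).append_left u).append_right w
  refine exists_linearMap_uMon ζ had _ ?_ ?_
  · intro i j h u w μ v
    by_cases hP : P (u ++ serreWord i j (1 - a i j).toNat 0 ++ w) μ v
    · rw [← hE i j h u w μ v hP]
      refine Finset.sum_congr rfl fun r hr => ?_
      rw [if_pos ((hPw _ _ μ v (hperm i j u w r hr)).2 hP)]
    · refine Finset.sum_eq_zero fun r hr => ?_
      rw [if_neg (fun h => hP ((hPw _ _ μ v (hperm i j u w r hr)).1 h)), smul_zero]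
  · intro i j h w μ u v
    by_cases hP : P w μ (u ++ serreWord i j (1 - a i j).toNat 0 ++ v)
    · rw [← hF i j h w μ u v hP]
      refine Finset.sum_congr rfl fun r hr => ?_
      rw [if_pos ((hPv w μ _ _ (hperm i j u v r hr)).2 hP)]
    · refine Finset.sum_eq_zero fun r hr => ?_
      rw [if_neg (fun h => hP ((hPv w μ _ _ (hperm i j u v r hr)).1 h)), smul_zero]

open scoped Classical in
theorem exists_projection (had : IsSymmetrizableGCM a d)
    (P : List (Fin n) → (Fin n → ℤ) → List (Fin n) → Prop)
    (hPw : ∀ w w' μ v, w.Perm w' → (P w μ v ↔ P w' μ v))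
    (hPv : ∀ w μ v v', v.Perm v' → (P w μ v ↔ P w μ v')) :
    ∃ g : Uq a d ζ →ₗ[k] Uq a d ζ, ∀ w μ v, g (uMon a d ζ w μ v) =
      if P w μ v then uMon a d ζ w μ v else 0 :=
  exists_linearMap_filter had P hPw hPv _
    (fun i j h u w μ v _ => serre_sum_uMon_left i j h u w μ v)
    (fun i j h w μ u v _ => serre_sum_uMon_right i j h w μ u v)

end Filter

/-! ### The direct sum decompositions -/

section Internal

open scoped Classical in
-- The family `b` need not be independent: the maps `p i` alone separate the summands.
theorem isInternal_and_directProj {k M ι κ : Type*} [Field k] [AddCommGroup M] [Module k M]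
    [DecidableEq ι] (b : κ → M) (hb : Submodule.span k (Set.range b) = ⊤) (key : κ → ι)
    (W : ι → Submodule k M) (hW : ∀ i, W i = Submodule.span k {x | ∃ y, key y = i ∧ x = b y})
    (p : ι → M →ₗ[k] M) (hp : ∀ i y, p i (b y) = if key y = i then b y else 0) :
    DirectSum.IsInternal W ∧ ∀ i, directProj W i = p i := by
  have hmem : ∀ y, b y ∈ W (key y) := fun y => by
    rw [hW]; exact Submodule.subset_span ⟨y, rfl, rfl⟩
  have hint : DirectSum.IsInternal W := by
    rw [DirectSum.isInternal_submodule_iff_iSupIndep_and_iSup_eq_top]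
    constructor
    · rw [iSupIndep_def]
      intro i
      rw [Submodule.disjoint_def]
      intro x hx hx'
      have h1 : W i ≤ LinearMap.eqLocus (p i) LinearMap.id := by
        rw [hW, Submodule.span_le]
        rintro _ ⟨y, hy, rfl⟩
        simp [hp, hy]
      have h2 : (⨆ j, ⨆ (_ : j ≠ i), W j) ≤ LinearMap.ker (p i) := by
        refine iSup₂_le fun j hj => ?_
        rw [hW, Submodule.span_le]
        rintro _ ⟨y, hy, rfl⟩
        simp [hp, hy, hj]
      have h3 : p i x = x := h1 hx
      rw [← h3]
      exact h2 hx'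
    · rw [eq_top_iff, ← hb, Submodule.span_le]
      rintro _ ⟨y, rfl⟩
      exact Submodule.mem_iSup_of_mem _ (hmem y)
  refine ⟨hint, fun i => ?_⟩
  rw [directProj, dif_pos hint]
  refine LinearMap.ext_on_range hb fun y => ?_
  have h1 : (LinearEquiv.ofBijective (DirectSum.coeLinearMap W) hint).symm (b y) =
      DirectSum.lof k ι (fun j => W j) (key y) ⟨b y, hmem y⟩ := by
    rw [LinearEquiv.symm_apply_eq]
    exact (DirectSum.coeLinearMap_lof W (key y) ⟨b y, hmem y⟩).symm
  simp only [LinearMap.comp_apply, LinearEquiv.coe_coe, h1, hp]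
  split_ifs with h
  · subst h
    rw [DirectSum.component.lof_self]
    rfl
  · rw [DirectSum.component.of, dif_neg h, map_zero]

theorem adjoin_range_toSubmodule {k A ι : Type*} [Field k] [Ring A] [Algebra k A] (f : ι → A) :
    (Algebra.adjoin k (Set.range f)).toSubmodule =
      Submodule.span k (Set.range fun w : List ι => (w.map f).prod) := by
  rw [Algebra.adjoin_eq_span]
  congr 1
  ext x
  constructor
  · intro hx
    induction hx using Submonoid.closure_induction with
    | mem x hx => obtain ⟨i, rfl⟩ := hx; exact ⟨[i], by simp⟩
    | one => exact ⟨[], by simp⟩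
    | mul x y _ _ hx hy =>
      obtain ⟨v, rfl⟩ := hx
      obtain ⟨w, rfl⟩ := hy
      exact ⟨v ++ w, by simp⟩
  · rintro ⟨w, rfl⟩
    refine Submonoid.list_prod_mem _ fun y hy => ?_
    obtain ⟨i, -, rfl⟩ := List.mem_map.1 hy
    exact Submonoid.subset_closure ⟨i, rfl⟩

variable {k : Type*} [Field k] {n : ℕ} (a : Matrix (Fin n) (Fin n) ℤ) (d : Fin n → ℕ) (ζ : kˣ)

/-- The weight of a word. -/
def wt (w : List (Fin n)) : Fin n → ℤ := wsum (fun i => Pi.single i 1) w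

/-- Collecting the $K_i$ from a word in the $F_iK_i$ shifts the torus exponent by the weight of the
word. This is why $P_\lambda$ selects the monomials with `μ - wt v = λ`. -/
theorem uKpow_mul_prod_FK (v : List (Fin n)) : ∀ l : Fin n → ℤ, ∃ s : kˣ,
    (uKpow a d ζ l : Uq a d ζ) *
      (v.map fun i => uF a d ζ i * (uK a d ζ i : Uq a d ζ)).prod =
    (s : k) • ((uKpow a d ζ (l + wt v) : Uq a d ζ) * (v.map (uF a d ζ)).prod) := by
  induction v with
  | nil => exact fun l => ⟨1, by simp [wt]⟩
  | cons i v ih =>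
    intro l
    obtain ⟨s, hs⟩ := ih (l + Pi.single i 1)
    refine ⟨ζ ^ (-pair a d l i) * s * ζ ^ (pair a d (l + wt (i :: v)) i), ?_⟩
    have h1 : (uKpow a d ζ l : Uq a d ζ) * (uK a d ζ i : Uq a d ζ) =
        (uKpow a d ζ (l + Pi.single i 1) : Uq a d ζ) := by
      rw [uKpow_add, uKpow_single, zpow_one, Units.val_mul]
    have h2 : l + Pi.single i 1 + wt v = l + wt (i :: v) := by
      rw [wt, wt, wsum_cons, add_assoc]
    have h3 := uKpow_uF a d ζ (l + wt (i :: v)) i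
    simp only [List.map_cons, List.prod_cons]
    rw [← mul_assoc, ← mul_assoc, uKpow_uF, smul_mul_assoc, mul_assoc (uF a d ζ i), h1,
      smul_mul_assoc, mul_assoc, hs, h2, mul_smul_comm, ← mul_assoc, ← mul_assoc _ (uF a d ζ i), h3,
      smul_mul_assoc]
    simp only [smul_smul, Units.val_mul, mul_assoc]
    congr 1
    rw [← Units.val_mul (ζ ^ pair _ _ _ _), ← zpow_add]
    simp

theorem UKG_eq (l : Fin n → ℤ) : UKG a d ζ l = Submodule.span k
    {x | ∃ y : List (Fin n) × (Fin n → ℤ) × List (Fin n), y.2.1 - wt y.2.2 = l ∧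
      x = uMon a d ζ y.1 y.2.1 y.2.2} := by
  rw [UKG, Uplus, Gminus, adjoin_range_toSubmodule, adjoin_range_toSubmodule,
    Submodule.span_mul_span, Submodule.span_mul_span]
  apply le_antisymm
  · rw [Submodule.span_le]
    rintro _ ⟨_, ⟨_, ⟨w, rfl⟩, _, rfl, rfl⟩, _, ⟨v, rfl⟩, rfl⟩
    obtain ⟨s, hs⟩ := uKpow_mul_prod_FK a d ζ v l
    simp only [mul_assoc, hs, mul_smul_comm]
    refine Submodule.smul_mem _ _ (Submodule.subset_span ⟨(w, l + wt v, v), by simp, ?_⟩)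
    rw [uMon, mul_assoc]
  · rw [Submodule.span_le]
    rintro _ ⟨⟨w, μ, v⟩, h, rfl⟩
    obtain ⟨s, hs⟩ := uKpow_mul_prod_FK a d ζ v l
    have h1 : uMon a d ζ w μ v = ((s⁻¹ : kˣ) : k) • ((w.map (uE a d ζ)).prod *
        (uKpow a d ζ l : Uq a d ζ) *
        (v.map fun i => uF a d ζ i * (uK a d ζ i : Uq a d ζ)).prod) := by
      rw [mul_assoc, hs, mul_smul_comm, smul_smul, Units.inv_mul, one_smul, ← mul_assoc, ← h, uMon]
      simp
    simp only [h1]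
    exact Submodule.smul_mem _ _ (Submodule.subset_span
      ⟨_, ⟨_, ⟨w, rfl⟩, _, rfl, rfl⟩, _, ⟨v, rfl⟩, rfl⟩)

theorem Hsub_toSubmodule : (Hsub a d ζ).toSubmodule =
    Submodule.span k (Set.range fun μ => (uKpow a d ζ μ : Uq a d ζ)) := by
  rw [Hsub, Algebra.adjoin_eq_span]
  congr 1
  ext x
  constructor
  · intro hx
    induction hx using Submonoid.closure_induction with
    | mem x hx =>
      rcases hx with ⟨i, rfl⟩ | ⟨i, rfl⟩
      · exact ⟨Pi.single i 1, by simp [uKpow_single]⟩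
      · exact ⟨-Pi.single i 1, by simp [uKpow_neg_single]⟩
    | one => exact ⟨0, by simp [uKpow_zero]⟩
    | mul x y _ _ hx hy =>
      obtain ⟨μ, rfl⟩ := hx
      obtain ⟨ν, rfl⟩ := hy
      exact ⟨μ + ν, by simp [uKpow_add]⟩
  · rintro ⟨μ, rfl⟩
    set S := Submonoid.closure (Set.range (fun i => (uK a d ζ i : Uq a d ζ)) ∪
      Set.range (fun i => (((uK a d ζ i)⁻¹ : (Uq a d ζ)ˣ) : Uq a d ζ)))
    refine (zpow_induction (P := fun μ => (uKpow a d ζ μ : Uq a d ζ) ∈ S ∧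
      (uKpow a d ζ (-μ) : Uq a d ζ) ∈ S) ?_ ?_ ?_ ?_ μ).1
    · simp [uKpow_zero, S.one_mem]
    · rintro μ ν ⟨h1, h2⟩ ⟨h3, h4⟩
      rw [neg_add, uKpow_add, uKpow_add, Units.val_mul, Units.val_mul]
      exact ⟨S.mul_mem h1 h3, S.mul_mem h2 h4⟩
    · rintro μ ⟨h1, h2⟩
      exact ⟨h2, by rwa [neg_neg]⟩
    · intro i
      rw [uKpow_neg_single, uKpow_single, zpow_one]
      exact ⟨Submonoid.subset_closure (Or.inl ⟨i, rfl⟩),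
        Submonoid.subset_closure (Or.inr ⟨i, rfl⟩)⟩

theorem UHU_eq (αβ : (Fin n → ℕ) × (Fin n → ℕ)) : UHU a d ζ αβ = Submodule.span k
    {x | ∃ y : List (Fin n) × (Fin n → ℤ) × List (Fin n),
      ((fun i => y.1.count i, fun i => y.2.2.count i) : (Fin n → ℕ) × (Fin n → ℕ)) = αβ ∧
      x = uMon a d ζ y.1 y.2.1 y.2.2} := by
  rw [UHU, UplusDeg, UminusDeg, Hsub_toSubmodule, Submodule.span_mul_span, Submodule.span_mul_span]
  congr 1
  ext x
  constructor
  · rintro ⟨_, ⟨_, ⟨w, hw, rfl⟩, _, ⟨μ, rfl⟩, rfl⟩, _, ⟨v, hv, rfl⟩, rfl⟩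
    exact ⟨(w, μ, v), Prod.ext (funext hw) (funext hv), rfl⟩
  · rintro ⟨⟨w, μ, v⟩, rfl, rfl⟩
    exact ⟨_, ⟨_, ⟨w, fun _ => rfl, rfl⟩, _, ⟨μ, rfl⟩, rfl⟩, _, ⟨v, fun _ => rfl, rfl⟩, rfl⟩

variable {a d}

open scoped Classical in
theorem UKG_isInternal_and_projP (had : IsSymmetrizableGCM a d) :
    DirectSum.IsInternal (UKG a d ζ) ∧ ∀ l w μ v, projP a d ζ l (uMon a d ζ w μ v) =
      if μ - wt v = l then uMon a d ζ w μ v else 0 := by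
  choose p hp using fun l : Fin n → ℤ => exists_projection (ζ := ζ) had
    (fun _ μ v => μ - wt v = l) (fun _ _ _ _ _ => Iff.rfl)
    (fun _ _ v v' h => by rw [wt, wt, wsum_perm _ h])
  have h := isInternal_and_directProj _ (span_range_uMon (a := a) (d := d) (ζ := ζ))
    (fun y => y.2.1 - wt y.2.2) (UKG a d ζ) (UKG_eq a d ζ) p (fun l y => by convert hp l y.1 y.2.1 y.2.2)
  exact ⟨h.1, fun l w μ v => by rw [projP, h.2, hp]; congr⟩

open scoped Classical in
theorem UHU_isInternal_and_projPi (had : IsSymmetrizableGCM a d) :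
    DirectSum.IsInternal (UHU a d ζ) ∧ ∀ w μ v, projPi a d ζ 0 0 (uMon a d ζ w μ v) =
      if w = [] ∧ v = [] then uMon a d ζ w μ v else 0 := by
  choose p hp using fun αβ : (Fin n → ℕ) × (Fin n → ℕ) => exists_projection (ζ := ζ) had
    (fun w _ v => ((fun i => w.count i, fun i => v.count i) : (Fin n → ℕ) × (Fin n → ℕ)) = αβ)
    (fun w w' _ _ h => by rw [show (fun i => w.count i) = fun i => w'.count i from
      funext fun i => h.count_eq i])
    (fun _ _ v v' h => by rw [show (fun i => v.count i) = fun i => v'.count i from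
      funext fun i => h.count_eq i])
  have h := isInternal_and_directProj _ (span_range_uMon (a := a) (d := d) (ζ := ζ))
    (fun y => ((fun i => y.1.count i, fun i => y.2.2.count i) : (Fin n → ℕ) × (Fin n → ℕ)))
    (UHU a d ζ) (UHU_eq a d ζ) p (fun l y => by convert hp l y.1 y.2.1 y.2.2)
  have hnil : ∀ w : List (Fin n), (fun i => w.count i) = (0 : Fin n → ℕ) ↔ w = [] := by
    intro w
    constructor
    · intro hw
      refine List.eq_nil_iff_forall_not_mem.2 fun i hi => ?_
      exact (List.count_pos_iff.2 hi).ne' (congrFun hw i)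
    · rintro rfl
      rfl
  refine ⟨h.1, fun w μ v => ?_⟩
  rw [projPi, h.2, hp]
  simp only [Prod.mk.injEq, hnil]

end Internal

/-! ### Serre polynomials of sums of skew-commuting elements -/

section Abstract

variable {k A : Type*} [Field k] [Ring A] [Algebra k A]

/-- The off-diagonal scalars of the continuants describing `p_{ij}(B_i, B_j)`. -/
def kap (s p δ : k) : ℕ → k
  | 0 => 0
  | t + 1 => p * kap s p δ t + δ * (1 - s ^ 2 * p ^ (2 * t))

/-- The closed form keeps the geometric sum undivided, so that $p=1$ is allowed. -/
theorem kap_succ (s p δ : k) (t : ℕ) :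
    kap s p δ (t + 1) = δ * (∑ r ∈ Finset.range (t + 1), p ^ r) * (1 - s ^ 2 * p ^ t) := by
  induction t with
  | zero => simp [kap]
  | succ t ih =>
    rw [kap, ih, Finset.sum_range_succ' (fun r => p ^ r) (t + 1)]
    have : ∑ r ∈ Finset.range (t + 1), p ^ (r + 1) =
        p * ∑ r ∈ Finset.range (t + 1), p ^ r := by
      rw [Finset.mul_sum]
      exact Finset.sum_congr rfl fun r _ => pow_succ' _ _
    rw [this]
    have h2 := Finset.sum_range_succ (fun r => p ^ r) (t + 1)
    rw [Finset.sum_range_succ' (fun r => p ^ r) (t + 1), this] at h2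
    linear_combination (δ * s ^ 2 * p ^ (t + 1)) * h2

/-- Write $[l]_p=\sum_{r<l}p^r$. Because $s^2p^{m-1}=1$, the factor $1-s^2p^{m-t-1}$ of
$\kappa_{m-t}$ is $1-p'^t=(1-p')[t]_{p'}$, and the one of $\kappa'_t$ is $1-p^{m-t}=(1-p)[m-t]_p$.
Both sides then agree by $-p'(1-p)=1-p'$. -/
theorem kap_reverse {s p s' p' δ : k} (hs : s * s' = 1) (hp : p * p' = 1) {m : ℕ}
    (hm : s ^ 2 * p ^ (m - 1) = 1) {t : ℕ} (h0 : 0 < t) (ht : t < m) :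
    kap s' p' (-(δ * p')) t = kap s p δ (m - t) := by
  obtain ⟨t, rfl⟩ := Nat.exists_eq_succ_of_ne_zero h0.ne'
  obtain ⟨r, rfl⟩ := Nat.exists_eq_add_of_lt ht
  rw [show t.succ + r + 1 - t.succ = r + 1 by omega, Nat.succ_eq_add_one, kap_succ, kap_succ]
  have hs2 : s ^ 2 * s' ^ 2 = 1 := by rw [← mul_pow, hs, one_pow]
  have hpp : ∀ l, p ^ l * p' ^ l = 1 := fun l => by rw [← mul_pow, hp, one_pow]
  have hm' : s ^ 2 * (p ^ (t + 1) * p ^ r) = 1 := by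
    rw [← pow_add, ← hm]; congr 2
  have e1 : s ^ 2 * p ^ r = p' ^ (t + 1) := by
    linear_combination (-s ^ 2 * p ^ r) * hpp (t + 1) + p' ^ (t + 1) * hm'
  have e2 : s' ^ 2 * p' ^ t = p ^ (r + 1) := by
    have h3 := hpp t
    rw [pow_succ p t] at hm'
    rw [pow_succ]
    linear_combination (p ^ (r + 1)) * hs2 * (p ^ t * p' ^ t) + p ^ (r + 1) * h3 -
      s' ^ 2 * p' ^ t * hm'
  rw [e1, e2]
  have g1 := mul_neg_geom_sum p (r + 1)
  have g2 := mul_neg_geom_sum p' (t + 1)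
  rw [← g1, ← g2]
  linear_combination (δ * (∑ i ∈ Finset.range (t + 1), p' ^ i) *
    ∑ i ∈ Finset.range (r + 1), p ^ i) * hp

/-- Moving `x'` through one bracket creates a correction in `1 - w`. As `w` passes the `t`-th term
at the cost of the square of that bracket's scalar, `w` drops out and only a multiple of the
preceding term remains. -/
theorem skew_kap {s p δ : k} {x x' y w : A} (hx : x' * x = p • (x * x') + δ • (1 - w))
    (hy : x' * y = s • (y * x')) (hwx : w * x = p ^ 2 • (x * w)) (hwy : w * y = s ^ 2 • (y * w))
    (t : ℕ) : x' * qSeq s p x y (t + 1) = (s * p ^ (t + 1)) • (qSeq s p x y (t + 1) * x') +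
      kap s p δ (t + 1) • qSeq s p x y t := by
  have aux : ∀ t, (1 - w) * qSeq s p x y t - (s * p ^ t) • ((s * p ^ t) •
      (qSeq s p x y t * (1 - w))) = (1 - s ^ 2 * p ^ (2 * t)) • qSeq s p x y t := by
    intro t
    rw [sub_mul, skew_qSeq s p _ _ x y w hwx hwy, mul_sub, smul_smul, smul_sub, sub_smul, one_smul,
      one_mul, mul_one, show s * p ^ t * (s * p ^ t) = s ^ 2 * (p ^ 2) ^ t by ring, pow_mul]
    abel
  induction t with
  | zero =>
    have h := aux 0
    simp only [qSeq, kap, mul_zero, zero_add, pow_zero, mul_one] at h ⊢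
    rw [mul_sub x', mul_smul_comm, ← mul_assoc x', hx, add_mul, smul_mul_assoc, mul_assoc x, hy, ← mul_assoc x', hy,
      smul_mul_assoc δ, smul_mul_assoc s, mul_assoc y, hx, mul_smul δ, ← h]
    simp only [mul_add, smul_add, smul_sub, mul_smul_comm, smul_mul_assoc, sub_mul, smul_smul,
      mul_assoc, mul_sub, pow_one, mul_one, one_mul]
    module
  | succ t ih =>
    have h := aux (t + 1)
    rw [qSeq, mul_sub, mul_smul_comm, ← mul_assoc x', hx, add_mul, smul_mul_assoc, mul_assoc x, ih,
      ← mul_assoc x', ih, add_mul, smul_mul_assoc _ _ x, mul_assoc _ x' x, hx,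
      smul_mul_assoc δ, show kap s p δ (t + 1 + 1) = p * kap s p δ (t + 1) +
        δ * (1 - s ^ 2 * p ^ (2 * (t + 1))) from rfl, add_smul, mul_smul δ, ← h]
    have h2 : (p * kap s p δ (t + 1)) • qSeq s p x y (t + 1) =
        p • (x * (kap s p δ (t + 1) • qSeq s p x y t)) -
          (s * p ^ (t + 1)) • (kap s p δ (t + 1) • qSeq s p x y t * x) := by
      rw [qSeq]
      simp only [mul_smul_comm, smul_mul_assoc, smul_sub, smul_smul]
      congr 2
      ring
    rw [h2]
    generalize qSeq s p x y (t + 1) = u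
    simp only [mul_add, smul_add, smul_sub, mul_smul_comm, smul_mul_assoc, sub_mul, smul_smul,
      mul_assoc, mul_sub, mul_one, one_mul]
    module

/-- Replacing `x` by `x + x'` in the outermost bracket changes it by a multiple of the term two
steps earlier, by `skew_kap`; this is exactly the three-term recursion of a continuant. -/
theorem qSeq_eq_cont_kap {s p δ : k} {x x' y w : A} (hx : x' * x = p • (x * x') + δ • (1 - w))
    (hy : x' * y = s • (y * x')) (hwx : w * x = p ^ 2 • (x * w)) (hwy : w * y = s ^ 2 • (y * w))
    (t : ℕ) :
    qSeq s p x y t = cont (fun t => qComm (s * p ^ t) (x + x')) (kap s p δ) t y := by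
  induction t using Nat.strong_induction_on with
  | _ t ih =>
    match t with
    | 0 => rfl
    | 1 => simp [cont, qComm_apply, qSeq, add_mul, mul_add, hy]
    | t + 2 =>
      rw [cont_add_two, LinearMap.sub_apply, Module.End.mul_apply, LinearMap.smul_apply,
        ← ih (t + 1) (by omega), ← ih t (by omega), qComm_apply, add_mul,
        skew_kap hx hy hwx hwy, mul_add, qSeq]
      rw [smul_add]
      abel

theorem AlgFiltration.qComm_mem (Φ : AlgFiltration k A) {b z : A} (hb : b ∈ Φ.piece 1) {m : ℕ}
    (hz : z ∈ Φ.piece m) (s : k) : qComm s b z ∈ Φ.piece (m + 1) := by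
  rw [qComm_apply]
  refine Submodule.sub_mem _ ?_ (Submodule.smul_mem _ _ (Φ.mul_mem hz hb))
  rw [add_comm]
  exact Φ.mul_mem hb hz

theorem AlgFiltration.qSeq_mem (Φ : AlgFiltration k A) {b z : A} (hb : b ∈ Φ.piece 1) {m : ℕ}
    (hz : z ∈ Φ.piece m) (s p : k) (t : ℕ) : qSeq s p b z t ∈ Φ.piece (m + t) := by
  induction t with
  | zero => exact hz
  | succ t ih => exact Φ.qComm_mem hb ih _

/-- Each use of a scalar `κ` removes two factors `b`, so the continuant and the pure product differ
only in lower degree. -/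
theorem AlgFiltration.cont_mem (Φ : AlgFiltration k A) {b z : A} (hb : b ∈ Φ.piece 1)
    (hz : z ∈ Φ.piece 1) (s κ : ℕ → k) (t : ℕ) :
    cont (fun t => qComm (s t) b) κ t z ∈ Φ.piece (t + 1) ∧
      cont (fun t => qComm (s t) b) κ t z - cont (fun t => qComm (s t) b) (0 : ℕ → k) t z ∈
        Φ.piece t := by
  induction t using Nat.strong_induction_on with
  | _ t ih =>
    match t with
    | 0 => exact ⟨hz, by simp [cont]⟩
    | 1 => exact ⟨Φ.qComm_mem hb hz _, by simp [cont]⟩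
    | t + 2 =>
      have h1 := ih (t + 1) (by omega)
      have h0 := ih t (by omega)
      have e : ∀ κ : ℕ → k, cont (fun t => qComm (s t) b) κ (t + 2) z =
          qComm (s (t + 1)) b (cont (fun t => qComm (s t) b) κ (t + 1) z) -
            κ (t + 1) • cont (fun t => qComm (s t) b) κ t z := fun κ => rfl
      constructor
      · rw [e]
        exact Submodule.sub_mem _ (Φ.qComm_mem hb h1.1 _)
          (Submodule.smul_mem _ _ (Φ.mono (by omega) h0.1))
      · rw [e, e, Pi.zero_apply, zero_smul, sub_zero, sub_right_comm, ← map_sub]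
        exact Submodule.sub_mem _ (Φ.qComm_mem hb h1.2 _)
          (Submodule.smul_mem _ _ (Φ.mono (by omega) h0.1))

/-- The two vanishing hypotheses say that a continuant in the brackets with `x + x'` kills `y`, and
that its reversal kills `y'`. The reversal is the same operator, so it kills `y + r • y'`; the
iterated bracket is this operator up to lower degree. -/
theorem AlgFiltration.qSeq_mem_of_skew (Φ : AlgFiltration k A) {s p s' p' δ r : k}
    {x x' y y' w : A} {m : ℕ} (hs : s * s' = 1) (hp : p * p' = 1) (hm : s ^ 2 * p ^ (m - 1) = 1)
    (hrev : ∀ t < m, s' * p' ^ t = s * p ^ (m - 1 - t))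
    (hx : x' * x = p • (x * x') + δ • (1 - w))
    (hy : x' * y = s • (y * x')) (hwx : w * x = p ^ 2 • (x * w)) (hwy : w * y = s ^ 2 • (y * w))
    (hy' : x * y' = s' • (y' * x)) (hwx' : w * x' = p' ^ 2 • (x' * w))
    (hwy' : w * y' = s' ^ 2 • (y' * w)) (hS : qSeq s p x y m = 0) (hS' : qSeq s p x' y' m = 0)
    (hb : x + x' ∈ Φ.piece 1) (hz : y + r • y' ∈ Φ.piece 1) :
    qSeq s p (x + x') (y + r • y') m ∈ Φ.piece m := by
  -- The same relation with `x` and `x'` interchanged: `p` is inverted and `δ` becomes `-(δ * p')`,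
  -- the form expected by `kap_reverse`.
  have hx2 : x * x' = p' • (x' * x) + (-(δ * p')) • (1 - w) := by
    rw [hx, smul_add, smul_smul, smul_smul, mul_comm p', hp, one_smul, mul_comm p', neg_smul]
    abel
  have h1 := qSeq_eq_cont_kap hx hy hwx hwy m
  have h2 := qSeq_eq_cont_kap hx2 hy' hwx' hwy' m
  rw [qSeq_reverse s p s' p' _ _ m hrev, hS', add_comm x' x,
    cont_reverse m (fun t => qComm (s * p ^ t) (x + x')) _ (kap s p δ) _
      (fun _ _ => qComm_commute _ _ _) (fun t ht => by simp only [hrev t ht])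
      (fun t h0 ht => kap_reverse hs hp hm h0 ht)] at h2
  rw [hS] at h1
  have h3 := (Φ.cont_mem hb hz (fun t => s * p ^ t) (kap s p δ) m).2
  rw [map_add, map_smul, ← h1, ← h2, smul_zero, add_zero, zero_sub, ← qSeq_eq_cont] at h3
  exact (Submodule.neg_mem_iff _).1 h3

/-- The `z` term disappears after the first bracket, by `hzx`; only the `w` term propagates, gaining
one scalar factor per step. -/
theorem skew_of_inhomogeneous {s p : k} {x x' y z w : A} (hx : x' * x = p • (x * x'))
    (hy : x' * y = s • (y * x') + z + w) (hwx : w * x = (s * p) • (x * w))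
    (hzx : s • (z * x) = p • (x * z)) (t : ℕ) :
    x' * qSeq s p x y (t + 1) = (s * p ^ (t + 1)) • (qSeq s p x y (t + 1) * x') +
      (p ^ (t + 1) * ∏ r ∈ Finset.range (t + 1), (1 - s ^ 2 * p ^ r)) • (x ^ (t + 1) * w) := by
  induction t with
  | zero =>
    simp only [qSeq, Finset.prod_range_one, mul_sub, mul_smul_comm, pow_zero, mul_one, zero_add,
      pow_one]
    rw [← mul_assoc x', hx, smul_mul_assoc, mul_assoc x, hy, ← mul_assoc x', hy]
    simp only [add_mul, smul_mul_assoc, mul_assoc y, hx, hwx, smul_add, hzx, mul_add,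
      mul_smul_comm, smul_smul, sub_mul, mul_assoc, smul_sub]
    module
  | succ t ih =>
    have h4 : (x ^ (t + 1) * w) * x = (s * p) • (x ^ (t + 2) * w) := by
      rw [mul_assoc, hwx, mul_smul_comm, ← mul_assoc, ← pow_succ]
    have h5 : x * (x ^ (t + 1) * w) = x ^ (t + 2) * w := by
      rw [← mul_assoc, ← pow_succ']
    rw [qSeq, mul_sub, mul_smul_comm, ← mul_assoc x', hx, smul_mul_assoc, mul_assoc x, ih,
      ← mul_assoc x', ih, add_mul, smul_mul_assoc _ _ x, mul_assoc _ x' x, hx, smul_mul_assoc,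
      h4, mul_add, mul_smul_comm, mul_smul_comm, h5, Finset.prod_range_succ _ (t + 1)]
    generalize qSeq s p x y (t + 1) = u
    generalize x ^ (t + 2) * w = v
    generalize (∏ r ∈ Finset.range (t + 1), (1 - s ^ 2 * p ^ r)) = q
    simp only [smul_add, mul_smul_comm, smul_mul_assoc, sub_mul, smul_smul, mul_assoc, smul_sub]
    module

/-- The `z` created by the first bracket is simply fed into the remaining brackets, whose scalars
start at `s * p`. The `w` created there and those created later by `skew_of_inhomogeneous`
accumulate to one multiple of `x ^ t * w`. -/
theorem qSeq_add_of_inhomogeneous {s p : k} {x x' y z w : A} (hx : x' * x = p • (x * x'))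
    (hy : x' * y = s • (y * x') + z + w) (hwx : w * x = (s * p) • (x * w))
    (hwx' : x' * w = (s * p) • (w * x'))
    (hzx : s • (z * x) = p • (x * z)) (t : ℕ) :
    qSeq s p (x + x') y (t + 1) = qSeq s p x y (t + 1) +
      ((∑ r ∈ Finset.range (t + 1), p ^ r) *
        ∏ r ∈ Finset.range t, (1 - s ^ 2 * p ^ (r + 1))) • (x ^ t * w) +
      qSeq (s * p) p (x + x') z t := by
  induction t with
  | zero =>
    simp only [qSeq, add_mul, mul_add, hy, pow_zero, mul_one, smul_add, zero_add,
      Finset.sum_range_one, Finset.prod_range_zero, one_smul, one_mul]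
    abel
  | succ t ih =>
    have h1 : x' * x ^ t = p ^ t • (x ^ t * x') := by
      clear ih
      induction t with
      | zero => simp
      | succ t ih =>
        rw [pow_succ, ← mul_assoc, ih, smul_mul_assoc, mul_assoc, hx, mul_smul_comm, smul_smul,
          mul_assoc, pow_succ]
    have h2 : (x + x') * (x ^ t * w) - (s * p ^ (t + 1)) • ((x ^ t * w) * (x + x')) =
        (1 - s ^ 2 * p ^ (t + 2)) • (x ^ (t + 1) * w) := by
      rw [add_mul, ← mul_assoc, ← pow_succ', ← mul_assoc, h1, smul_mul_assoc, mul_assoc _ x', hwx',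
        mul_add, mul_assoc _ w x, hwx, mul_smul_comm, mul_smul_comm, ← mul_assoc _ x w, ← pow_succ,
        mul_assoc _ w x', ← mul_assoc]
      module
    have h3 := skew_of_inhomogeneous hx hy hwx hzx t
    rw [qSeq_succ s p (x + x'), ih, qSeq_succ s p x y (t + 1), qSeq_succ (s * p), qComm_apply,
      qComm_apply, qComm_apply, mul_add, mul_add,
      add_mul _ _ (x + x'), add_mul _ _ (x + x'), mul_smul_comm, smul_mul_assoc]
    set u := qSeq s p x y (t + 1)
    set v := qSeq (s * p) p (x + x') z t
    set G := ∑ r ∈ Finset.range (t + 1), p ^ r with hG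
    set Q := ∏ r ∈ Finset.range t, (1 - s ^ 2 * p ^ (r + 1)) with hQ
    have hQ1 : ∏ r ∈ Finset.range (t + 1), (1 - s ^ 2 * p ^ r) = Q * (1 - s ^ 2) := by
      rw [Finset.prod_range_succ']; simp [hQ]
    rw [hQ1] at h3
    rw [Finset.sum_range_succ, Finset.prod_range_succ, ← hG, ← hQ]
    -- The recursion for the coefficient of the `w` term; it reduces to $(1-p)\sum_{r\le
    -- t}p^r=1-p^{t+1}$.
    have hν : (G + p ^ (t + 1)) * (Q * (1 - s ^ 2 * p ^ (t + 1))) =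
        G * Q * (1 - s ^ 2 * p ^ (t + 2)) + p ^ (t + 1) * (Q * (1 - s ^ 2)) := by
      have hg := mul_neg_geom_sum p (t + 1)
      rw [← hG] at hg
      linear_combination (-Q * s ^ 2 * p ^ (t + 1)) * hg
    rw [hν, add_smul, mul_smul _ (1 - s ^ 2 * p ^ (t + 2)), ← h2, ← sub_eq_iff_eq_add'.2 h3,
      add_mul _ _ u, mul_add u, mul_assoc s p, ← pow_succ' p t]
    simp only [smul_add, smul_sub, smul_smul]
    rw [mul_comm (G * Q)]
    abel

/-- For `2 ≤ m` the coefficient of the `w` term contains $1-s^2p^{m-1}=0$. For $m=1$ that product is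
empty and `w` survives, which is the source of the exceptional case. -/
theorem qSeq_of_inhomogeneous {s p : k} {x x' y z w : A} {m : ℕ} (hm : 2 ≤ m)
    (hsp : s ^ 2 * p ^ (m - 1) = 1) (hx : x' * x = p • (x * x'))
    (hy : x' * y = s • (y * x') + z + w) (hwx : w * x = (s * p) • (x * w))
    (hwx' : x' * w = (s * p) • (w * x'))
    (hzx : s • (z * x) = p • (x * z)) (hS : qSeq s p x y m = 0) :
    qSeq s p (x + x') y m = qSeq (s * p) p (x + x') z (m - 1) := by
  obtain ⟨m, rfl⟩ := Nat.exists_eq_add_of_le' hm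
  rw [qSeq_add_of_inhomogeneous hx hy hwx hwx' hzx, hS,
    Finset.prod_eq_zero (Finset.mem_range.2 (Nat.lt_succ_self m))]
  · simp
  · rw [← hsp]; simp

end Abstract

/-! ### The generators `B_i` -/

section Generators

variable {k : Type*} [Field k] {n : ℕ} (a : Matrix (Fin n) (Fin n) ℤ) (d : Fin n → ℕ) (ζ : kˣ)
  (τ : Equiv.Perm (Fin n)) (c : Fin n → k)

/-- The scalars `ζ^{d_i a_{ij}}`. -/
def chi (i j : Fin n) : kˣ := ζ ^ ((d i : ℤ) * a i j)

/-- The elements `E_{τ(i)} K_i⁻¹`. -/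
def uX (i : Fin n) : Uq a d ζ := uE a d ζ (τ i) * (uKpow a d ζ (-Pi.single i 1) : Uq a d ζ)

theorem uB_eq (i : Fin n) : uB a d ζ τ c i = uF a d ζ i + c i • uX a d ζ τ i := by
  rw [uB, uX, uKpow_neg_single]

theorem uKτ_eq (i : Fin n) :
    uKτ a d ζ τ i = (uKpow a d ζ (Pi.single i 1 - Pi.single (τ i) 1) : Uq a d ζ) := by
  rw [uKτ, sub_eq_add_neg, uKpow_add, uKpow_neg_single, uKpow_single, zpow_one]

/-- The letters in the words spanning the pieces of the filtration of `B_𝐜`. -/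
def uLetter : Fin n ⊕ Fin n → Uq a d ζ
  | .inl i => uB a d ζ τ c i
  | .inr i => uKτ a d ζ τ i

/-- The filtration of `U` by the images of the filtered pieces of `B_𝐜`. -/
def uFilt : AlgFiltration k (Uq a d ζ) where
  piece m := Submodule.span k {x | ∃ w, bDeg w ≤ m ∧ x = (w.map (uLetter a d ζ τ c)).prod}
  mono := by
    intro i j hij
    refine Submodule.span_mono ?_
    rintro x ⟨w, hw, rfl⟩
    exact ⟨w, hw.trans hij, rfl⟩
  one_mem := Submodule.subset_span ⟨[], by simp [bDeg], by simp⟩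
  mul_mem := by
    intro i j x y hx hy
    have h := Submodule.mul_mem_mul hx hy
    rw [Submodule.span_mul_span] at h
    refine Submodule.span_mono ?_ h
    rintro _ ⟨_, ⟨v, hv, rfl⟩, _, ⟨w, hw, rfl⟩, rfl⟩
    refine ⟨v ++ w, ?_, by simp⟩
    simp only [bDeg, List.countP_append] at hv hw ⊢
    omega

theorem uLetter_eq (l : Fin n ⊕ Fin n) :
    uLetter a d ζ τ c l = (bGen a d ζ τ c l : Uq a d ζ) := by
  cases l <;> rfl

theorem uFilt_piece (m : ℕ) : (uFilt a d ζ τ c).piece m =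
    ((filt a d ζ τ c).piece m).map (Bc a d ζ τ c).val.toLinearMap := by
  change Submodule.span k _ = Submodule.map _ (Submodule.span k _)
  rw [Submodule.map_span]
  congr 1
  have h : ∀ w : List (Fin n ⊕ Fin n), (w.map (uLetter a d ζ τ c)).prod =
      (Bc a d ζ τ c).val (w.map (bGen a d ζ τ c)).prod := by
    intro w
    rw [map_list_prod, List.map_map]
    congr 1
    exact List.map_congr_left fun l _ => uLetter_eq a d ζ τ c l
  ext x
  constructor
  · rintro ⟨w, hw, rfl⟩
    exact ⟨_, ⟨w, hw, rfl⟩, (h w).symm⟩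
  · rintro ⟨_, ⟨w, hw, rfl⟩, rfl⟩
    exact ⟨w, hw, (h w).symm⟩

theorem mem_uFilt_iff (m : ℕ) (x : Bc a d ζ τ c) :
    (x : Uq a d ζ) ∈ (uFilt a d ζ τ c).piece m ↔ x ∈ (filt a d ζ τ c).piece m := by
  rw [uFilt_piece]
  constructor
  · rintro ⟨y, hy, h⟩
    rwa [← Subtype.ext h]
  · exact fun h => ⟨x, h, rfl⟩

theorem uB_mem (i : Fin n) : uB a d ζ τ c i ∈ (uFilt a d ζ τ c).piece 1 :=
  Submodule.subset_span ⟨[.inl i], by simp [bDeg], by simp [uLetter]⟩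

theorem uKτ_mem (i : Fin n) : uKτ a d ζ τ i ∈ (uFilt a d ζ τ c).piece 0 :=
  Submodule.subset_span ⟨[.inr i], by simp [bDeg], by simp [uLetter]⟩

theorem pair_sub (μ ν : Fin n → ℤ) (j : Fin n) :
    pair a d (μ - ν) j = pair a d μ j - pair a d ν j := by
  rw [sub_eq_add_neg, pair_add, pair_neg, sub_eq_add_neg]

theorem zpow_pair_single (i j : Fin n) : ζ ^ pair a d (Pi.single i 1) j = chi a d ζ i j := by
  rw [pair_single, chi]

theorem uKpow_uX (ν : Fin n → ℤ) (i : Fin n) : (uKpow a d ζ ν : Uq a d ζ) * uX a d ζ τ i =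
    ((ζ ^ pair a d ν (τ i) : kˣ) : k) • (uX a d ζ τ i * (uKpow a d ζ ν : Uq a d ζ)) := by
  rw [uX, ← mul_assoc, uKpow_uE, smul_mul_assoc, mul_assoc, mul_assoc, ← Units.val_mul,
    ← Units.val_mul, ← uKpow_add, ← uKpow_add, add_comm]

theorem uX_uF (i j : Fin n) : uX a d ζ τ i * uF a d ζ j =
    (chi a d ζ i j : k) • (uF a d ζ j * uX a d ζ τ i) +
      if τ i = j then (chi a d ζ i j : k) •
        ((uKpow a d ζ (Pi.single j 1 - Pi.single i 1) : Uq a d ζ) -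
          (uKpow a d ζ (-Pi.single i 1 - Pi.single j 1) : Uq a d ζ)) else 0 := by
  rw [uX, mul_assoc, uKpow_uF, pair_neg, neg_neg, zpow_pair_single, mul_smul_comm, ← mul_assoc,
    uE_uF, add_mul, smul_add, mul_assoc]
  congr 1
  split_ifs with h
  · subst h
    rw [sub_mul, ← Units.val_mul, ← Units.val_mul, ← uKpow_add, ← uKpow_add, neg_add_eq_sub,
      ← sub_eq_add_neg, ← neg_add']
  · simp

theorem uF_uX (i j : Fin n) : uF a d ζ j * uX a d ζ τ i =
    (((chi a d ζ i j)⁻¹ : kˣ) : k) • (uX a d ζ τ i * uF a d ζ j) +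
      if τ i = j then ((uKpow a d ζ (-Pi.single i 1 - Pi.single j 1) : Uq a d ζ) -
        (uKpow a d ζ (Pi.single j 1 - Pi.single i 1) : Uq a d ζ)) else 0 := by
  rw [uX_uF, smul_add, smul_smul, Units.inv_mul, one_smul]
  split_ifs
  · rw [smul_smul, Units.inv_mul, one_smul]
    abel
  · simp

end Generators

/-! ### Quantum Serre polynomials evaluated at the `B_i`: drop in degree and exceptional case. -/

section TwistedSymmetry

variable {k : Type*} [Field k] {n : ℕ} {a : Matrix (Fin n) (Fin n) ℤ} {d : Fin n → ℕ} {ζ : kˣ}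
  {τ : Equiv.Perm (Fin n)} (c : Fin n → k)

theorem chi_symm (had : IsSymmetrizableGCM a d) (i j : Fin n) :
    chi a d ζ i j = chi a d ζ j i := by rw [chi, chi, had.symm]

theorem chi_self (had : IsSymmetrizableGCM a d) (i : Fin n) :
    ((ζ : k) ^ (2 * d i)) = (chi a d ζ i i : k) := by
  rw [chi, had.diag, ← Units.val_pow_eq_pow_val, ← zpow_natCast]
  push_cast
  rw [mul_comm]

theorem serre_eq_qSeq_chi (had : IsSymmetrizableGCM a d) (i j : Fin n) {A : Type*} [Ring A]
    [Algebra k A] (x y : A) : serre ζ (d i) (a i j) x y =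
      qSeq (chi a d ζ i j : k) (chi a d ζ i i : k) x y (1 - a i j).toNat := by
  rw [serre_eq_qSeq, chi_self had]
  rfl

theorem chi_inv_mul_pow (had : IsSymmetrizableGCM a d) (i j : Fin n) (t : ℕ)
    (ht : t < (1 - a i j).toNat) :
    (((chi a d ζ i j)⁻¹ : kˣ) : k) * (((chi a d ζ i i)⁻¹ : kˣ) : k) ^ t =
      (chi a d ζ i j : k) * (chi a d ζ i i : k) ^ ((1 - a i j).toNat - 1 - t) := by
  have h := zpow_mul_pow_reflect ζ (d i) (a i j) t ht
  have h2 : (((ζ⁻¹ : kˣ) : k) ^ (2 * d i)) = (((chi a d ζ i i)⁻¹ : kˣ) : k) := by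
    rw [chi_self had, chi, chi, inv_zpow]
  rw [h2, chi_self had, inv_zpow] at h
  exact h

theorem chi_sq_mul_pow (had : IsSymmetrizableGCM a d) {i j : Fin n} (hij : i ≠ j) :
    (chi a d ζ i j : k) ^ 2 * (chi a d ζ i i : k) ^ ((1 - a i j).toNat - 1) = 1 := by
  have h := chi_inv_mul_pow (ζ := ζ) had i j 0 (had.toNat_pos hij)
  rw [pow_zero, mul_one, Nat.sub_zero] at h
  rw [sq, mul_assoc, ← h, Units.mul_inv]

theorem serre_uX (had : IsSymmetrizableGCM a d) (hτ : ∀ i, τ (τ i) = i)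
    (hτa : ∀ i j, a (τ i) (τ j) = a i j)
    (hτq : ∀ i j, chi a d ζ (τ i) (τ j) = chi a d ζ i j) {i j : Fin n} (hij : i ≠ j) (r : k) :
    qSeq (chi a d ζ i j : k) (chi a d ζ i i : k) (r • uX a d ζ τ i) (uX a d ζ τ j)
      (1 - a i j).toNat = 0 := by
  have h0 := serre_uE a d ζ (τ i) (τ j) (fun h => hij (τ.injective h))
  rw [serre_eq_qSeq_chi had, hτq, hτq, hτa] at h0
  -- The common scalar required by `qSeq_twist`; it rests on $\tau^2=\mathrm{id}$ and the symmetry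
  -- of $d_ia_{ij}$.
  have hβ : chi a d ζ j (τ i) = chi a d ζ i (τ j) := by
    have h := hτq i (τ j)
    rw [hτ] at h
    rw [chi_symm had, h]
  rw [uX, uX, ← mul_smul_comm]
  obtain ⟨u, hu⟩ := qSeq_twist (chi a d ζ i j : k) (chi a d ζ i i : k)
    (((chi a d ζ i (τ i))⁻¹ : kˣ) : k) (((chi a d ζ i (τ j))⁻¹ : kˣ) : k)
    (uE a d ζ (τ i)) (uE a d ζ (τ j)) (r • (uKpow a d ζ (-Pi.single i 1) : Uq a d ζ))
    (uKpow a d ζ (-Pi.single j 1) : Uq a d ζ)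
    (by rw [smul_mul_assoc, uKpow_uE, mul_smul_comm, pair_neg, zpow_neg, zpow_pair_single,
      smul_comm])
    (by rw [smul_mul_assoc, uKpow_uE, mul_smul_comm, pair_neg, zpow_neg, zpow_pair_single,
      smul_comm])
    (by rw [uKpow_uE, pair_neg, zpow_neg, zpow_pair_single, hβ])
    (by rw [smul_mul_assoc, mul_smul_comm, ← Units.val_mul, ← Units.val_mul, ← uKpow_add,
      ← uKpow_add, add_comm]) (1 - a i j).toNat
  rw [hu, h0, zero_mul, smul_zero]

/-- The quantum Serre polynomial of `B_i`, `B_j` has lower filtration degree than expected,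
when `τ(i) ≠ j`. -/
theorem serre_uB_mem_of_ne (had : IsSymmetrizableGCM a d) (hτ : ∀ i, τ (τ i) = i)
    (hτa : ∀ i j, a (τ i) (τ j) = a i j)
    (hτq : ∀ i j, chi a d ζ (τ i) (τ j) = chi a d ζ i j) {i j : Fin n} (hij : i ≠ j)
    (hj : τ i ≠ j) :
    serre ζ (d i) (a i j) (uB a d ζ τ c i) (uB a d ζ τ c j) ∈
      (uFilt a d ζ τ c).piece (1 - a i j).toNat := by
  have hji : τ j ≠ i := fun h => hj (by rw [← h, hτ])
  rw [serre_eq_qSeq_chi had, uB_eq, uB_eq]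
  -- If $\tau(i)\ne i$, the two summands of $B_i$ skew-commute exactly. If $\tau(i)=i$, the
  -- correction is a multiple of $1-K_i^{-2}$.
  refine (uFilt a d ζ τ c).qSeq_mem_of_skew (s' := (((chi a d ζ i j)⁻¹ : kˣ) : k))
    (p' := (((chi a d ζ i i)⁻¹ : kˣ) : k))
    (δ := if τ i = i then c i * (chi a d ζ i i : k) else 0)
    (w := if τ i = i then (uKpow a d ζ (-Pi.single i 1 - Pi.single i 1) : Uq a d ζ) else 0)
    (Units.mul_inv _) (Units.mul_inv _) (chi_sq_mul_pow had hij) (chi_inv_mul_pow had i j)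
    ?_ ?_ ?_ ?_ ?_ ?_ ?_ ?_ ?_ ?_ ?_
  · rw [smul_mul_assoc, uX_uF, mul_smul_comm]
    split_ifs with h
    · rw [sub_self, uKpow_zero, Units.val_one]
      module
    · module
  · rw [smul_mul_assoc, uX_uF, if_neg hj, mul_smul_comm]
    module
  · split_ifs with h
    · rw [uKpow_uF, pair_sub, pair_neg, neg_sub, sub_neg_eq_add, zpow_add, zpow_pair_single,
        ← sq, Units.val_pow_eq_pow_val]
    · simp
  · split_ifs with h
    · rw [uKpow_uF, pair_sub, pair_neg, neg_sub, sub_neg_eq_add, zpow_add, zpow_pair_single,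
        ← sq, Units.val_pow_eq_pow_val]
    · simp
  · rw [uF_uX, if_neg hji, add_zero, chi_symm had]
  · split_ifs with h
    · rw [mul_smul_comm, uKpow_uX, h, pair_sub, pair_neg, zpow_sub, zpow_neg, zpow_pair_single,
        ← sq, Units.val_pow_eq_pow_val, smul_mul_assoc, smul_comm]
    · simp
  · split_ifs with h
    · have h2 := hτq i j
      rw [h] at h2
      rw [uKpow_uX, pair_sub, pair_neg, zpow_sub, zpow_neg, zpow_pair_single, h2,
        ← sq, Units.val_pow_eq_pow_val]
    · simp
  · rw [← serre_eq_qSeq_chi had, serre_uF a d ζ i j hij]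
  · exact serre_uX had hτ hτa hτq hij _
  · rw [← uB_eq]; exact uB_mem a d ζ τ c i
  · rw [← uB_eq]; exact uB_mem a d ζ τ c j

/-- The relations between `F_i`, `F_j` and `E_{τ(i)} K_i⁻¹` when `τ(i) = j`. -/
theorem swap_relations (had : IsSymmetrizableGCM a d)
    (hτq : ∀ i j, chi a d ζ (τ i) (τ j) = chi a d ζ i j) {i j : Fin n} (hij : i ≠ j)
    (hj : τ i = j) (r : k) :
    let s := (chi a d ζ i j : k)
    let p := (chi a d ζ i i : k)
    let x := uF a d ζ i
    let x' := r • uX a d ζ τ i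
    let z := (r * s) • (uKpow a d ζ (Pi.single j 1 - Pi.single i 1) : Uq a d ζ)
    let w := -(r * s) • (uKpow a d ζ (-Pi.single i 1 - Pi.single j 1) : Uq a d ζ)
    x' * x = p • (x * x') ∧ x' * uF a d ζ j = s • (uF a d ζ j * x') + z + w ∧
      w * x = (s * p) • (x * w) ∧ x' * w = (s * p) • (w * x') ∧ s • (z * x) = p • (x * z) := by
  have hχ : chi a d ζ j j = chi a d ζ i i := by rw [← hτq i i, hj]
  refine ⟨?_, ?_, ?_, ?_, ?_⟩
  · rw [smul_mul_assoc, uX_uF, if_neg (fun h : τ i = i => hij (h.symm.trans hj)), mul_smul_comm]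
    module
  · rw [smul_mul_assoc, uX_uF, if_pos hj, mul_smul_comm]
    module
  · rw [smul_mul_assoc, uKpow_uF, pair_sub, pair_neg, neg_sub, sub_neg_eq_add, zpow_add,
      zpow_pair_single, zpow_pair_single, chi_symm had j i, mul_smul_comm, smul_comm, Units.val_mul]
  · rw [smul_mul_assoc, mul_smul_comm, smul_mul_assoc, mul_smul_comm, uKpow_uX, hj, pair_sub,
      pair_neg, zpow_sub, zpow_neg, zpow_pair_single, zpow_pair_single, hχ]
    simp only [smul_smul, Units.val_mul, Units.val_inv_eq_inv_val]
    congr 1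
    field_simp
  · rw [smul_mul_assoc, uKpow_uF, pair_sub, neg_sub, zpow_sub, zpow_pair_single, zpow_pair_single,
      chi_symm had j i, mul_smul_comm]
    simp only [smul_smul, Units.val_mul, Units.val_inv_eq_inv_val]
    congr 1
    field_simp

/-- The relations between `F_i`, `E_{τ(i)} K_i⁻¹` and `E_{τ(j)} K_j⁻¹` when `τ(i) = j`. -/
theorem swap_relations' (had : IsSymmetrizableGCM a d) (hτ : ∀ i, τ (τ i) = i)
    (hτq : ∀ i j, chi a d ζ (τ i) (τ j) = chi a d ζ i j) {i j : Fin n} (hij : i ≠ j)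
    (hj : τ i = j) (r : k) :
    let s := (((chi a d ζ i j)⁻¹ : kˣ) : k)
    let p := (((chi a d ζ i i)⁻¹ : kˣ) : k)
    let x := r • uX a d ζ τ i
    let x' := uF a d ζ i
    let z := (-1 : k) • (uKpow a d ζ (Pi.single i 1 - Pi.single j 1) : Uq a d ζ)
    let w := (uKpow a d ζ (-Pi.single i 1 - Pi.single j 1) : Uq a d ζ)
    x' * x = p • (x * x') ∧ x' * uX a d ζ τ j = s • (uX a d ζ τ j * x') + z + w ∧
      w * x = (s * p) • (x * w) ∧ x' * w = (s * p) • (w * x') ∧ s • (z * x) = p • (x * z) := by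
  have hχ : chi a d ζ j j = chi a d ζ i i := by rw [← hτq i i, hj]
  have hji : τ j = i := by rw [← hj, hτ]
  refine ⟨?_, ?_, ?_, ?_, ?_⟩
  · rw [mul_smul_comm, uF_uX, if_neg (fun h : τ i = i => hij (h.symm.trans hj)), smul_mul_assoc, add_zero, smul_comm]
  · rw [uF_uX, if_pos hji, chi_symm had j i, show (-Pi.single j 1 - Pi.single i 1 : Fin n → ℤ) =
      -Pi.single i 1 - Pi.single j 1 by abel]
    module
  · rw [mul_smul_comm, uKpow_uX, hj, pair_sub, pair_neg, zpow_sub, zpow_neg, zpow_pair_single,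
      zpow_pair_single, hχ, smul_mul_assoc, smul_comm, Units.val_mul]
  · rw [uKpow_uF, pair_sub, pair_neg, neg_sub, sub_neg_eq_add, zpow_add, zpow_pair_single,
      zpow_pair_single, chi_symm had j i, smul_smul, ← Units.val_mul, ← Units.val_mul, ← mul_inv,
      mul_comm (chi a d ζ i j), inv_mul_cancel, Units.val_one, one_smul]
  · rw [mul_smul_comm, smul_mul_assoc, uKpow_uX, hj, pair_sub, zpow_sub, zpow_pair_single,
      zpow_pair_single, hχ, mul_smul_comm, smul_mul_assoc]
    simp only [smul_smul, Units.val_mul, Units.val_inv_eq_inv_val]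
    congr 1
    field_simp

/-- By linearity in the second argument, $F_j$ and $E_iK_j^{-1}$ are treated separately, the latter
with the roles of $F_i$ and $E_jK_i^{-1}$ exchanged and the parameters inverted. Each leaves $m-1$
brackets with $B_i$ applied to an element of $H_\theta$, hence degree at most $m-1$. -/
theorem serre_uB_mem_of_eq (had : IsSymmetrizableGCM a d) (hτ : ∀ i, τ (τ i) = i)
    (hτa : ∀ i j, a (τ i) (τ j) = a i j)
    (hτq : ∀ i j, chi a d ζ (τ i) (τ j) = chi a d ζ i j) {i j : Fin n} (hij : i ≠ j)
    (hj : τ i = j) (ha : a i j ≠ 0) :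
    serre ζ (d i) (a i j) (uB a d ζ τ c i) (uB a d ζ τ c j) ∈
      (uFilt a d ζ τ c).piece (1 - a i j).toNat := by
  have hji : τ j = i := by rw [← hj, hτ]
  have hm : 2 ≤ (1 - a i j).toNat := by
    have := had.offDiag i j hij
    omega
  have hsp := chi_sq_mul_pow (ζ := ζ) had hij
  have hsp' : (((chi a d ζ i j)⁻¹ : kˣ) : k) ^ 2 *
      (((chi a d ζ i i)⁻¹ : kˣ) : k) ^ ((1 - a i j).toNat - 1) = 1 := by
    rw [← Units.val_pow_eq_pow_val, ← Units.val_pow_eq_pow_val, ← Units.val_mul, inv_pow, inv_pow,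
      ← mul_inv, Units.val_eq_one, inv_eq_one, ← Units.val_eq_one]
    simpa using hsp
  obtain ⟨h1, h2, h3, h4, h5⟩ := swap_relations had hτq hij hj (c i)
  obtain ⟨h1', h2', h3', h4', h5'⟩ := swap_relations' had hτ hτq hij hj (c i)
  have hS' := serre_uX had hτ hτa hτq hij (c i)
  have hS := serre_uF a d ζ i j hij
  rw [← qSeq_reverse _ _ _ _ _ _ _ (chi_inv_mul_pow had i j)] at hS'
  rw [serre_eq_qSeq_chi had] at hS
  rw [serre_eq_qSeq_chi had, uB_eq a d ζ τ c j, qSeq_add, qSeq_smul,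
    ← qSeq_reverse _ _ _ _ _ (uX a d ζ τ j) _ (chi_inv_mul_pow had i j)]
  have hb := uB_mem a d ζ τ c i
  have e1 := qSeq_of_inhomogeneous hm hsp h1 h2 h3 h4 h5 hS
  have e2 := qSeq_of_inhomogeneous hm hsp' h1' h2' h3' h4' h5' hS'
  rw [← uB_eq a d ζ τ c] at e1
  rw [add_comm (c i • uX a d ζ τ i) (uF a d ζ i), ← uB_eq a d ζ τ c] at e2
  have hz := uKτ_mem a d ζ τ c j
  have hz' := uKτ_mem a d ζ τ c i
  rw [uKτ_eq, hji] at hz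
  rw [uKτ_eq, hj] at hz'
  rw [e1, e2]
  refine (uFilt a d ζ τ c).mono (i := 0 + ((1 - a i j).toNat - 1)) (by omega) ?_
  exact Submodule.add_mem _
    ((uFilt a d ζ τ c).qSeq_mem hb (Submodule.smul_mem _ _ hz) _ _ _)
    (Submodule.smul_mem _ _ ((uFilt a d ζ τ c).qSeq_mem hb (Submodule.smul_mem _ _ hz') _ _ _))

/-- The case $m=1$ of the same computation, where both `w` terms survive: $F_j$ contributes $-c_i$
and $c_jE_iK_j^{-1}$ contributes $c_j$ to the coefficient of $K_i^{-1}K_j^{-1}$. -/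
theorem serre_uB_of_eq_zero (had : IsSymmetrizableGCM a d) (hτ : ∀ i, τ (τ i) = i)
    (hτa : ∀ i j, a (τ i) (τ j) = a i j)
    (hτq : ∀ i j, chi a d ζ (τ i) (τ j) = chi a d ζ i j) {i j : Fin n} (hij : i ≠ j)
    (hj : τ i = j) (ha : a i j = 0) :
    serre ζ (d i) (a i j) (uB a d ζ τ c i) (uB a d ζ τ c j) =
      c i • (uKpow a d ζ (Pi.single j 1 - Pi.single i 1) : Uq a d ζ) -
        c j • (uKpow a d ζ (Pi.single i 1 - Pi.single j 1) : Uq a d ζ) +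
      (c j - c i) • (uKpow a d ζ (-Pi.single i 1 - Pi.single j 1) : Uq a d ζ) := by
  have hm : (1 - a i j).toNat = 0 + 1 := by rw [ha]; rfl
  have hχ : chi a d ζ i j = 1 := by rw [chi, ha, mul_zero, zpow_zero]
  obtain ⟨h1, h2, h3, h4, h5⟩ := swap_relations had hτq hij hj (c i)
  obtain ⟨h1', h2', h3', h4', h5'⟩ := swap_relations' had hτ hτq hij hj (c i)
  have hS' := serre_uX had hτ hτa hτq hij (c i)
  have hS := serre_uF a d ζ i j hij
  rw [← qSeq_reverse _ _ _ _ _ _ _ (chi_inv_mul_pow had i j), hm] at hS'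
  rw [serre_eq_qSeq_chi had, hm] at hS
  rw [serre_eq_qSeq_chi had, uB_eq a d ζ τ c j, qSeq_add, qSeq_smul,
    ← qSeq_reverse _ _ _ _ _ (uX a d ζ τ j) _ (chi_inv_mul_pow had i j), hm]
  have e1 := qSeq_add_of_inhomogeneous h1 h2 h3 h4 h5 0
  have e2 := qSeq_add_of_inhomogeneous h1' h2' h3' h4' h5' 0
  rw [← uB_eq a d ζ τ c, hS] at e1
  rw [add_comm (c i • uX a d ζ τ i) (uF a d ζ i), ← uB_eq a d ζ τ c] at e2
  rw [e1, e2, hS', hχ]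
  simp only [qSeq, zero_add, Finset.sum_range_one, Finset.prod_range_zero, pow_zero, one_mul,
    one_smul, Units.val_one, mul_one]
  module

theorem serre_uB_mem (had : IsSymmetrizableGCM a d) (hτ : ∀ i, τ (τ i) = i)
    (hτa : ∀ i j, a (τ i) (τ j) = a i j)
    (hτq : ∀ i j, chi a d ζ (τ i) (τ j) = chi a d ζ i j)
    (hc : ∀ i, a i (τ i) = 0 → c i = c (τ i)) {i j : Fin n} (hij : i ≠ j) :
    serre ζ (d i) (a i j) (uB a d ζ τ c i) (uB a d ζ τ c j) ∈
      (uFilt a d ζ τ c).piece (1 - a i j).toNat := by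
  by_cases hj : τ i = j
  · by_cases ha : a i j = 0
    · have hji : τ j = i := by rw [← hj, hτ]
      have h := hc i (by rw [hj, ha])
      rw [hj] at h
      rw [serre_uB_of_eq_zero c had hτ hτa hτq hij hj ha, h, sub_self, zero_smul, add_zero]
      have hz := uKτ_mem a d ζ τ c j
      have hz' := uKτ_mem a d ζ τ c i
      rw [uKτ_eq, hji] at hz
      rw [uKτ_eq, hj] at hz'
      exact (uFilt a d ζ τ c).mono (Nat.zero_le _)
        (Submodule.sub_mem _ (Submodule.smul_mem _ _ hz) (Submodule.smul_mem _ _ hz'))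
    · exact serre_uB_mem_of_eq c had hτ hτa hτq hij hj ha
  · exact serre_uB_mem_of_ne c had hτ hτa hτq hij hj

/-! ### The projections of the Serre elements in the `B_i` -/

theorem qSeq_mem_uDeg {g : Fin n → ℤ} {s t : ℤ} {x y : Uq a d ζ}
    (hx : x ∈ uDeg a d ζ g s) (hy : y ∈ uDeg a d ζ g t) (r p : k) (m : ℕ) :
    qSeq r p x y m ∈ uDeg a d ζ g (m * s + t) := by
  induction m with
  | zero => simpa [qSeq] using hy
  | succ m ih =>
    have e : ((m + 1 : ℕ) : ℤ) * s + t = s + (m * s + t) := by push_cast; ring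
    rw [qSeq, e]
    refine Submodule.sub_mem _ (mul_mem_uDeg hx ih) (Submodule.smul_mem _ _ ?_)
    rw [add_comm]
    exact mul_mem_uDeg ih hx

theorem uX_mem_uDeg (g : Fin n → ℤ) (i : Fin n) : uX a d ζ τ i ∈ uDeg a d ζ g (g (τ i)) := by
  simpa [uX] using mul_mem_uDeg (uE_mem_uDeg g (τ i)) (uKpow_mem_uDeg (a := a) (d := d) (ζ := ζ) g _)

/-- Both projections keep or kill each monomial, and the only monomials kept by $\pi_{0,0}$ are the
$K_\mu$, of degree zero for any weights. -/
theorem projPi_projP_eq_zero (had : IsSymmetrizableGCM a d) {g : Fin n → ℤ} {s : ℤ} (hs : s ≠ 0)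
    (l : Fin n → ℤ) {x : Uq a d ζ} (hx : x ∈ uDeg a d ζ g s) :
    projPi a d ζ 0 0 (projP a d ζ l x) = 0 := by
  have h := uDeg_le_comap (projPi a d ζ 0 0 ∘ₗ projP a d ζ l) ⊥ (fun w μ v h => ?_) hx
  · simpa using h
  · rw [LinearMap.comp_apply, (UKG_isInternal_and_projP ζ had).2]
    split_ifs
    · rw [(UHU_isInternal_and_projPi ζ had).2, if_neg]
      · exact Submodule.zero_mem _
      · rintro ⟨rfl, rfl⟩
        exact hs (by simpa using h.symm)
    · rw [map_zero]
      exact Submodule.zero_mem _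

theorem projPi_projP_serre_uB (had : IsSymmetrizableGCM a d) (hτ : ∀ i, τ (τ i) = i)
    {i j : Fin n} (hij : i ≠ j) (h : a i j ≠ 0 ∨ τ i ≠ j) (l : Fin n → ℤ) :
    projPi a d ζ 0 0 (projP a d ζ l
      (serre ζ (d i) (a i j) (uB a d ζ τ c i) (uB a d ζ τ c j))) = 0 := by
  rw [serre_eq_qSeq_chi had, uB_eq, uB_eq]
  by_cases hj : τ i = j
  · have hji : τ j = i := by rw [← hj, hτ]
    have ha : a i j ≠ 0 := h.resolve_right (not_not.2 hj)
    -- For these weights $B_i$ is homogeneous of degree $-1$ and $B_j$ of degree $1$, so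
    -- $p_{ij}(B_i,B_j)$ has degree $1-m=a_{ij}\ne0$.
    let g : Fin n → ℤ := Pi.single i 1 - Pi.single j 1
    have gi : g i = 1 := by simp [g, hij]
    have gj : g j = -1 := by simp [g, hij.symm]
    have f1 := uF_mem_uDeg (a := a) (d := d) (ζ := ζ) g i
    have f2 := uF_mem_uDeg (a := a) (d := d) (ζ := ζ) g j
    have x1 := uX_mem_uDeg (a := a) (d := d) (ζ := ζ) (τ := τ) g i
    have x2 := uX_mem_uDeg (a := a) (d := d) (ζ := ζ) (τ := τ) g j
    rw [gi] at f1
    rw [gj, neg_neg] at f2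
    rw [hj, gj] at x1
    rw [hji, gi] at x2
    refine projPi_projP_eq_zero had ?_ l (qSeq_mem_uDeg
      (Submodule.add_mem _ f1 (Submodule.smul_mem _ (c i) x1))
      (Submodule.add_mem _ f2 (Submodule.smul_mem _ (c j) x2)) _ _ _)
    have := had.offDiag i j hij
    omega
  · have hji : τ j ≠ i := fun h => hj (by rw [← h, hτ])
    -- For these weights $B_i$ has degree $0$, while the two summands of $B_j$ have degrees $-1$ and
    -- $1$; linearity in the second argument excludes degree $0$.
    let g : Fin n → ℤ := fun l => if l = j ∨ l = τ j then 1 else 0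
    have gi : g i = 0 := if_neg (by rintro (h | h); exacts [hij h, hji h.symm])
    have gti : g (τ i) = 0 := if_neg (by
      rintro (h | h)
      exacts [hj h, hij (τ.injective h)])
    have gj : g j = 1 := if_pos (Or.inl rfl)
    have gtj : g (τ j) = 1 := if_pos (Or.inr rfl)
    have f1 := uF_mem_uDeg (a := a) (d := d) (ζ := ζ) g i
    have f2 := uF_mem_uDeg (a := a) (d := d) (ζ := ζ) g j
    have x1 := uX_mem_uDeg (a := a) (d := d) (ζ := ζ) (τ := τ) g i
    have x2 := uX_mem_uDeg (a := a) (d := d) (ζ := ζ) (τ := τ) g j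
    rw [gi, neg_zero] at f1
    rw [gj] at f2
    rw [gti] at x1
    rw [gtj] at x2
    have hb := Submodule.add_mem _ f1 (Submodule.smul_mem _ (c i) x1)
    rw [qSeq_add, qSeq_smul, map_add, map_add, map_smul, map_smul,
      projPi_projP_eq_zero had (by simp) l (qSeq_mem_uDeg hb f2 _ _ _),
      projPi_projP_eq_zero had (by simp) l (qSeq_mem_uDeg hb x2 _ _ _), smul_zero, add_zero]

theorem projP_projPi_serre_uB (had : IsSymmetrizableGCM a d) (hτ : ∀ i, τ (τ i) = i)
    (hτa : ∀ i j, a (τ i) (τ j) = a i j)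
    (hτq : ∀ i j, chi a d ζ (τ i) (τ j) = chi a d ζ i j) {i j : Fin n} (hij : i ≠ j)
    (ha : a i j = 0) (hj : τ i = j) :
    projP a d ζ (-Pi.single i 1 - Pi.single j 1) (projPi a d ζ 0 0
      (serre ζ (d i) (a i j) (uB a d ζ τ c i) (uB a d ζ τ c j))) =
    (c j - c i) • (((uK a d ζ i)⁻¹ * (uK a d ζ j)⁻¹ : (Uq a d ζ)ˣ) : Uq a d ζ) := by
  rw [serre_uB_of_eq_zero c had hτ hτa hτq hij hj ha, ← uKpow_neg_single, ← uKpow_neg_single,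
    ← uKpow_add, ← sub_eq_add_neg]
  simp only [uKpow_eq_uMon, map_add, map_sub, map_smul, (UHU_isInternal_and_projPi ζ had).2,
    and_self, if_true, (UKG_isInternal_and_projP ζ had).2]
  have e1 : ¬ (Pi.single j 1 - Pi.single i 1 - wt [] = (-Pi.single i 1 - Pi.single j 1 :
      Fin n → ℤ)) := by
    intro h
    have := congrFun h j
    simp [wt, hij.symm] at this
  have e2 : ¬ (Pi.single i 1 - Pi.single j 1 - wt [] = (-Pi.single i 1 - Pi.single j 1 :
      Fin n → ℤ)) := by
    intro h
    have := congrFun h i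
    simp [wt, hij] at this
  rw [if_neg e1, if_neg e2, if_pos (by simp [wt])]
  simp

end TwistedSymmetry

/-! ### The height grading -/

section Height

variable {k : Type*} [Field k] {n : ℕ} {a : Matrix (Fin n) (Fin n) ℤ} {d : Fin n → ℕ} {ζ : kˣ}

theorem exists_heightProj (ζ : kˣ) (had : IsSymmetrizableGCM a d) (s : ℤ) :
    ∃ g : Uq a d ζ →ₗ[k] Uq a d ζ, (∀ x ∈ uDeg a d ζ 1 s, g x = x) ∧
      (∀ t ≠ s, ∀ x ∈ uDeg a d ζ 1 t, g x = 0) ∧ ∀ x, g x ∈ uDeg a d ζ 1 s := by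
  obtain ⟨g, hg⟩ := exists_projection (ζ := ζ) had
    (fun w _ v => wsum (1 : Fin n → ℤ) w - wsum (1 : Fin n → ℤ) v = s)
    (fun w w' μ v h => by rw [wsum_perm _ h]) (fun w μ v v' h => by rw [wsum_perm _ h])
  refine ⟨g, fun x hx => ?_, fun t ht x hx => ?_, fun x => ?_⟩
  · have h := uDeg_le_comap (g - LinearMap.id) ⊥ (fun w μ v h => by simp [hg, h]) hx
    simpa [sub_eq_zero] using h
  · have h := uDeg_le_comap g ⊥ (fun w μ v h => by simp [hg, h, ht]) hx
    simpa using h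
  · refine uDeg_le_comap (g := 0) (s := 0) g _ (fun w μ v _ => ?_)
      (by rw [uDeg_zero_eq_top]; trivial)
    rw [hg]
    split_ifs with h
    · exact uMon_mem_uDeg 1 w μ v h
    · exact Submodule.zero_mem _

/-- The projection of `U` onto its part of height `s`, where `E_i` has height `1` and `F_i` has
height `-1`. -/
def heightProj (ζ : kˣ) (had : IsSymmetrizableGCM a d) (s : ℤ) : Uq a d ζ →ₗ[k] Uq a d ζ :=
  (exists_heightProj ζ had s).choose

theorem heightProj_self (had : IsSymmetrizableGCM a d) {s : ℤ} {x : Uq a d ζ}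
    (hx : x ∈ uDeg a d ζ 1 s) : heightProj ζ had s x = x :=
  (exists_heightProj ζ had s).choose_spec.1 x hx

theorem heightProj_of_ne (had : IsSymmetrizableGCM a d) {s t : ℤ} (h : t ≠ s) {x : Uq a d ζ}
    (hx : x ∈ uDeg a d ζ 1 t) : heightProj ζ had s x = 0 :=
  (exists_heightProj ζ had s).choose_spec.2.1 t h x hx

theorem heightProj_mem_uDeg (had : IsSymmetrizableGCM a d) (s : ℤ) (x : Uq a d ζ) :
    heightProj ζ had s x ∈ uDeg a d ζ 1 s :=
  (exists_heightProj ζ had s).choose_spec.2.2 x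

variable (a d ζ) in
/-- The part of `U` of height greater than `s`. -/
def uAbove (s : ℤ) : Submodule k (Uq a d ζ) := ⨆ t, ⨆ (_ : s < t), uDeg a d ζ 1 t

theorem mem_uAbove {s t : ℤ} (h : s < t) {x : Uq a d ζ} (hx : x ∈ uDeg a d ζ 1 t) :
    x ∈ uAbove a d ζ s :=
  Submodule.mem_iSup_of_mem t (Submodule.mem_iSup_of_mem h hx)

theorem uAbove_anti {s t : ℤ} (h : s ≤ t) : uAbove a d ζ t ≤ uAbove a d ζ s :=
  iSup₂_le fun _ hr _ hx => mem_uAbove (h.trans_lt hr) hx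

theorem mul_mem_uAbove {s t : ℤ} {x y : Uq a d ζ} (hx : x ∈ uDeg a d ζ 1 s)
    (hy : y ∈ uAbove a d ζ t) : x * y ∈ uAbove a d ζ (s + t) := by
  have h : uAbove a d ζ t ≤ (uAbove a d ζ (s + t)).comap (LinearMap.mulLeft k x) :=
    iSup₂_le fun r hr z hz => mem_uAbove (by omega) (mul_mem_uDeg hx hz)
  exact h hy

theorem heightProj_of_mem_uAbove (had : IsSymmetrizableGCM a d) {s : ℤ} {x : Uq a d ζ}
    (hx : x ∈ uAbove a d ζ s) : heightProj ζ had s x = 0 := by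
  have h : uAbove a d ζ s ≤ LinearMap.ker (heightProj ζ had s) :=
    iSup₂_le fun r hr z hz => heightProj_of_ne had (ne_of_gt hr) hz
  exact h hx

variable (τ : Equiv.Perm (Fin n)) (c : Fin n → k)

variable (a d ζ) in
/-- The letters `F_i` and `K_i K_{τ(i)}⁻¹`. -/
def fLetter : Fin n ⊕ Fin n → Uq a d ζ
  | .inl i => uF a d ζ i
  | .inr i => uKτ a d ζ τ i

@[simp] theorem bDeg_nil : bDeg ([] : List (Fin n ⊕ Fin n)) = 0 := rfl

@[simp] theorem bDeg_inl (i : Fin n) (w : List (Fin n ⊕ Fin n)) :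
    bDeg (.inl i :: w) = 1 + bDeg w := by
  rw [bDeg, List.countP_cons_of_pos rfl, add_comm, bDeg]

@[simp] theorem bDeg_inr (i : Fin n) (w : List (Fin n ⊕ Fin n)) :
    bDeg (.inr i :: w) = bDeg w := by simp [bDeg]

theorem bDeg_append (w w' : List (Fin n ⊕ Fin n)) : bDeg (w ++ w') = bDeg w + bDeg w' := by
  simp [bDeg]

theorem uKτ_mem_uDeg (g : Fin n → ℤ) (i : Fin n) : uKτ a d ζ τ i ∈ uDeg a d ζ g 0 := by
  rw [uKτ_eq]
  exact uKpow_mem_uDeg _ _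

theorem prod_fLetter_mem_uDeg (w : List (Fin n ⊕ Fin n)) :
    (w.map (fLetter a d ζ τ)).prod ∈ uDeg a d ζ 1 (-(bDeg w : ℤ)) := by
  induction w with
  | nil => simpa using one_mem_uDeg (1 : Fin n → ℤ)
  | cons l w ih =>
    rw [List.map_cons, List.prod_cons]
    cases l with
    | inl i =>
      rw [bDeg_inl, Nat.cast_add, neg_add]
      exact mul_mem_uDeg (uF_mem_uDeg 1 i) ih
    | inr i =>
      rw [bDeg_inr, ← zero_add (-_)]
      exact mul_mem_uDeg (uKτ_mem_uDeg τ 1 i) ih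

/-- Choosing the $E$-summand of a letter $B_i$ instead of $F_i$ raises the height by two, so the
word in the $F_i$ is the unique lowest term. -/
theorem prod_uLetter_sub_mem_uAbove (w : List (Fin n ⊕ Fin n)) :
    (w.map (uLetter a d ζ τ c)).prod - (w.map (fLetter a d ζ τ)).prod ∈
      uAbove a d ζ (-(bDeg w : ℤ)) := by
  induction w with
  | nil => simp
  | cons l w ih =>
    simp only [List.map_cons, List.prod_cons]
    cases l with
    | inl i =>
      have hx : c i • uX a d ζ τ i ∈ uDeg a d ζ 1 1 := Submodule.smul_mem _ _ (uX_mem_uDeg 1 i)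
      have e : ∀ f x y z : Uq a d ζ, (f + x) * y - f * z = f * (y - z) + (x * z + x * (y - z)) := by
        intros f x y z
        rw [add_mul, mul_sub, mul_sub, add_sub_cancel]
        abel
      rw [bDeg_inl, uLetter, fLetter, uB_eq, e, Nat.cast_add, neg_add]
      refine Submodule.add_mem _ (mul_mem_uAbove (uF_mem_uDeg 1 i) ih) (Submodule.add_mem _ ?_ ?_)
      · exact mem_uAbove (by push_cast; omega) (mul_mem_uDeg hx (prod_fLetter_mem_uDeg τ w))
      · exact uAbove_anti (by push_cast; omega) (mul_mem_uAbove hx ih)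
    | inr i =>
      rw [bDeg_inr, uLetter, fLetter, ← mul_sub, ← zero_add (-_)]
      exact mul_mem_uAbove (uKτ_mem_uDeg τ 1 i) ih

theorem heightProj_prod_uLetter (had : IsSymmetrizableGCM a d) {m : ℕ}
    {w : List (Fin n ⊕ Fin n)} (hw : bDeg w ≤ m) :
    heightProj ζ had (-(m : ℤ)) (w.map (uLetter a d ζ τ c)).prod =
      if bDeg w = m then (w.map (fLetter a d ζ τ)).prod else 0 := by
  have h := prod_uLetter_sub_mem_uAbove (ζ := ζ) (a := a) (d := d) τ c w
  have hf := prod_fLetter_mem_uDeg (ζ := ζ) (a := a) (d := d) τ w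
  rw [← sub_add_cancel (w.map (uLetter a d ζ τ c)).prod (w.map (fLetter a d ζ τ)).prod, map_add,
    heightProj_of_mem_uAbove had (uAbove_anti (by omega) h), zero_add]
  split_ifs with hm
  · rw [← hm, heightProj_self had hf]
  · exact heightProj_of_ne had (by omega) hf

/-- The `i`-th piece has no part of height below $-i$, so lowest parts multiply. -/
theorem heightProj_mul (had : IsSymmetrizableGCM a d) {i j : ℕ} {x y : Uq a d ζ}
    (hx : x ∈ (uFilt a d ζ τ c).piece i) (hy : y ∈ (uFilt a d ζ τ c).piece j) :
    heightProj ζ had (-((i + j : ℕ) : ℤ)) (x * y) =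
      heightProj ζ had (-(i : ℤ)) x * heightProj ζ had (-(j : ℤ)) y := by
  induction hx using Submodule.span_induction with
  | zero => simp
  | add x x' _ _ h h' => rw [add_mul, map_add, map_add, add_mul, h, h']
  | smul r x _ h => rw [smul_mul_assoc, map_smul, map_smul, smul_mul_assoc, h]
  | mem x hx =>
    obtain ⟨w, hw, rfl⟩ := hx
    induction hy using Submodule.span_induction with
    | zero => simp
    | add y y' _ _ h h' => rw [mul_add, map_add, map_add, mul_add, h, h']
    | smul r y _ h => rw [mul_smul_comm, map_smul, map_smul, mul_smul_comm, h]
    | mem y hy =>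
      obtain ⟨w', hw', rfl⟩ := hy
      rw [← List.prod_append, ← List.map_append, heightProj_prod_uLetter τ c had hw,
        heightProj_prod_uLetter τ c had hw', heightProj_prod_uLetter τ c had
        (by rw [bDeg_append]; omega), bDeg_append, List.map_append, List.prod_append]
      by_cases h : bDeg w = i
      · by_cases h' : bDeg w' = j
        · rw [if_pos h, if_pos h', if_pos (by omega)]
        · rw [if_neg h', if_neg (by omega), mul_zero]
      · rw [if_neg h, if_neg (by omega), zero_mul]

theorem uKτ_mem_partialBos (i : Fin n) : uKτ a d ζ τ i ∈ partialBos a d ζ τ :=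
  (le_sup_left : Hθ a d ζ τ ≤ _) (Algebra.subset_adjoin ⟨i, rfl⟩)

theorem uF_mem_partialBos (i : Fin n) : uF a d ζ i ∈ partialBos a d ζ τ :=
  (le_sup_right : Uminus a d ζ ≤ _) (Algebra.subset_adjoin ⟨i, rfl⟩)

theorem prod_fLetter_mem_partialBos (w : List (Fin n ⊕ Fin n)) :
    (w.map (fLetter a d ζ τ)).prod ∈ partialBos a d ζ τ := by
  refine Subalgebra.list_prod_mem _ fun x hx => ?_
  obtain ⟨l, -, rfl⟩ := List.mem_map.1 hx
  cases l with
  | inl i => exact uF_mem_partialBos τ i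
  | inr i => exact uKτ_mem_partialBos τ i

theorem heightProj_mem_partialBos (had : IsSymmetrizableGCM a d) {m : ℕ} {x : Uq a d ζ}
    (hx : x ∈ (uFilt a d ζ τ c).piece m) :
    heightProj ζ had (-(m : ℤ)) x ∈ partialBos a d ζ τ := by
  have h : (uFilt a d ζ τ c).piece m ≤
      (partialBos a d ζ τ).toSubmodule.comap (heightProj ζ had (-(m : ℤ))) := by
    refine Submodule.span_le.2 ?_
    rintro _ ⟨w, hw, rfl⟩
    rw [SetLike.mem_coe, Submodule.mem_comap, heightProj_prod_uLetter τ c had hw]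
    split_ifs
    · exact prod_fLetter_mem_partialBos τ w
    · exact Submodule.zero_mem _
  exact h hx

theorem mem_prev_iff (m : ℕ) (x : Bc a d ζ τ c) :
    (x : Uq a d ζ) ∈ (uFilt a d ζ τ c).prev m ↔ x ∈ (filt a d ζ τ c).prev m := by
  cases m with
  | zero => simp [AlgFiltration.prev]
  | succ m => exact mem_uFilt_iff a d ζ τ c m x

theorem heightProj_eq_zero_of_mem_prev (had : IsSymmetrizableGCM a d) {m : ℕ} {x : Uq a d ζ}
    (hx : x ∈ (uFilt a d ζ τ c).prev m) : heightProj ζ had (-(m : ℤ)) x = 0 := by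
  cases m with
  | zero =>
    rw [(Submodule.mem_bot k).1 hx, map_zero]
  | succ m =>
    have h : (uFilt a d ζ τ c).piece m ≤ LinearMap.ker (heightProj ζ had (-((m + 1 : ℕ) : ℤ))) := by
      refine Submodule.span_le.2 ?_
      rintro _ ⟨w, hw, rfl⟩
      rw [SetLike.mem_coe, LinearMap.mem_ker, heightProj_prod_uLetter τ c had (by omega),
        if_neg (by omega)]
    exact h hx

end Height

/-! ### The canonical homomorphism -/

section Graded

variable {k A : Type*} [Field k] [Ring A] [Algebra k A] (Φ : AlgFiltration k A)

/-- The linear map on `Φ_m / Φ_{m-1}` induced by a linear map on `Φ_m` that kills `Φ_{m-1}`. -/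
def AlgFiltration.compLift {M : Type*} [AddCommGroup M] [Module k M] {m : ℕ}
    (f : Φ.piece m →ₗ[k] M) (h : ∀ x : Φ.piece m, (x : A) ∈ Φ.prev m → f x = 0) :
    Φ.Comp m →ₗ[k] M :=
  Submodule.liftQ ((Φ.prev m).comap (Φ.piece m).subtype) f h

theorem AlgFiltration.symbol_mul {i j : ℕ} (x : Φ.piece i) (y : Φ.piece j) :
    Φ.symbol (i + j) ⟨(x : A) * y, Φ.mul_mem x.2 y.2⟩ = Φ.symbol i x * Φ.symbol j y := by
  rw [AlgFiltration.symbol, AlgFiltration.symbol, AlgFiltration.symbol, DirectSum.of_mul_of]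
  rfl

theorem AlgFiltration.cls_eq_zero {m : ℕ} (x : Φ.piece m) :
    Φ.cls m x = 0 ↔ (x : A) ∈ Φ.prev m :=
  Submodule.Quotient.mk_eq_zero _

end Graded

section Canonical

variable {k : Type*} [Field k] {n : ℕ} {a : Matrix (Fin n) (Fin n) ℤ} {d : Fin n → ℕ} {ζ : kˣ}
  (τ : Equiv.Perm (Fin n)) (c : Fin n → k)

/-- The map `Φ_m → H_θ ⋉ U⁻` given by the part of lowest possible height. -/
def pieceProj (had : IsSymmetrizableGCM a d) (m : ℕ) :
    (filt a d ζ τ c).piece m →ₗ[k] partialBos a d ζ τ :=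
  LinearMap.codRestrict (partialBos a d ζ τ).toSubmodule
    (heightProj ζ had (-(m : ℤ)) ∘ₗ (Bc a d ζ τ c).val.toLinearMap ∘ₗ
      ((filt a d ζ τ c).piece m).subtype)
    fun x => heightProj_mem_partialBos τ c had ((mem_uFilt_iff a d ζ τ c m x).2 x.2)

theorem coe_pieceProj (had : IsSymmetrizableGCM a d) (m : ℕ) (x : (filt a d ζ τ c).piece m) :
    (pieceProj τ c had m x : Uq a d ζ) = heightProj ζ had (-(m : ℤ)) ((x : Bc a d ζ τ c) : _) :=
  rfl

/-- The map `Φ_m / Φ_{m-1} → H_θ ⋉ U⁻` given by the part of lowest possible height. -/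
def compProj (had : IsSymmetrizableGCM a d) (m : ℕ) :
    (filt a d ζ τ c).Comp m →ₗ[k] partialBos a d ζ τ :=
  (filt a d ζ τ c).compLift (M := partialBos a d ζ τ) (pieceProj τ c had m) fun x hx =>
    Subtype.ext <| (coe_pieceProj τ c had m x).trans
      (heightProj_eq_zero_of_mem_prev τ c had ((mem_prev_iff τ c m x.1).2 hx))

theorem compProj_cls (had : IsSymmetrizableGCM a d) (m : ℕ) (x : (filt a d ζ τ c).piece m) :
    compProj τ c had m ((filt a d ζ τ c).cls m x) = pieceProj τ c had m x := rfl

/-- The canonical homomorphism `gr(B_𝐜) → H_θ ⋉ U⁻`. -/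
def canonicalHom (had : IsSymmetrizableGCM a d) :
    (filt a d ζ τ c).Gr →ₐ[k] partialBos a d ζ τ :=
  DirectSum.toAlgebra k _ (compProj τ c had)
    (Subtype.ext (heightProj_self had (one_mem_uDeg _)))
    (by
      intro i j x y
      obtain ⟨x, rfl⟩ := (filt a d ζ τ c).cls_surjective i x
      obtain ⟨y, rfl⟩ := (filt a d ζ τ c).cls_surjective j y
      exact Subtype.ext (heightProj_mul τ c had ((mem_uFilt_iff a d ζ τ c i x).2 x.2)
        ((mem_uFilt_iff a d ζ τ c j y).2 y.2)))

theorem coe_canonicalHom_symbol (had : IsSymmetrizableGCM a d) (m : ℕ)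
    (x : (filt a d ζ τ c).piece m) :
    (canonicalHom τ c had ((filt a d ζ τ c).symbol m x) : Uq a d ζ) =
      heightProj ζ had (-(m : ℤ)) ((x : Bc a d ζ τ c) : Uq a d ζ) := by
  rw [← coe_pieceProj τ c had, ← compProj_cls]
  refine congrArg Subtype.val ?_
  exact DirectSum.toAddMonoid_of (fun i => (compProj τ c had i).toAddMonoidHom) m
    ((filt a d ζ τ c).cls m x)

theorem piece_zero_le_uDeg (g : Fin n → ℤ) {x : Uq a d ζ} (hx : x ∈ (uFilt a d ζ τ c).piece 0) :
    x ∈ uDeg a d ζ g 0 := by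
  have h : (uFilt a d ζ τ c).piece 0 ≤ uDeg a d ζ g 0 := by
    refine Submodule.span_le.2 ?_
    rintro _ ⟨w, hw, rfl⟩
    induction w with
    | nil => exact one_mem_uDeg g
    | cons l w ih =>
      cases l with
      | inl i => simp at hw
      | inr i =>
        rw [bDeg_inr] at hw
        rw [List.map_cons, List.prod_cons, ← add_zero (0 : ℤ)]
        exact mul_mem_uDeg (uKτ_mem_uDeg τ g i) (ih hw)
  exact h hx

theorem isCanonical_canonicalHom (had : IsSymmetrizableGCM a d) :
    IsCanonical a d ζ τ c (canonicalHom τ c had) := by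
  constructor
  · intro i
    rw [coe_canonicalHom_symbol]
    have h := heightProj_prod_uLetter (ζ := ζ) τ c had (w := [.inl i]) (m := 1) (by simp)
    simpa [uLetter, fLetter, bGen] using h
  · intro h
    rw [coe_canonicalHom_symbol]
    exact heightProj_self had
      (piece_zero_le_uDeg τ c 1 ((mem_uFilt_iff a d ζ τ c 0 h).2 h.2))

variable {τ c}

theorem IsCanonical.apply_prod {φ : (filt a d ζ τ c).Gr →ₐ[k] partialBos a d ζ τ}
    (hφ : IsCanonical a d ζ τ c φ) (w : List (Fin n ⊕ Fin n)) (m : ℕ) (hw : bDeg w = m)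
    (h : (w.map (bGen a d ζ τ c)).prod ∈ (filt a d ζ τ c).piece m) :
    (φ ((filt a d ζ τ c).symbol m ⟨_, h⟩) : Uq a d ζ) = (w.map (fLetter a d ζ τ)).prod := by
  induction w generalizing m with
  | nil =>
    subst hw
    exact congrArg Subtype.val (map_one φ)
  | cons l w ih =>
    have hmem : (w.map (bGen a d ζ τ c)).prod ∈ (filt a d ζ τ c).piece (bDeg w) :=
      Submodule.subset_span ⟨w, le_rfl, rfl⟩
    cases l with
    | inl i =>
      obtain rfl : m = 1 + bDeg w := by rw [← hw, bDeg_inl]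
      have e := congrArg (fun x => (φ x : Uq a d ζ)) ((filt a d ζ τ c).symbol_mul
        ⟨_, bGen_inl_mem a d ζ τ c i⟩ ⟨_, hmem⟩)
      simp only [map_mul, MulMemClass.coe_mul, hφ.1, ih _ rfl] at e
      exact e
    | inr i =>
      obtain rfl : m = 0 + bDeg w := by rw [← hw, bDeg_inr, zero_add]
      have hi : bGen a d ζ τ c (.inr i) ∈ (filt a d ζ τ c).piece 0 :=
        Submodule.subset_span ⟨[.inr i], by simp, by simp⟩
      have e := congrArg (fun x => (φ x : Uq a d ζ)) ((filt a d ζ τ c).symbol_mul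
        ⟨_, hi⟩ ⟨_, hmem⟩)
      simp only [map_mul, MulMemClass.coe_mul, hφ.2, ih _ rfl] at e
      exact e

/-- Multiplicativity forces the value of `φ` on symbols of words, and the pieces are spanned by
words. This formula gives uniqueness and turns injectivity into a statement about heights. -/
theorem IsCanonical.coe_apply_symbol (had : IsSymmetrizableGCM a d)
    {φ : (filt a d ζ τ c).Gr →ₐ[k] partialBos a d ζ τ}
    (hφ : IsCanonical a d ζ τ c φ) (m : ℕ) (x : (filt a d ζ τ c).piece m) :
    (φ ((filt a d ζ τ c).symbol m x) : Uq a d ζ) =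
      heightProj ζ had (-(m : ℤ)) ((x : Bc a d ζ τ c) : Uq a d ζ) := by
  obtain ⟨x, hx⟩ := x
  let f : (filt a d ζ τ c).piece m →ₗ[k] Uq a d ζ :=
    (partialBos a d ζ τ).val.toLinearMap ∘ₗ φ.toLinearMap ∘ₗ
      DirectSum.lof k ℕ (filt a d ζ τ c).Comp m ∘ₗ (filt a d ζ τ c).cls m
  change f ⟨x, hx⟩ = _
  induction hx using Submodule.span_induction with
  | zero =>
    rw [ZeroMemClass.coe_zero, map_zero]
    exact map_zero f
  | add x y hx hy h h' =>
    change f (⟨x, hx⟩ + ⟨y, hy⟩) = heightProj ζ had (-(m : ℤ)) ((x : Uq a d ζ) + y)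
    rw [map_add, map_add, h, h']
  | smul r x hx h =>
    change f (r • ⟨x, hx⟩) = heightProj ζ had (-(m : ℤ)) (r • (x : Uq a d ζ))
    rw [map_smul, map_smul, h]
  | mem x hx =>
    obtain ⟨w, hw, rfl⟩ := hx
    have hval : (((w.map (bGen a d ζ τ c)).prod : Bc a d ζ τ c) : Uq a d ζ) =
        (w.map (uLetter a d ζ τ c)).prod := by
      rw [← Subalgebra.coe_val, map_list_prod, List.map_map]
      exact congrArg _ (List.map_congr_left fun l _ => (uLetter_eq a d ζ τ c l).symm)
    rw [hval, heightProj_prod_uLetter τ c had hw]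
    split_ifs with hm
    · exact hφ.apply_prod w m hm _
    · have h0 : (filt a d ζ τ c).cls m ⟨_, Submodule.subset_span ⟨w, hw, rfl⟩⟩ = 0 := by
        rw [AlgFiltration.cls_eq_zero]
        obtain ⟨m, rfl⟩ : ∃ l, m = l + 1 := ⟨m - 1, by omega⟩
        exact Submodule.subset_span ⟨w, by omega, rfl⟩
      simp only [f, LinearMap.comp_apply]
      rw [h0]
      simp

theorem IsCanonical.eq (had : IsSymmetrizableGCM a d)
    {φ ψ : (filt a d ζ τ c).Gr →ₐ[k] partialBos a d ζ τ}
    (hφ : IsCanonical a d ζ τ c φ) (hψ : IsCanonical a d ζ τ c ψ) : φ = ψ := by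
  refine AlgHom.ext fun z => ?_
  induction z using DirectSum.induction_on with
  | zero => rw [map_zero, map_zero]
  | add y z h h' => rw [map_add, map_add, h, h']
  | of m z =>
    obtain ⟨x, rfl⟩ := (filt a d ζ τ c).cls_surjective m z
    exact Subtype.ext ((hφ.coe_apply_symbol had m x).trans (hψ.coe_apply_symbol had m x).symm)

theorem IsCanonical.surjective {φ : (filt a d ζ τ c).Gr →ₐ[k] partialBos a d ζ τ}
    (hφ : IsCanonical a d ζ τ c φ) : Function.Surjective φ := by
  have h : partialBos a d ζ τ ≤ φ.range.map (partialBos a d ζ τ).val := by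
    refine sup_le (Algebra.adjoin_le ?_) (Algebra.adjoin_le ?_)
    · rintro _ ⟨i, rfl⟩
      have hi : bGen a d ζ τ c (.inr i) ∈ (filt a d ζ τ c).piece 0 :=
        Submodule.subset_span ⟨[.inr i], by simp, by simp⟩
      exact ⟨_, ⟨_, rfl⟩, hφ.2 ⟨_, hi⟩⟩
    · rintro _ ⟨i, rfl⟩
      exact ⟨_, ⟨_, rfl⟩, hφ.1 i⟩
  intro y
  obtain ⟨_, ⟨z, rfl⟩, hz⟩ := h y.2
  exact ⟨z, Subtype.ext hz⟩

/-- The images of the different graded components have different heights, so `φ` is injective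
exactly when it is injective on each component. -/
theorem IsCanonical.injective_iff (had : IsSymmetrizableGCM a d)
    {φ : (filt a d ζ τ c).Gr →ₐ[k] partialBos a d ζ τ} (hφ : IsCanonical a d ζ τ c φ) :
    Function.Injective φ ↔ ∀ m, ∀ x ∈ (uFilt a d ζ τ c).piece m,
      heightProj ζ had (-(m : ℤ)) x = 0 → x ∈ (uFilt a d ζ τ c).prev m := by
  rw [injective_iff_map_eq_zero]
  constructor
  · intro h m x hx h0
    rw [uFilt_piece] at hx
    obtain ⟨x, hx, rfl⟩ := hx
    have h1 := hφ.coe_apply_symbol had m ⟨x, hx⟩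
    have h2 := h _ (Subtype.ext (h1.trans h0))
    have h3 := DirectSum.of_injective (β := (filt a d ζ τ c).Comp) m (h2.trans (map_zero _).symm)
    exact (mem_prev_iff τ c m x).2 ((AlgFiltration.cls_eq_zero _ _).1 h3)
  · intro h z hz
    have key : ∀ (l : ℕ) (z : (filt a d ζ τ c).Gr), heightProj ζ had (-(l : ℤ)) (φ z : Uq a d ζ) =
        (φ (DirectSum.of (filt a d ζ τ c).Comp l (z l)) : Uq a d ζ) := by
      intro l z
      induction z using DirectSum.induction_on with
      | zero => simp
      | add y z h h' =>
        rw [map_add, AddMemClass.coe_add, map_add, h, h', DirectSum.add_apply, map_add, map_add,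
          AddMemClass.coe_add]
      | of m z =>
        obtain ⟨x, rfl⟩ := (filt a d ζ τ c).cls_surjective m z
        have h1 : (φ (DirectSum.of (filt a d ζ τ c).Comp m ((filt a d ζ τ c).cls m x)) :
            Uq a d ζ) = _ := hφ.coe_apply_symbol had m x
        have h2 := heightProj_mem_uDeg had (-(m : ℤ)) ((x : Bc a d ζ τ c) : Uq a d ζ)
        by_cases hl : m = l
        · subst hl
          rw [DirectSum.of_eq_same, h1, heightProj_self had h2]
        · rw [DirectSum.of_eq_of_ne _ _ _ (Ne.symm hl), map_zero, map_zero, h1,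
            heightProj_of_ne had (by omega) h2]
          rfl
    refine DFinsupp.ext fun l => ?_
    have h1 := key l z
    rw [hz, ZeroMemClass.coe_zero, map_zero] at h1
    obtain ⟨x, hx⟩ := (filt a d ζ τ c).cls_surjective l (z l)
    rw [← hx] at h1
    have h2 := h l _ ((mem_uFilt_iff a d ζ τ c l x).2 x.2)
      ((hφ.coe_apply_symbol had l x).symm.trans h1.symm)
    rw [← hx]
    exact (AlgFiltration.cls_eq_zero _ _).2 ((mem_prev_iff τ c l x.1).1 h2)

end Canonical

/-! ### The criterion for injectivity -/

section Injectivity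

variable {k : Type*} [Field k] {n : ℕ} {a : Matrix (Fin n) (Fin n) ℤ} {d : Fin n → ℕ} {ζ : kˣ}
  {τ : Equiv.Perm (Fin n)} (c : Fin n → k)

theorem Hθ_le_piece_zero {x : Uq a d ζ} (hx : x ∈ Hθ a d ζ τ) :
    x ∈ (uFilt a d ζ τ c).piece 0 := by
  rw [Hθ, ← Subalgebra.mem_toSubmodule, adjoin_range_toSubmodule] at hx
  refine Submodule.span_mono ?_ hx
  rintro _ ⟨w, rfl⟩
  refine ⟨w.map .inr, ?_, ?_⟩
  · induction w with
    | nil => simp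
    | cons i w ih => simpa using ih
  · rw [List.map_map]
    rfl

theorem prod_uB_mem (v : List (Fin n)) :
    (v.map (uB a d ζ τ c)).prod ∈ (uFilt a d ζ τ c).piece v.length := by
  induction v with
  | nil => exact (uFilt a d ζ τ c).one_mem
  | cons i v ih =>
    rw [List.map_cons, List.prod_cons, List.length_cons, add_comm]
    exact (uFilt a d ζ τ c).mul_mem (uB_mem a d ζ τ c i) ih

theorem mul_uKpow_of_skew {x : Uq a d ζ} {ν : Fin n → ℤ} {u : kˣ}
    (h : (uKpow a d ζ ν : Uq a d ζ) * x = (u : k) • (x * (uKpow a d ζ ν : Uq a d ζ))) :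
    x * (uKpow a d ζ ν : Uq a d ζ) = ((u⁻¹ : kˣ) : k) • ((uKpow a d ζ ν : Uq a d ζ) * x) := by
  rw [h, smul_smul, Units.inv_mul, one_smul]

/-- The words in the generators of `B_𝐜` and the corresponding words in the generators of
`H_θ ⋉ U⁻` are brought into normal form by the same scalars. -/
theorem exists_normal_form (hτ : ∀ i, τ (τ i) = i)
    (hτq : ∀ i j, chi a d ζ (τ i) (τ j) = chi a d ζ i j) (w : List (Fin n ⊕ Fin n)) :
    ∃ (s : kˣ) (ν : Fin n → ℤ) (v : List (Fin n)),
      (w.map (uLetter a d ζ τ c)).prod =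
        (s : k) • ((uKpow a d ζ ν : Uq a d ζ) * (v.map (uB a d ζ τ c)).prod) ∧
      (w.map (fLetter a d ζ τ)).prod =
        (s : k) • ((uKpow a d ζ ν : Uq a d ζ) * (v.map (uF a d ζ)).prod) ∧
      v.length = bDeg w ∧ (uKpow a d ζ ν : Uq a d ζ) ∈ Hθ a d ζ τ ∧ ∑ i, ν i = 0 ∧
      ∀ j, ζ ^ pair a d ν (τ j) = ζ ^ (-pair a d ν j) := by
  induction w with
  | nil =>
    refine ⟨1, 0, [], by simp [uKpow_zero], by simp [uKpow_zero], rfl, ?_, by simp,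
      by simp [pair_zero]⟩
    rw [uKpow_zero]
    exact Subalgebra.one_mem _
  | cons l w ih =>
    obtain ⟨s, ν, v, hB, hF, hv, hν, hs, hp⟩ := ih
    simp only [List.map_cons, List.prod_cons, hB, hF]
    cases l with
    | inl i =>
      have h1 : (uKpow a d ζ ν : Uq a d ζ) * uF a d ζ i = ((ζ ^ (-pair a d ν i) : kˣ) : k) •
          (uF a d ζ i * (uKpow a d ζ ν : Uq a d ζ)) := uKpow_uF a d ζ ν i
      -- The invariant `hp` makes $K_\nu$ pass both summands of $B_i$ with one and the same scalar,
      -- the one for $F_i$.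
      have h2 : (uKpow a d ζ ν : Uq a d ζ) * uB a d ζ τ c i = ((ζ ^ (-pair a d ν i) : kˣ) : k) •
          (uB a d ζ τ c i * (uKpow a d ζ ν : Uq a d ζ)) := by
        rw [uB_eq, mul_add, h1, mul_smul_comm, uKpow_uX, hp, add_mul, smul_add, smul_mul_assoc,
          smul_comm (c i)]
      refine ⟨s * (ζ ^ (-pair a d ν i))⁻¹, ν, i :: v, ?_, ?_, ?_, hν, hs, hp⟩
      · rw [uLetter, mul_smul_comm, ← mul_assoc, mul_uKpow_of_skew h2, smul_mul_assoc, smul_smul,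
          ← Units.val_mul, List.map_cons, List.prod_cons, mul_assoc]
      · rw [fLetter, mul_smul_comm, ← mul_assoc, mul_uKpow_of_skew h1, smul_mul_assoc, smul_smul,
          ← Units.val_mul, List.map_cons, List.prod_cons, mul_assoc]
      · rw [List.length_cons, bDeg_inl, hv, add_comm]
    | inr i =>
      refine ⟨s, Pi.single i 1 - Pi.single (τ i) 1 + ν, v, ?_, ?_, ?_, ?_, ?_, fun j => ?_⟩
      · rw [uLetter, uKτ_eq, mul_smul_comm, ← mul_assoc, ← Units.val_mul, ← uKpow_add]
      · rw [fLetter, uKτ_eq, mul_smul_comm, ← mul_assoc, ← Units.val_mul, ← uKpow_add]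
      · rw [bDeg_inr, hv]
      · rw [uKpow_add, Units.val_mul, ← uKτ_eq]
        exact Subalgebra.mul_mem _ (Algebra.subset_adjoin ⟨i, rfl⟩) hν
      · simp [Finset.sum_add_distrib, hs]
      · have e := hτq i (τ j)
        rw [hτ] at e
        rw [pair_add, pair_add, zpow_add, neg_add, zpow_add, hp, pair_sub, pair_sub, neg_sub,
          zpow_sub, zpow_sub, zpow_pair_single, zpow_pair_single, zpow_pair_single,
          zpow_pair_single, hτq, e]

/-- The map sending $K_\mu F_v$ to the class of $K_\mu B_v$ modulo lower degree respects the Serre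
relations by `serre_uB_mem`. Composed with the height projection it is the quotient map on the
`l`-th piece, so elements killed by the projection have zero class. -/
theorem mem_prev_of_heightProj_eq_zero (had : IsSymmetrizableGCM a d) (hτ : ∀ i, τ (τ i) = i)
    (hτa : ∀ i j, a (τ i) (τ j) = a i j)
    (hτq : ∀ i j, chi a d ζ (τ i) (τ j) = chi a d ζ i j)
    (hc : ∀ i, a i (τ i) = 0 → c i = c (τ i)) {l : ℕ} {x : Uq a d ζ}
    (hx : x ∈ (uFilt a d ζ τ c).piece l) (h0 : heightProj ζ had (-(l : ℤ)) x = 0) :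
    x ∈ (uFilt a d ζ τ c).prev l := by
  let N := (uFilt a d ζ τ c).prev l
  obtain ⟨g, hg⟩ := exists_linearMap_filter (ζ := ζ) had
    (fun w μ v => w = [] ∧ v.length = l ∧ (uKpow a d ζ μ : Uq a d ζ) ∈ Hθ a d ζ τ)
    (fun w w' μ v h => by rw [← List.length_eq_zero_iff, h.length_eq, List.length_eq_zero_iff])
    (fun w μ v v' h => by rw [h.length_eq])
    (fun _ μ v => N.mkQ ((uKpow a d ζ μ : Uq a d ζ) * (v.map (uB a d ζ τ c)).prod))
    (fun i j _ u w μ v h => by simp [serreWord] at h)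
    (by
      rintro i j hij w μ u v ⟨-, hl, hμ⟩
      have e := prod_serre_prod ζ (d i) (a i j) (uB a d ζ τ c) i j u v
      simp only [← map_smul, ← map_sum, ← mul_smul_comm, ← Finset.mul_sum]
      rw [← e, Submodule.mkQ_apply, Submodule.Quotient.mk_eq_zero]
      have hm := (uFilt a d ζ τ c).mul_mem (Hθ_le_piece_zero c hμ)
        ((uFilt a d ζ τ c).mul_mem ((uFilt a d ζ τ c).mul_mem (prod_uB_mem c u)
          (serre_uB_mem c had hτ hτa hτq hc hij)) (prod_uB_mem c v))
      -- A word containing a Serre word is nonempty, so the preceding piece is a genuine one. The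
      -- Serre word occupies $m+1$ of the `l` letters but contributes only degree $m$.
      obtain ⟨r, rfl⟩ : ∃ r, l = r + 1 := by
        refine ⟨l - 1, ?_⟩
        simp [serreWord] at hl
        omega
      refine (uFilt a d ζ τ c).mono ?_ hm
      simp [serreWord] at hl
      omega)
  have key : (uFilt a d ζ τ c).piece l ≤
      LinearMap.eqLocus (g ∘ₗ heightProj ζ had (-(l : ℤ))) N.mkQ := by
    refine Submodule.span_le.2 ?_
    rintro _ ⟨w, hw, rfl⟩
    rw [SetLike.mem_coe, LinearMap.mem_eqLocus, LinearMap.comp_apply,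
      heightProj_prod_uLetter τ c had hw]
    split_ifs with hl
    · obtain ⟨s, ν, v, hB, hF, hv, hν, -⟩ := exists_normal_form c hτ hτq w
      have e : (uKpow a d ζ ν : Uq a d ζ) * (v.map (uF a d ζ)).prod = uMon a d ζ [] ν v := by
        simp [uMon]
      rw [hB, hF, e, map_smul, map_smul, hg, if_pos ⟨rfl, hv.trans hl, hν⟩]
    · rw [map_zero, eq_comm, Submodule.mkQ_apply, Submodule.Quotient.mk_eq_zero]
      obtain ⟨r, rfl⟩ : ∃ r, l = r + 1 := ⟨l - 1, by omega⟩
      exact Submodule.subset_span ⟨w, by omega, rfl⟩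
  have h := key hx
  rw [LinearMap.mem_eqLocus, LinearMap.comp_apply, h0, map_zero, eq_comm, Submodule.mkQ_apply,
    Submodule.Quotient.mk_eq_zero] at h
  exact h

theorem eq_of_heightProj_eq_zero (had : IsSymmetrizableGCM a d) (hτ : ∀ i, τ (τ i) = i)
    (hτa : ∀ i j, a (τ i) (τ j) = a i j)
    (hτq : ∀ i j, chi a d ζ (τ i) (τ j) = chi a d ζ i j)
    (h : ∀ m, ∀ x ∈ (uFilt a d ζ τ c).piece m,
      heightProj ζ had (-(m : ℤ)) x = 0 → x ∈ (uFilt a d ζ τ c).prev m)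
    {i : Fin n} (ha : a i (τ i) = 0) : c i = c (τ i) := by
  have hij : i ≠ τ i := by
    intro e
    rw [← e, had.diag] at ha
    omega
  have hY := serre_uB_of_eq_zero c had hτ hτa hτq hij rfl ha
  have h2 : serre ζ (d i) (a i (τ i)) (uB a d ζ τ c i) (uB a d ζ τ c (τ i)) ∈
      (uFilt a d ζ τ c).piece 2 := by
    rw [serre_eq_qSeq_chi had, ha]
    exact (uFilt a d ζ τ c).qSeq_mem (uB_mem a d ζ τ c i) (uB_mem a d ζ τ c (τ i)) _ _ 1
  have hdeg : serre ζ (d i) (a i (τ i)) (uB a d ζ τ c i) (uB a d ζ τ c (τ i)) ∈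
      uDeg a d ζ 1 0 := by
    rw [hY]
    exact Submodule.add_mem _ (Submodule.sub_mem _ (Submodule.smul_mem _ _ (uKpow_mem_uDeg _ _))
      (Submodule.smul_mem _ _ (uKpow_mem_uDeg _ _))) (Submodule.smul_mem _ _ (uKpow_mem_uDeg _ _))
  -- An element of height $0$ has no part of height $-2$ or $-1$, so the hypothesis lowers its
  -- degree twice.
  have h1 := h 2 _ h2 (heightProj_of_ne had (by decide) hdeg)
  have h0 := h 1 _ h1 (heightProj_of_ne had (by decide) hdeg)
  -- The functional summing the coefficients of those $K_\mu$ whose exponents sum to $-2$. It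
  -- vanishes on $H_\theta$ and sees only the term $K_i^{-1}K_{\tau(i)}^{-1}$ of the commutator.
  obtain ⟨g, hg⟩ := exists_linearMap_filter (ζ := ζ) had
    (fun w μ v => w = [] ∧ v = [] ∧ ∑ l, μ l = -2)
    (fun w w' μ v h => by rw [← List.length_eq_zero_iff, h.length_eq, List.length_eq_zero_iff])
    (fun w μ v v' h => by
      rw [← List.length_eq_zero_iff (l := v), h.length_eq, List.length_eq_zero_iff])
    (fun _ _ _ => (1 : k))
    (fun i j _ u w μ v h => by simp [serreWord] at h)
    (fun i j _ w μ u v h => by simp [serreWord] at h)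
  have key : (uFilt a d ζ τ c).piece 0 ≤ LinearMap.ker g := by
    refine Submodule.span_le.2 ?_
    rintro _ ⟨w, hw, rfl⟩
    obtain ⟨s, ν, v, hB, -, hv, -, hν, -⟩ := exists_normal_form c hτ hτq w
    obtain rfl : v = [] := List.length_eq_zero_iff.1 (hv.trans (Nat.le_zero.1 hw))
    rw [SetLike.mem_coe, LinearMap.mem_ker, hB, List.map_nil, List.prod_nil, mul_one, map_smul,
      uKpow_eq_uMon, hg, if_neg (by simp [hν]), smul_zero]
  have hz := key h0
  rw [LinearMap.mem_ker, hY] at hz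
  simp only [uKpow_eq_uMon, map_add, map_sub, map_smul, hg] at hz
  rw [if_neg (by simp), if_neg (by simp), if_pos (by simp)] at hz
  simp only [mul_zero, sub_zero, zero_add, smul_eq_mul, mul_one] at hz
  exact (sub_eq_zero.1 hz).symm

end Injectivity

end QuantumPair

end

theorem proposition3p1 {k : Type*} [Field k] {n : ℕ}
    (a : Matrix (Fin n) (Fin n) ℤ) (d : Fin n → ℕ) (had : QuantumPair.IsSymmetrizableGCM a d)
    (ζ : kˣ) (hζ1 : (ζ : k) ≠ 1) (hζ2 : (ζ : k) ≠ -1)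
    (τ : Equiv.Perm (Fin n)) (hτ : ∀ i, τ (τ i) = i)
    (hτa : ∀ i j, a (τ i) (τ j) = a i j)
    (hτq : ∀ i j, ζ ^ ((d (τ i) : ℤ) * a (τ i) (τ j)) = ζ ^ ((d i : ℤ) * a i j))
    (c : Fin n → k) :
    -- the two decompositions defining `P_λ` and `π_{α,β}` are direct
    (DirectSum.IsInternal (QuantumPair.UKG a d ζ) ∧
      DirectSum.IsInternal (QuantumPair.UHU a d ζ)) ∧
    -- (i)
    (∀ i j, i ≠ j → (a i j ≠ 0 ∨ τ i ≠ j) →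
      QuantumPair.projPi a d ζ 0 0
        (QuantumPair.projP a d ζ (-((1 - a i j) • Pi.single i 1 + Pi.single j 1))
          (QuantumPair.serre ζ (d i) (a i j)
            (QuantumPair.uB a d ζ τ c i) (QuantumPair.uB a d ζ τ c j))) = 0) ∧
    (∀ i j, i ≠ j → a i j = 0 → τ i = j →
      QuantumPair.projP a d ζ (-Pi.single i 1 - Pi.single j 1)
        (QuantumPair.projPi a d ζ 0 0
          (QuantumPair.serre ζ (d i) (a i j)
            (QuantumPair.uB a d ζ τ c i) (QuantumPair.uB a d ζ τ c j))) =
        (c j - c i) • (((QuantumPair.uK a d ζ i)⁻¹ * (QuantumPair.uK a d ζ j)⁻¹ :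
          (QuantumPair.Uq a d ζ)ˣ) : QuantumPair.Uq a d ζ)) ∧
    -- (ii)
    (∃! φ : (QuantumPair.filt a d ζ τ c).Gr →ₐ[k] QuantumPair.partialBos a d ζ τ,
      QuantumPair.IsCanonical a d ζ τ c φ) ∧
    (∀ φ : (QuantumPair.filt a d ζ τ c).Gr →ₐ[k] QuantumPair.partialBos a d ζ τ,
      QuantumPair.IsCanonical a d ζ τ c φ →
        Function.Surjective φ ∧
        (Function.Bijective φ ↔ ∀ i, a i (τ i) = 0 → c i = c (τ i))) := by
  refine ⟨⟨(QuantumPair.UKG_isInternal_and_projP ζ had).1,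
      (QuantumPair.UHU_isInternal_and_projPi ζ had).1⟩,
    fun i j hij h => QuantumPair.projPi_projP_serre_uB c had hτ hij h _,
    fun i j hij ha hj => QuantumPair.projP_projPi_serre_uB c had hτ hτa hτq hij ha hj,
    ⟨QuantumPair.canonicalHom τ c had, QuantumPair.isCanonical_canonicalHom τ c had,
      fun ψ hψ => hψ.eq had (QuantumPair.isCanonical_canonicalHom τ c had)⟩,
    fun φ hφ => ⟨hφ.surjective, fun hb i ha => ?_, fun hc => ⟨?_, hφ.surjective⟩⟩⟩
  · exact QuantumPair.eq_of_heightProj_eq_zero c had hτ hτa hτq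
      ((hφ.injective_iff had).1 hb.1) ha
  · exact (hφ.injective_iff had).2 fun m x hx h0 =>
      QuantumPair.mem_prev_of_heightProj_eq_zero c had hτ hτa hτq hc hx h0
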